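/- Let $n\in\{2,3\}$, $\lambda_0,\Gamma_0,\alpha\in\mathbb R$, $\Gamma_2,\beta>0$, and assume that either $\Gamma_0<0$ and $4\alpha>\Gamma_0^2/\Gamma_2$, or $\Gamma_0\ge 0$ and $\alpha>0$. Notation. $\mathrm{FM}$ is the space of functions $u(x)=(2\pi)^{-n/2}\int_{\mathbb R^n}e^{ix\cdot\xi}\,d\hat u(\xi)$, where $\hat u$ is a finite $\mathbb C^n$-valued Borel measure on $\mathbb R^n$; $\|u\|_{\mathrm{FM}}=|\hat u|(\mathbb R^n)$ is the total variation of $\hat u$; $\mathrm{FM}_0=\{u\in\mathrm{FM}:\hat u(\{0\})=0\}$; $\mathrm{FM}^4=\{u\in\mathrm{FM}: |\xi|^4\hat u \text{ is a finite measure}\}$. For a symbol $\sigma$ on $\mathbb R^n\setminus\{0\}$, $Op(\sigma)u$ has the Fourier transform $O\mapsto\int_{O\setminus\{0\}}\sigma\,d\hat u$. Let $\sigma_P(\xi)=I-\xi\xi^T/|\xi|^2$, $P=Op(\sigma_P)$ (so $P$ is the Helmholtz projection on $\mathrm{FM}_0$, and $Pc=0$ for constants $c$), and $\mathrm{FM}_{0,\sigma}=P\,\mathrm{FM}_0$.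 Let $a(\xi)=\Gamma_2|\xi|^4+\Gamma_0|\xi|^2+\alpha$ be the symbol of $A_d=\Gamma_2\Delta^2-\Gamma_0\Delta+\alpha$, $e^{-tA_d}=Op(e^{-ta})$, and $H(u)=\beta P|u|^2u+\lambda_0P(u\cdot\nabla)u$, where $|u|^2=\sum_j|u_j|^2$. For solenoidal $u$ one has $(u\cdot\nabla)u=\sum_j\partial_j(u_ju)$, and for $t>0$ we understand $$e^{-tA_d}H(u)=\beta\,Op(e^{-ta}\sigma_P)(|u|^2u)+\lambda_0\sum_{j=1}^n Op(i\xi_je^{-ta}\sigma_P)(u_ju).$$ Given $u_0\in\mathrm{FM}_{0,\sigma}$, a global mild solution is a function $u\in \mathrm{BC}([0,\infty),\mathrm{FM}_{0,\sigma})$ with $$u(t)=e^{-tA_d}u_0-\int_0^te^{-(t-s)A_d}H(u(s))\,ds\qquad(t\ge0).$$ A classical solution is a pair $(u,\nabla q)$ with $u\in C([0,\infty),\mathrm{FM}_{0,\sigma})\cap C^1((0,\infty),\mathrm{FM}_{0,\sigma})\cap C((0,\infty),\mathrm{FM}^4)$, $\nabla q\in C((0,\infty),\mathrm{FM})$ a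 gradient field for each $t>0$, $u(0)=u_0$, and, on $(0,\infty)\times\mathbb R^n$, $$u_t+\lambda_0(u\cdot\nabla)u+(\alpha+\beta|u|^2)u-\Gamma_0\Delta u+\Gamma_2\Delta^2u+\nabla q=0,\qquad \operatorname{div}u=0 .$$ Theorem. There are $\kappa,C,\omega>0$, depending only on $n$ and the parameters, such that for every $u_0\in\mathrm{FM}_{0,\sigma}$ with $\|u_0\|_{\mathrm{FM}}<\kappa$ the following holds. 1. There is a unique global mild solution $u\in\mathrm{BC}([0,\infty),\mathrm{FM}_{0,\sigma})$, and $\|u(t)\|_{\mathrm{FM}}\le Ce^{-\omega t}\|u_0\|_{\mathrm{FM}}$ for all $t\ge0$. 2. Put $\nabla q(t):=-(I-P)\bigl[\lambda_0(u\cdot\nabla)u+(\alpha+\beta|u|^2)u\bigr](t)$ for $t>0$. Then $\nabla q\in L^1((0,T),\mathrm{FM})$ for every $T>0$, and $(u,\nabla q)$ is the unique classical solution. 3. If $u_0$ is real-valued, then so are $u$ and $\nabla q$. -/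

import Mathlib

open MeasureTheory Set
open scoped InnerProductSpace Laplacian

noncomputable section

namespace ActiveFluid

/-- The frequency and physical space `ℝⁿ` with its Euclidean structure. -/
abbrev Rn (n : ℕ) := EuclideanSpace ℝ (Fin n)

/-- The space `ℂⁿ` of values, with its Euclidean norm. -/
abbrev Cn (n : ℕ) := EuclideanSpace ℂ (Fin n)

/-- The finite `ℂⁿ`-valued Borel measures on `ℝⁿ`, i.e. those of finite total variation.
(Finite Borel measures on `ℝⁿ` are automatically regular, so these are the finite Radon
measures.) -/
def radonMeasures (n : ℕ) : Submodule ℂ (VectorMeasure (Rn n) (Cn n)) where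
  carrier := {μ | μ.variation univ < ⊤}
  zero_mem' := by simp
  add_mem' := by
    intro μ ν hμ hν
    refine lt_of_le_of_lt (VectorMeasure.variation_add_le univ) ?_
    simpa using ⟨hμ, hν⟩
  smul_mem' := by
    intro c μ hμ
    simp only [mem_ofPred_eq, VectorMeasure.variation_smul] at hμ ⊢
    simpa using ENNReal.mul_lt_top (by simp) hμ

/-- The space `FM(ℝⁿ)` of Fourier transformed finite Radon measures with values in `ℂⁿ`.
Since the Fourier transform is injective on finite measures, an element `u` is recorded by its
Fourier transform, the measure `u.hat`; it is regarded as a function on `ℝⁿ` through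
`u(x) = (2π)^(-n/2) ∫ exp(i x·ξ) dû(ξ)`, see the coercion to functions below. -/
def FM (n : ℕ) : Type := radonMeasures n

namespace FM

variable {n : ℕ}

instance : AddCommGroup (FM n) := inferInstanceAs (AddCommGroup (radonMeasures n))

instance : Module ℂ (FM n) := inferInstanceAs (Module ℂ (radonMeasures n))

/-- The Fourier transform `û` of `u ∈ FM(ℝⁿ)`, a finite vector measure. -/
def hat (u : FM n) : VectorMeasure (Rn n) (Cn n) := u.1

/-- `‖u‖_FM` is the total variation `|û|(ℝⁿ)`. -/
instance : Norm (FM n) := ⟨fun u => u.hat.variation.real univ⟩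

theorem norm_def (u : FM n) : ‖u‖ = u.hat.variation.real univ := rfl

theorem normedSpaceCore (n : ℕ) : NormedSpace.Core ℂ (FM n) where
  norm_nonneg u := measureReal_nonneg
  norm_smul c u := by
    have h : (c • u).hat = c • u.hat := rfl
    rw [norm_def, norm_def, h, VectorMeasure.variation_smul]
    simp [Measure.real]
  norm_triangle u v := by
    have h : (u + v).hat = u.hat + v.hat := rfl
    have hu : u.hat.variation univ < ⊤ := u.2
    have hv : v.hat.variation univ < ⊤ := v.2
    rw [norm_def, norm_def, norm_def, h, Measure.real, Measure.real, Measure.real,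
      ← ENNReal.toReal_add hu.ne hv.ne]
    refine ENNReal.toReal_mono (ENNReal.add_lt_top.2 ⟨hu, hv⟩).ne ?_
    exact VectorMeasure.variation_add_le univ
  norm_eq_zero_iff u := by
    have hu : u.hat.variation univ < ⊤ := u.2
    rw [norm_def, Measure.real, ENNReal.toReal_eq_zero_iff, or_iff_left hu.ne,
      Measure.measure_univ_eq_zero, VectorMeasure.variation_eq_zero]
    exact ⟨fun h => Subtype.ext h, fun h => congrArg Subtype.val h⟩

instance : NormedAddCommGroup (FM n) := NormedAddCommGroup.ofCore (normedSpaceCore n)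

instance : NormedSpace ℂ (FM n) := NormedSpace.ofCore (normedSpaceCore n)

/-- The function on `ℝⁿ` given by an element of `FM(ℝⁿ)`:
`u(x) = (2π)^(-n/2) ∫ exp(i x·ξ) dû(ξ)`. -/
def eval (u : FM n) (x : Rn n) : Cn n :=
  ((2 * Real.pi) ^ (-(n : ℝ) / 2) : ℝ) •
    VectorMeasure.integral u.hat
      (fun ξ : Rn n => Complex.exp (Complex.I * ((⟪x, ξ⟫_ℝ : ℝ) : ℂ)))
      (ContinuousLinearMap.lsmul ℝ ℂ)

instance : CoeFun (FM n) (fun _ => Rn n → Cn n) := ⟨eval⟩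

open Classical in
/-- A function `f : ℝⁿ → ℂⁿ` which belongs to `FM(ℝⁿ)`, viewed as an element of `FM(ℝⁿ)`
(and `0` if `f` does not belong to `FM(ℝⁿ)`). -/
def ofFun (f : Rn n → Cn n) : FM n :=
  if h : ∃ w : FM n, (w : Rn n → Cn n) = f then h.choose else 0

/-- The measure `û ⌊ σ`, `(û ⌊ σ)(O) = ∫_{O \ {0}} σ dû`, is finite. -/
theorem withDensity_mem (u : FM n) (σ : Rn n → Cn n →L[ℂ] Cn n) :
    u.hat.withDensity (({0}ᶜ : Set (Rn n)).indicator σ)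
      (ContinuousLinearMap.restrictScalarsL ℂ (Cn n) (Cn n) ℝ ℝ) ∈ radonMeasures n := by
  by_cases h : u.hat.Integrable (({0}ᶜ : Set (Rn n)).indicator σ)
  · refine lt_of_le_of_lt (VectorMeasure.variation_WithDensity_le univ) ?_
    rw [withDensity_apply _ MeasurableSet.univ, Measure.restrict_univ]
    exact (Integrable.of_measure_le_smul (c := (‖_‖₊ : ENNReal)) ENNReal.coe_ne_top
      (VectorMeasure.variation_transpose_le _ _) h).2
  · simp [VectorMeasure.withDensity, h]

/-- The Fourier multiplier `Op(σ)u`, i.e. the element of `FM(ℝⁿ)` with Fourier transform `û ⌊ σ`,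
for a symbol `σ` on `ℝⁿ \ {0}`. A possible point mass of `û` at the origin is discarded
(and the value is `0` if `σ` is not integrable with respect to `|û|`). -/
def op (σ : Rn n → Cn n →L[ℂ] Cn n) (u : FM n) : FM n :=
  ⟨u.hat.withDensity (({0}ᶜ : Set (Rn n)).indicator σ)
    (ContinuousLinearMap.restrictScalarsL ℂ (Cn n) (Cn n) ℝ ℝ), withDensity_mem u σ⟩

end FM

/-- `FM₀(ℝⁿ)`: the Fourier transform has no point mass at the origin. -/
def FM₀ (n : ℕ) : Set (FM n) := {u | u.hat {0} = 0}

/-- `FM^s(ℝⁿ)`, `s ∈ ℕ`: the measure `|ξ|^s û` is finite. -/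
def FMSobolev (n s : ℕ) : Set (FM n) := {u | u.hat.Integrable (fun ξ : Rn n => ‖ξ‖ ^ s)}

/-- The symbol `I - ξ ξᵀ / |ξ|²` of the Helmholtz projection. -/
def helmholtzSymbol {n : ℕ} (ξ : Rn n) : Cn n →L[ℂ] Cn n :=
  Matrix.toEuclideanCLM (n := Fin n) (𝕜 := ℂ)
    (1 - Matrix.of fun i j => ((ξ i * ξ j / ‖ξ‖ ^ 2 : ℝ) : ℂ))

/-- The Helmholtz projection `P = Op(I - ξ ξᵀ / |ξ|²)`, with `P c = 0` for constants `c`. -/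
def helmholtz {n : ℕ} (u : FM n) : FM n := u.op helmholtzSymbol

/-- The solenoidal space `FM_{0,σ}(ℝⁿ) = P FM₀(ℝⁿ)`. -/
def FM₀σ (n : ℕ) : Set (FM n) := helmholtz '' FM₀ n

/-- The symbol `Γ₂|ξ|⁴ + Γ₀|ξ|² + α` of `A_d = Γ₂Δ² - Γ₀Δ + α`. -/
def symbolAd (Γ₀ Γ₂ α : ℝ) {n : ℕ} (ξ : Rn n) : ℝ := Γ₂ * ‖ξ‖ ^ 4 + Γ₀ * ‖ξ‖ ^ 2 + α

/-- The semigroup `exp(-t A_d)`, on `FM₀(ℝⁿ)`. -/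
def semigroup (Γ₀ Γ₂ α t : ℝ) {n : ℕ} (u : FM n) : FM n :=
  u.op fun ξ => (Real.exp (-t * symbolAd Γ₀ Γ₂ α ξ) : ℂ) • ContinuousLinearMap.id ℂ (Cn n)

/-- `exp(-t A_d) H(u)` for `t > 0` and solenoidal `u`, where
`H(u) = β P|u|²u + λ₀ P(u·∇)u`. Since `div u = 0`, one has `(u·∇)u = ∑ⱼ ∂ⱼ(uⱼ u)`, and
`exp(-t A_d) P ∂ⱼ` is the multiplier with the bounded symbol
`i ξⱼ exp(-t σ(ξ)) (I - ξ ξᵀ/|ξ|²)`; so no derivative of `u` is needed. -/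
def semigroupH (lam₀ Γ₀ Γ₂ α β t : ℝ) {n : ℕ} (u : FM n) : FM n :=
  β • (FM.ofFun fun x => (‖u x‖ ^ 2 : ℝ) • u x).op
      (fun ξ => (Real.exp (-t * symbolAd Γ₀ Γ₂ α ξ) : ℂ) • helmholtzSymbol ξ) +
    lam₀ • ∑ j, (FM.ofFun fun x => u x j • u x).op
      (fun ξ => (Complex.I * (ξ j : ℂ) * (Real.exp (-t * symbolAd Γ₀ Γ₂ α ξ) : ℂ)) •
        helmholtzSymbol ξ)

/-- `u ∈ BC([0,∞), FM_{0,σ}(ℝⁿ))` (only the values on `[0,∞)` matter) is a global mild solution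
with initial value `u₀`:
`u(t) = exp(-t A_d) u₀ - ∫₀ᵗ exp(-(t-s) A_d) H(u(s)) ds` for `t ≥ 0`. -/
structure IsGlobalMildSolution (lam₀ Γ₀ Γ₂ α β : ℝ) {n : ℕ} (u₀ : FM n) (u : ℝ → FM n) :
    Prop where
  mem : ∀ t, 0 ≤ t → u t ∈ FM₀σ n
  continuousOn : ContinuousOn u (Ici 0)
  bounded : ∃ R : ℝ, ∀ t, 0 ≤ t → ‖u t‖ ≤ R
  integrable : ∀ t, 0 ≤ t → IntervalIntegrable
    (fun s => semigroupH lam₀ Γ₀ Γ₂ α β (t - s) (u s)) volume 0 t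
  formula : ∀ t, 0 ≤ t → u t = semigroup Γ₀ Γ₂ α t u₀ -
    ∫ s in (0 : ℝ)..t, semigroupH lam₀ Γ₀ Γ₂ α β (t - s) (u s)

/-- The partial derivative `∂ⱼ f` of a function `f` on `ℝⁿ`. -/
def partialDeriv {n : ℕ} (j : Fin n) (f : Rn n → Cn n) (x : Rn n) : Cn n :=
  fderiv ℝ f x (EuclideanSpace.single j 1)

/-- The convective derivative `(f·∇)f = ∑ⱼ fⱼ ∂ⱼ f`. -/
def convection {n : ℕ} (f : Rn n → Cn n) (x : Rn n) : Cn n :=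
  ∑ j, f x j • partialDeriv j f x

/-- The element `λ₀(u·∇)u + (α + β|u|²)u` of `FM(ℝⁿ)`. -/
def lowerOrderTerms (lam₀ α β : ℝ) {n : ℕ} (u : FM n) : FM n :=
  FM.ofFun fun x => lam₀ • convection u x + (α + β * ‖u x‖ ^ 2) • u x

/-- The recovered pressure gradient `∇q = -(I - P)[λ₀(u·∇)u + (α + β|u|²)u]`. -/
def pressureGradient (lam₀ α β : ℝ) {n : ℕ} (u : FM n) : FM n :=
  -(lowerOrderTerms lam₀ α β u - helmholtz (lowerOrderTerms lam₀ α β u))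

/-- The pair `(u, g)`, `g = ∇q`, is a classical solution on `(0,∞) × ℝⁿ` of
`u_t + λ₀(u·∇)u + (α + β|u|²)u - Γ₀Δu + Γ₂Δ²u + ∇q = 0`, `div u = 0`, `u(0) = u₀`, where
`u ∈ C([0,∞), FM_{0,σ}) ∩ C¹((0,∞), FM_{0,σ}) ∩ C((0,∞), FM⁴)` and `∇q ∈ C((0,∞), FM)`. -/
structure IsClassicalSolution (lam₀ Γ₀ Γ₂ α β : ℝ) {n : ℕ} (u₀ : FM n) (u g : ℝ → FM n) :
    Prop where
  mem : ∀ t, 0 ≤ t → u t ∈ FM₀σ n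
  initial : u 0 = u₀
  continuousOn : ContinuousOn u (Ici 0)
  differentiableAt : ∀ t, 0 < t → DifferentiableAt ℝ u t
  continuousOn_deriv : ContinuousOn (deriv u) (Ioi 0)
  mem_sobolev : ∀ t, 0 < t → u t ∈ FMSobolev n 4
  continuousOn_sobolev : ContinuousOn
    (fun t => (u t).op fun ξ => ((‖ξ‖ ^ 4 : ℝ) : ℂ) • ContinuousLinearMap.id ℂ (Cn n)) (Ioi 0)
  continuousOn_pressure : ContinuousOn g (Ioi 0)
  /-- `g t = ∇q(t)` for some scalar function `q(t)` on `ℝⁿ`. -/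
  gradient : ∀ t, 0 < t → ∃ q : Rn n → ℂ, Differentiable ℝ q ∧
    ∀ x j, fderiv ℝ q x (EuclideanSpace.single j 1) = g t x j
  divergence_free : ∀ t, 0 < t → ∀ x, ∑ j, partialDeriv j (u t) x j = 0
  momentum : ∀ t, 0 < t → ∀ x,
    (deriv u t) x + lam₀ • convection (u t) x + (α + β * ‖u t x‖ ^ 2) • u t x
      - Γ₀ • (Δ (u t : Rn n → Cn n)) x + Γ₂ • (Δ (Δ (u t : Rn n → Cn n))) x + g t x = 0

/-- The function `u` takes values in `ℝⁿ`. -/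
def FM.IsReal {n : ℕ} (u : FM n) : Prop := ∀ x j, (u x j).im = 0

end ActiveFluid

end

noncomputable section

/-! ### Vector measures with a density, and uniqueness for the Fourier transform -/

namespace MeasureTheory

variable {X E F G : Type*} {mX : MeasurableSpace X}
  [NormedAddCommGroup E] [NormedSpace ℝ E]
  [NormedAddCommGroup F] [NormedSpace ℝ F] [CompleteSpace F]
  [NormedAddCommGroup G] [NormedSpace ℝ G] [CompleteSpace G]

/-! An element of FM is a finite vector measure on frequency space, hence by Radon–Nikodym an L¹
density over a scalar measure. In this picture a Fourier multiplier is multiplication by its symbol,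
with operator norm at most the supremum of the symbol. The product u_j v is the image of a product
measure under addition of frequencies, a bounded bilinear operation with constant (2π)^(-n/2). Since
the Fourier transform is injective (`eval_injective`), identities between functions and identities
in FM can be exchanged freely.

The stability condition bounds the symbol a from below by a multiple of (1+|ξ|²)²
(`isCoerciveSymbol_symbolAd`). Hence e^(-τA_d) decays exponentially, and a multiplier of order 4θ
composed with it costs τ^(-θ) (`norm_mul_exp_le`). The divergence in the convective term therefore
costs only τ^(-1/4), which is integrable. The nonlinearity vanishes to second order at 0, so for
small data the Duhamel map is a contraction in an exponentially weighted space
(`exists_eq_integral`). Uniqueness needs no smallness: it follows from a Gronwall inequality for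
weakly singular kernels (`eq_zero_of_le_integral`).

Unbounded operators are avoided by describing their domains as ranges of powers of the resolvent
(1-Δ)⁻¹. Four derivatives on the Duhamel integral would be too singular, but two derivatives
together with the divergence cost τ^(-3/4). So u = (1-Δ)⁻¹y for t > 0. By the Leibniz rule on the
frequency side (`B_res_res`), y solves an integral equation of the same type, and a second pass
gives u = (1-Δ)⁻²z (`exists_smoothing`). Then every term of the equation is continuous in FM and u
is differentiable in time.

The pointwise momentum equation is equivalent to an identity in FM (`momentum_iff`). P annihilates
gradients, even if the potential is not in FM (`helm_eq_zero_of_gradient`), and the range of I-P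
consists of gradients (`exists_potential_sub_helm`). So the equation splits into an evolution
equation for u and a formula for ∇q. Conversely, a classical solution satisfies the variation of
constants formula on [ε,t]; letting ε → 0 shows that it is mild, and uniqueness carries over. The
first smoothing pass bounds y by t^(-1/2) near 0, which makes ∇q integrable in time. If u₀ is real,
the conjugate of u solves the same equation, so u is real. -/

omit [NormedSpace ℝ E] in
theorem integrable_variation_withDensityᵥ {m : Measure X} {f : X → F} (hf : Integrable f m)
    {g : X → E} (hg : AEStronglyMeasurable g m) :
    (m.withDensityᵥ f).Integrable g ↔ Integrable (fun x => ‖f x‖ * ‖g x‖) m := by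
  have hg' : AEStronglyMeasurable g (m.withDensityᵥ f).variation := by
    rw [Measure.variation_withDensityᵥ hf]
    exact hg.mono_ac (withDensity_absolutelyContinuous _ _)
  unfold VectorMeasure.Integrable
  rw [← integrable_norm_iff hg', Measure.variation_withDensityᵥ hf,
    integrable_withDensity_iff_integrable_smul₀' hf.aestronglyMeasurable.enorm
      (ae_of_all _ fun x => enorm_lt_top)]
  simp

/-- Integration against a vector measure with a density. -/
theorem integral_withDensityᵥ {m : Measure X} {f : X → F} (hf : Integrable f m)
    {g : X → E} (hg : (m.withDensityᵥ f).Integrable g)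
    (B : E →L[ℝ] F →L[ℝ] G) :
    (m.withDensityᵥ f).integral g B = ∫ x, B (g x) (f x) ∂m := by
  set ν := (m.withDensityᵥ f).variation with hν
  have hνm : ν = m.withDensity fun x => ‖f x‖ₑ := Measure.variation_withDensityᵥ hf
  let h : X → F := fun x => ‖f x‖⁻¹ • f x
  have hm : AEStronglyMeasurable h ν := by
    rw [hνm]
    exact AEStronglyMeasurable.mono_ac (withDensity_absolutelyContinuous _ _)
      (hf.aestronglyMeasurable.norm.inv₀.smul hf.aestronglyMeasurable)
  have hb : ∀ x, ‖h x‖ ≤ 1 := fun x => by simp [h, norm_smul, inv_mul_le_one]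
  have conv : ∀ g : X → E, ∫ x, B (g x) (f x) ∂m = ∫ x, B (g x) (h x) ∂ν := by
    intro g
    rw [hνm, integral_withDensity_eq_integral_toReal_smul₀ hf.aestronglyMeasurable.enorm
      (ae_of_all _ fun _ => enorm_lt_top)]
    refine integral_congr_ae (ae_of_all _ fun x => ?_)
    by_cases hx : f x = 0
    · simp [hx]
    · simp [h, smul_smul, hx]
  have hB : ∀ g : X → E, Integrable g ν → Integrable (fun x => B (g x) (h x)) ν := by
    intro g hg
    refine (hg.norm.const_mul ‖B‖).mono' (B.aestronglyMeasurable_comp₂ hg.1 hm) ?_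
    refine ae_of_all _ fun x => (B.le_opNorm₂ _ _).trans ?_
    exact mul_le_of_le_one_right (by positivity) (hb x)
  rw [conv]
  refine Integrable.induction (μ := ν)
    (P := fun g => (m.withDensityᵥ f).integral g B = ∫ x, B (g x) (h x) ∂ν)
    ?_ ?_ ?_ ?_ hg
  · intro c s hs hsν
    have : IsFiniteMeasure (ν.restrict s) := ⟨by simpa using hsν⟩
    rw [VectorMeasure.integral_indicator_const c hs, ← conv, withDensityᵥ_apply hf hs,
      ← ContinuousLinearMap.integral_comp_comm _ hf.integrableOn, ← integral_indicator hs]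
    refine integral_congr_ae (ae_of_all _ fun x => ?_)
    by_cases hx : x ∈ s <;> simp [hx]
  · intro g g' _ hg hg' e e'
    rw [VectorMeasure.integral_add hg hg', e, e', ← integral_add (hB g hg) (hB g' hg')]
    simp
  · refine isClosed_eq VectorMeasure.continuous_integral ?_
    refine (LipschitzWith.of_dist_le_mul (K := ‖B‖₊) fun g g' => ?_).continuous
    rw [dist_eq_norm, dist_eq_norm, L1.norm_eq_integral_norm, ← integral_sub
      (hB _ (L1.integrable_coeFn g)) (hB _ (L1.integrable_coeFn g')), coe_nnnorm,
      ← integral_const_mul]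
    refine norm_integral_le_of_norm_le ((L1.integrable_coeFn (g - g')).norm.const_mul _) ?_
    filter_upwards [Lp.coeFn_sub g g'] with x hx
    rw [hx, Pi.sub_apply, ← sub_apply, ← map_sub]
    exact (B.le_opNorm₂ _ _).trans (mul_le_of_le_one_right (by positivity) (hb x))
  · intro g g' hgg' _ e
    rw [← VectorMeasure.integral_congr_ae hgg', e]
    refine integral_congr_ae ?_
    filter_upwards [hgg'] with x hx
    rw [hx]

omit [CompleteSpace F] in
theorem withDensityᵥ_restrict {m : Measure X} {f : X → F} (hf : Integrable f m) {s : Set X}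
    (hs : MeasurableSet s) :
    (m.withDensityᵥ f).restrict s = (m.restrict s).withDensityᵥ f := by
  ext t ht
  rw [VectorMeasure.restrict_apply _ hs ht, withDensityᵥ_apply hf (ht.inter hs),
    withDensityᵥ_apply hf.restrict ht, Measure.restrict_restrict ht]

/-- The real and imaginary parts of each coordinate are signed measures absolutely continuous with
respect to m, so scalar Radon–Nikodym applies to each of them and the densities are reassembled. -/
theorem exists_withDensityᵥ_eq {k : ℕ} (μ : VectorMeasure X (EuclideanSpace ℂ (Fin k)))
    (m : Measure X) [SigmaFinite m] (h : μ.variation ≪ m) :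
    ∃ f : X → EuclideanSpace ℂ (Fin k), StronglyMeasurable f ∧ Integrable f m ∧
      μ = m.withDensityᵥ f := by
  let L (i : Fin k) : EuclideanSpace ℂ (Fin k) →L[ℝ] ℂ :=
    (EuclideanSpace.proj i : EuclideanSpace ℂ (Fin k) →L[ℂ] ℂ).restrictScalars ℝ
  have hac : ∀ T : EuclideanSpace ℂ (Fin k) →L[ℝ] ℝ,
      (μ.mapRange (T : EuclideanSpace ℂ (Fin k) →+ ℝ) T.continuous) ≪ᵥ
        m.toENNRealVectorMeasure := by
    intro T
    refine VectorMeasure.AbsolutelyContinuous.mk fun s hs h0 => ?_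
    rw [Measure.toENNRealVectorMeasure_apply_measurable hs] at h0
    have : μ s = 0 := by
      have h1 := VectorMeasure.enorm_measure_le_variation μ s
      rw [h h0] at h1
      simpa using h1
    change T (μ s) = 0
    simp [this]
  choose r hr using fun T : EuclideanSpace ℂ (Fin k) →L[ℝ] ℝ =>
    (⟨_, SignedMeasure.measurable_rnDeriv _ m, SignedMeasure.integrable_rnDeriv _ m,
      SignedMeasure.withDensityᵥ_rnDeriv_eq _ m (hac T)⟩ :
      ∃ r : X → ℝ, Measurable r ∧ Integrable r m ∧ m.withDensityᵥ r =
        (μ.mapRange (T : EuclideanSpace ℂ (Fin k) →+ ℝ) T.continuous))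
  let f : X → EuclideanSpace ℂ (Fin k) := fun x => WithLp.toLp 2 fun i =>
    ((r (Complex.reCLM.comp (L i)) x : ℂ) + (r (Complex.imCLM.comp (L i)) x : ℂ) * Complex.I)
  have hm : Measurable f := by
    refine (WithLp.measurable_toLp 2 _).comp (measurable_pi_lambda _ fun i => ?_)
    have h1 := (hr (Complex.reCLM.comp (L i))).1
    have h2 := (hr (Complex.imCLM.comp (L i))).1
    fun_prop
  have hi : Integrable f m := by
    refine Integrable.of_eval_piLp fun i => ?_
    have h1 := (hr (Complex.reCLM.comp (L i))).2.1
    have h2 := (hr (Complex.imCLM.comp (L i))).2.1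
    exact h1.ofReal.add (h2.ofReal.mul_const _)
  refine ⟨f, hm.stronglyMeasurable, hi, ?_⟩
  ext s hs i
  rw [withDensityᵥ_apply hi hs]
  have h1 := (hr (Complex.reCLM.comp (L i))).2
  have h2 := (hr (Complex.imCLM.comp (L i))).2
  have e : (∫ x in s, f x ∂m) i = ∫ x in s, f x i ∂m :=
    ((L i).integral_comp_comm hi.integrableOn).symm
  have e1 : m.withDensityᵥ (r (Complex.reCLM.comp (L i))) s = (μ s i).re :=
    congrArg (fun ν : VectorMeasure X ℝ => ν s) h1.2
  have e2 : m.withDensityᵥ (r (Complex.imCLM.comp (L i))) s = (μ s i).im :=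
    congrArg (fun ν : VectorMeasure X ℝ => ν s) h2.2
  rw [withDensityᵥ_apply h1.1 hs] at e1
  rw [withDensityᵥ_apply h2.1 hs] at e2
  rw [e]
  change _ = ∫ x in s, _ ∂m
  have e3 : (∫ x in s, ((r (Complex.reCLM.comp (L i)) x : ℂ) +
      (r (Complex.imCLM.comp (L i)) x : ℂ) * Complex.I) ∂m) =
      ((∫ x in s, r (Complex.reCLM.comp (L i)) x ∂m : ℝ) : ℂ) +
      ((∫ x in s, r (Complex.imCLM.comp (L i)) x ∂m : ℝ) : ℂ) * Complex.I := by
    rw [integral_add h1.1.ofReal.restrict (h2.1.ofReal.mul_const _).restrict,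
      integral_mul_const, integral_complex_ofReal, integral_complex_ofReal]
  rw [e3, e1, e2, Complex.re_add_im]

/-- The hypothesis says that the finite positive measures with densities f⁺ and f⁻ have the same
characteristic function. Hence they coincide, f⁺ = f⁻ almost everywhere, and f = 0. -/
theorem ae_eq_zero_of_forall_integral_exp_real {E : Type*} [NormedAddCommGroup E]
    [InnerProductSpace ℝ E] [MeasurableSpace E] [BorelSpace E] [SecondCountableTopology E]
    [CompleteSpace E] {m : Measure E} [SigmaFinite m] {f : E → ℝ} (hf : Integrable f m)
    (h : ∀ x : E, ∫ ξ, Complex.exp (Complex.I * ((⟪x, ξ⟫_ℝ : ℝ) : ℂ)) * (f ξ : ℂ) ∂m = 0) :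
    f =ᵐ[m] 0 := by
  have := isFiniteMeasure_withDensity_ofReal hf.2
  have := isFiniteMeasure_withDensity_ofReal hf.neg.2
  have key : m.withDensity (fun x => ENNReal.ofReal (f x)) =
      m.withDensity (fun x => ENNReal.ofReal (-f x)) := by
    refine Measure.ext_of_charFun ?_
    ext x
    have hx := h x
    have hmul : ∀ g : E → ℝ, Integrable g m →
        Integrable (fun ξ => Complex.exp (Complex.I * ((⟪x, ξ⟫_ℝ : ℝ) : ℂ)) * (g ξ : ℂ)) m := by
      intro g hg
      refine hg.ofReal.bdd_mul (c := 1) ?_ (ae_of_all _ fun ξ => ?_)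
      · exact Continuous.aestronglyMeasurable (by fun_prop)
      · rw [mul_comm, Complex.norm_exp_ofReal_mul_I]
    rw [charFun_apply, charFun_apply]
    have conv : ∀ g : E → ℝ, Integrable g m →
        ∫ ξ, Complex.exp (((⟪ξ, x⟫_ℝ : ℝ) : ℂ) * Complex.I)
          ∂(m.withDensity fun x => ENNReal.ofReal (g x)) =
        ∫ ξ, Complex.exp (Complex.I * ((⟪x, ξ⟫_ℝ : ℝ) : ℂ)) * (max (g ξ) 0 : ℝ) ∂m := by
      intro g hg
      rw [integral_withDensity_eq_integral_toReal_smul₀ hg.aemeasurable.ennreal_ofReal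
        (ae_of_all _ fun _ => ENNReal.ofReal_lt_top)]
      refine integral_congr_ae (ae_of_all _ fun ξ => ?_)
      simp only [ENNReal.toReal_ofReal', Complex.real_smul]
      rw [real_inner_comm, mul_comm, mul_comm (Complex.I)]
    rw [conv f hf, conv (fun ξ => -f ξ) hf.neg, ← sub_eq_zero, ← integral_sub (hmul _ hf.pos_part)
      (hmul (fun ξ => max (-f ξ) 0) hf.neg.pos_part), ← hx]
    refine integral_congr_ae (ae_of_all _ fun ξ => ?_)
    simp only [← mul_sub]
    congr 1
    norm_cast
    rcases le_total 0 (f ξ) with h | h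
    · simp [h]
    · simp [h]
  replace key := (withDensity_eq_iff hf.aemeasurable.ennreal_ofReal
    hf.neg.aemeasurable.ennreal_ofReal ?_).1 key
  · filter_upwards [key] with ξ hξ
    have := congrArg ENNReal.toReal hξ
    simp only [ENNReal.toReal_ofReal', Pi.zero_apply] at this ⊢
    rcases le_total 0 (f ξ) with h | h
    · simpa [h] using this
    · simpa [h] using this.symm
  · exact (lt_top_iff_ne_top.1 (by simpa using measure_lt_top (m.withDensity fun x => ENNReal.ofReal (f x)) univ))

/-- Conjugating the hypothesis at -x shows that the conjugate of f also has vanishing transform; so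
do the real and imaginary parts, to which the real case applies. -/
theorem ae_eq_zero_of_forall_integral_exp {E : Type*} [NormedAddCommGroup E]
    [InnerProductSpace ℝ E] [MeasurableSpace E] [BorelSpace E] [SecondCountableTopology E]
    [CompleteSpace E] {m : Measure E} [SigmaFinite m] {f : E → ℂ} (hf : Integrable f m)
    (h : ∀ x : E, ∫ ξ, Complex.exp (Complex.I * ((⟪x, ξ⟫_ℝ : ℝ) : ℂ)) * f ξ ∂m = 0) :
    f =ᵐ[m] 0 := by
  have hmul : ∀ (x : E) (g : E → ℂ), Integrable g m →
      Integrable (fun ξ => Complex.exp (Complex.I * ((⟪x, ξ⟫_ℝ : ℝ) : ℂ)) * g ξ) m := by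
    intro x g hg
    refine hg.bdd_mul (c := 1) ?_ (ae_of_all _ fun ξ => ?_)
    · exact Continuous.aestronglyMeasurable (by fun_prop)
    · rw [mul_comm, Complex.norm_exp_ofReal_mul_I]
  have hc : Integrable (fun ξ => (starRingEnd ℂ) (f ξ)) m :=
    Complex.conjCLE.toContinuousLinearMap.integrable_comp hf
  have h' : ∀ x : E, ∫ ξ, Complex.exp (Complex.I * ((⟪x, ξ⟫_ℝ : ℝ) : ℂ)) *
      (starRingEnd ℂ) (f ξ) ∂m = 0 := by
    intro x
    have := congrArg (starRingEnd ℂ) (h (-x))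
    rw [← integral_conj, map_zero] at this
    rw [← this]
    refine integral_congr_ae (ae_of_all _ fun ξ => ?_)
    simp only [map_mul, ← Complex.exp_conj, Complex.conj_I, Complex.conj_ofReal, inner_neg_left]
    push_cast
    ring_nf
  have hre := ae_eq_zero_of_forall_integral_exp_real hf.re (fun x => by
    have := (integral_add (hmul x _ hf) (hmul x _ hc)).symm
    rw [h, h', add_zero] at this
    have e : ∀ ξ, Complex.exp (Complex.I * ((⟪x, ξ⟫_ℝ : ℝ) : ℂ)) * (((f ξ).re : ℝ) : ℂ) =
        (1 / 2 : ℂ) * (Complex.exp (Complex.I * ((⟪x, ξ⟫_ℝ : ℝ) : ℂ)) * f ξ +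
          Complex.exp (Complex.I * ((⟪x, ξ⟫_ℝ : ℝ) : ℂ)) * (starRingEnd ℂ) (f ξ)) := by
      intro ξ
      rw [← mul_add, Complex.add_conj]; push_cast; ring
    simp only [RCLike.re_to_complex, e]
    rw [integral_const_mul, ← this, mul_zero])
  have him := ae_eq_zero_of_forall_integral_exp_real hf.im (fun x => by
    have := (integral_sub (hmul x _ hf) (hmul x _ hc)).symm
    rw [h, h', sub_zero] at this
    have e : ∀ ξ, Complex.exp (Complex.I * ((⟪x, ξ⟫_ℝ : ℝ) : ℂ)) * (((f ξ).im : ℝ) : ℂ) =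
        (-Complex.I / 2 : ℂ) * (Complex.exp (Complex.I * ((⟪x, ξ⟫_ℝ : ℝ) : ℂ)) * f ξ -
          Complex.exp (Complex.I * ((⟪x, ξ⟫_ℝ : ℝ) : ℂ)) * (starRingEnd ℂ) (f ξ)) := by
      intro ξ
      rw [← mul_sub, Complex.sub_conj]; push_cast; ring_nf; simp
    simp only [RCLike.im_to_complex, e]
    rw [integral_const_mul, ← this, mul_zero])
  filter_upwards [hre, him] with ξ h1 h2
  exact Complex.ext (by simpa using h1) (by simpa using h2)

end MeasureTheory

/-! ### The Banach space FM: densities, evaluation, completeness -/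

namespace ActiveFluid

namespace FM

variable {n : ℕ} {X : Type*} {mX : MeasurableSpace X}

theorem hat_injective : Function.Injective (hat : FM n → _) := Subtype.val_injective

theorem hat_add (u v : FM n) : (u + v).hat = u.hat + v.hat := rfl

theorem hat_smul (c : ℂ) (u : FM n) : (c • u).hat = c • u.hat := rfl

instance (u : FM n) : IsFiniteMeasure u.hat.variation := ⟨u.2⟩

theorem map_withDensityᵥ_mem (m : Measure X) (φ : X → Rn n) (f : X → Cn n) :
    (m.withDensityᵥ f).map φ ∈ radonMeasures n := by
  by_cases hf : Integrable f m
  · by_cases hφ : Measurable φ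
    · refine lt_of_le_of_lt (VectorMeasure.variation_map_le univ) ?_
      rw [Measure.map_apply hφ MeasurableSet.univ, Measure.variation_withDensityᵥ hf]
      simpa using! hf.2
    · rw [VectorMeasure.map_not_measurable _ hφ]
      exact zero_mem _
  · simp [Measure.withDensityᵥ, hf]

/-- The element of `FM` whose Fourier transform is the image under `φ` of the vector measure with
density `f` with respect to `m`. -/
def push (m : Measure X) (φ : X → Rn n) (f : X → Cn n) : FM n :=
  ⟨(m.withDensityᵥ f).map φ, map_withDensityᵥ_mem m φ f⟩

theorem hat_push (m : Measure X) (φ : X → Rn n) (f : X → Cn n) :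
    (push m φ f).hat = (m.withDensityᵥ f).map φ := rfl

theorem push_add {m : Measure X} {φ : X → Rn n} {f g : X → Cn n} (hf : Integrable f m)
    (hg : Integrable g m) : push m φ (fun x => f x + g x) = push m φ f + push m φ g := by
  apply hat_injective
  rw [hat_add, hat_push, hat_push, hat_push, withDensityᵥ_add' hf hg, VectorMeasure.map_add]

theorem push_smul (m : Measure X) (φ : X → Rn n) (c : ℂ) (f : X → Cn n) :
    push m φ (fun x => c • f x) = c • push m φ f := by
  apply hat_injective
  rw [hat_smul, hat_push, hat_push, withDensityᵥ_smul', VectorMeasure.map_smul]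

theorem push_zero (m : Measure X) (φ : X → Rn n) : push m φ (fun _ => 0) = 0 := by
  simpa using push_smul m φ 0 (fun _ => 0)

theorem push_sub {m : Measure X} {φ : X → Rn n} {f g : X → Cn n} (hf : Integrable f m)
    (hg : Integrable g m) : push m φ (fun x => f x - g x) = push m φ f - push m φ g := by
  have := push_add (φ := φ) (hf.sub hg) hg
  simp only [Pi.sub_apply, sub_add_cancel] at this
  rw [this, add_sub_cancel_right]
  rfl

theorem push_finset_sum {ι : Type*} (s : Finset ι) {m : Measure X} {φ : X → Rn n}
    {f : ι → X → Cn n} (hf : ∀ i ∈ s, Integrable (f i) m) :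
    push m φ (fun x => ∑ i ∈ s, f i x) = ∑ i ∈ s, push m φ (f i) := by
  classical
  induction s using Finset.induction_on with
  | empty => simp [push_zero]
  | insert i s hi ih =>
    simp only [Finset.sum_insert hi]
    rw [push_add (hf i (by simp)) (integrable_finsetSum s fun j hj => hf j (by simp [hj])),
      ih fun j hj => hf j (by simp [hj])]

theorem push_congr {m : Measure X} {φ : X → Rn n} {f g : X → Cn n} (h : f =ᵐ[m] g) :
    push m φ f = push m φ g := by
  apply hat_injective
  rw [hat_push, hat_push, WithDensityᵥEq.congr_ae h]

theorem norm_push_le {m : Measure X} {φ : X → Rn n} (hφ : Measurable φ) {f : X → Cn n}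
    (hf : Integrable f m) : ‖push m φ f‖ ≤ ∫ x, ‖f x‖ ∂m := by
  rw [norm_def, Measure.real, integral_norm_eq_lintegral_enorm hf.aestronglyMeasurable]
  refine ENNReal.toReal_mono hf.2.ne ?_
  refine (VectorMeasure.variation_map_le univ).trans ?_
  rw [Measure.map_apply hφ MeasurableSet.univ, Measure.variation_withDensityᵥ hf]
  simp

theorem norm_push_id {m : Measure (Rn n)} {f : Rn n → Cn n}
    (hf : Integrable f m) : ‖push m id f‖ = ∫ x, ‖f x‖ ∂m := by
  rw [norm_def, Measure.real, integral_norm_eq_lintegral_enorm hf.aestronglyMeasurable,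
    hat_push, VectorMeasure.map_id, Measure.variation_withDensityᵥ hf]
  simp

theorem push_id_eq_zero_iff {m : Measure (Rn n)} {f : Rn n → Cn n}
    (hf : Integrable f m) : push m id f = 0 ↔ f =ᵐ[m] 0 := by
  rw [← norm_eq_zero, norm_push_id hf, integral_eq_zero_iff_of_nonneg (fun _ => norm_nonneg _)
    hf.norm]
  refine Filter.eventually_congr (ae_of_all _ fun x => ?_)
  simp

/-- This reduces statements about vector measures to statements about L¹ functions over any
convenient dominating measure. -/
theorem exists_push (u : FM n) (m : Measure (Rn n)) [SigmaFinite m] (h : u.hat.variation ≪ m) :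
    ∃ f : Rn n → Cn n, StronglyMeasurable f ∧ Integrable f m ∧ u = push m id f := by
  obtain ⟨f, hf, hi, e⟩ := exists_withDensityᵥ_eq u.hat m h
  refine ⟨f, hf, hi, hat_injective ?_⟩
  rw [hat_push, VectorMeasure.map_id, e]

/-- The sum of the two variations dominates both, so two elements can be compared as L¹ functions
over one measure. -/
theorem exists_push_pair (u v : FM n) : ∃ (m : Measure (Rn n)) (f g : Rn n → Cn n),
    IsFiniteMeasure m ∧ StronglyMeasurable f ∧ Integrable f m ∧ StronglyMeasurable g ∧
    Integrable g m ∧ u = push m id f ∧ v = push m id g := by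
  obtain ⟨f, hf, hfi, hu⟩ := exists_push u (u.hat.variation + v.hat.variation)
    (Measure.absolutelyContinuous_of_le (Measure.le_add_right le_rfl))
  obtain ⟨g, hg, hgi, hv⟩ := exists_push v (u.hat.variation + v.hat.variation)
    (Measure.absolutelyContinuous_of_le (Measure.le_add_left le_rfl))
  exact ⟨_, f, g, inferInstance, hf, hfi, hg, hgi, hu, hv⟩

theorem integrable_exp_smul {m : Measure X} {φ : X → Rn n} (hφ : Measurable φ) {f : X → Cn n}
    (hf : Integrable f m) (x : Rn n) :
    Integrable (fun y => Complex.exp (Complex.I * ((⟪x, φ y⟫_ℝ : ℝ) : ℂ)) • f y) m := by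
  refine hf.bdd_smul (φ := fun y => Complex.exp (Complex.I * ((⟪x, φ y⟫_ℝ : ℝ) : ℂ))) (C := 1) ?_
    (ae_of_all _ fun y => ?_)
  · exact Measurable.aestronglyMeasurable (by fun_prop)
  · rw [mul_comm, Complex.norm_exp_ofReal_mul_I]

theorem eval_push {m : Measure X} {φ : X → Rn n} (hφ : Measurable φ) {f : X → Cn n}
    (hf : Integrable f m) (x : Rn n) :
    push m φ f x = ((2 * Real.pi) ^ (-(n : ℝ) / 2) : ℝ) •
      ∫ y, Complex.exp (Complex.I * ((⟪x, φ y⟫_ℝ : ℝ) : ℂ)) • f y ∂m := by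
  have hc : Continuous fun ξ : Rn n => Complex.exp (Complex.I * ((⟪x, ξ⟫_ℝ : ℝ) : ℂ)) := by
    fun_prop
  rw [eval, hat_push, VectorMeasure.integral_map hφ hc.aestronglyMeasurable,
    integral_withDensityᵥ hf]
  · simp
  all_goals
  · refine (integrable_variation_withDensityᵥ hf
      (hc.measurable.comp hφ).aestronglyMeasurable).2 ?_
    refine hf.norm.congr (ae_of_all _ fun y => ?_)
    simp only [Function.comp_apply]
    rw [ mul_comm Complex.I, Complex.norm_exp_ofReal_mul_I, mul_one]

/-- Over a common measure, the difference of the densities has vanishing Fourier transform in each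
coordinate, hence is zero almost everywhere. -/
theorem eval_injective : Function.Injective (eval : FM n → Rn n → Cn n) := by
  intro u v huv
  obtain ⟨m, f, g, hm, -, hf, -, hg, rfl, rfl⟩ := exists_push_pair u v
  refine push_congr ?_
  have hc : ((2 * Real.pi) ^ (-(n : ℝ) / 2) : ℝ) ≠ 0 := by positivity
  have key : ∀ i : Fin n, (fun ξ => f ξ i - g ξ i) =ᵐ[m] 0 := by
    intro i
    have hfi : Integrable (fun ξ => f ξ i) m := hf.eval_piLp i
    have hgi : Integrable (fun ξ => g ξ i) m := hg.eval_piLp i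
    refine ae_eq_zero_of_forall_integral_exp (hfi.sub hgi) fun x => ?_
    have h1 := congrFun huv x
    change push m id f x = push m id g x at h1
    rw [eval_push measurable_id hf, eval_push measurable_id hg] at h1
    replace h1 := smul_right_injective _ hc h1
    rw [← sub_eq_zero, ← integral_sub (integrable_exp_smul measurable_id hf x)
      (integrable_exp_smul measurable_id hg x)] at h1
    have h2 := congrArg (fun z : Cn n => z i) h1
    rw [eval_integral_piLp] at h2
    · simpa [mul_sub] using h2
    · intro j
      exact ((integrable_exp_smul measurable_id hf x).sub
        (integrable_exp_smul measurable_id hg x)).eval_piLp j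
  filter_upwards [ae_all_iff.2 key] with ξ hξ
  ext i
  simpa [sub_eq_zero] using hξ i

theorem eval_add (u v : FM n) (x : Rn n) : (u + v) x = u x + v x := by
  obtain ⟨m, f, g, hm, -, hf, -, hg, rfl, rfl⟩ := exists_push_pair u v
  rw [← push_add hf hg, show push m id (fun x => f x + g x) x = _ from eval_push measurable_id (hf.add hg) x, eval_push measurable_id hf,
    eval_push measurable_id hg, ← smul_add, ← integral_add (integrable_exp_smul measurable_id hf x)
      (integrable_exp_smul measurable_id hg x)]
  simp

theorem eval_smul (c : ℂ) (u : FM n) (x : Rn n) : (c • u) x = c • u x := by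
  obtain ⟨f, -, hf, e⟩ := exists_push u u.hat.variation .rfl
  rw [e, ← push_smul, show push u.hat.variation id (fun x => c • f x) x = _ from
    eval_push measurable_id (hf.smul c) x, eval_push measurable_id hf,
    smul_comm c, ← integral_smul c]
  simp only [smul_comm c, Pi.smul_apply]

theorem norm_eval_le (u : FM n) (x : Rn n) :
    ‖u x‖ ≤ ((2 * Real.pi) ^ (-(n : ℝ) / 2) : ℝ) * ‖u‖ := by
  obtain ⟨f, -, hf, e⟩ := exists_push u u.hat.variation .rfl
  rw [e, norm_push_id hf, eval_push measurable_id hf, norm_smul, Real.norm_of_nonneg (by positivity)]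
  gcongr
  refine (norm_integral_le_integral_norm _).trans (le_of_eq ?_)
  refine integral_congr_ae (ae_of_all _ fun y => ?_)
  simp only [norm_smul, id]
  rw [mul_comm Complex.I, Complex.norm_exp_ofReal_mul_I, one_mul]

/-- Evaluation at a point, as a continuous linear map. -/
def evalCLM (x : Rn n) : FM n →L[ℂ] Cn n :=
  LinearMap.mkContinuous
    { toFun := fun u => u x
      map_add' := fun u v => eval_add u v x
      map_smul' := fun c u => eval_smul c u x }
    ((2 * Real.pi) ^ (-(n : ℝ) / 2) : ℝ) (fun u => norm_eval_le u x)

@[simp] theorem evalCLM_apply (x : Rn n) (u : FM n) : evalCLM x u = u x := rfl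

/-- An absolutely convergent series lives over the sum m of the variations of its terms, a finite
measure because the norms are summable. Passing to densities over m preserves norms, so completeness
of L¹(m) provides the limit. -/
instance : CompleteSpace (FM n) := by
  refine NormedAddCommGroup.completeSpace_of_summable_imp_tendsto fun u hu => ?_
  let m : Measure (Rn n) := Measure.sum fun k => (u k).hat.variation
  have hm : IsFiniteMeasure m := by
    refine ⟨?_⟩
    rw [Measure.sum_apply _ MeasurableSet.univ]
    refine lt_top_iff_ne_top.2 ?_
    have := hu.tsum_ofReal_ne_top
    convert this using 3 with k
    rw [norm_def, ofReal_measureReal]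
  choose f hfm hf e using fun k => exists_push (u k) m
    (Measure.absolutelyContinuous_of_le (Measure.le_sum _ k))
  let F : ℕ → Lp (Cn n) 1 m := fun k => (hf k).toL1
  have hF : ∀ k, ‖F k‖ = ‖u k‖ := by
    intro k
    rw [L1.norm_of_fun_eq_integral_norm, e k, norm_push_id (hf k)]
  have hs : Summable F := Summable.of_norm (by simpa only [hF] using hu)
  obtain ⟨g, hg⟩ := hs
  have hg' := hg.tendsto_sum_nat
  refine ⟨push m id g, ?_⟩
  rw [tendsto_iff_norm_sub_tendsto_zero] at hg' ⊢
  refine hg'.congr fun N => ?_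
  have h1 : ∑ k ∈ Finset.range N, u k = push m id (fun x => ∑ k ∈ Finset.range N, f k x) := by
    rw [push_finset_sum _ fun i _ => hf i]
    exact Finset.sum_congr rfl fun i _ => e i
  rw [h1, ← push_sub (integrable_finsetSum _ fun i _ => hf i) (L1.integrable_coeFn g),
    show ‖push m id (fun x => ∑ i ∈ Finset.range N, f i x - g x)‖ = _ from
      norm_push_id ((integrable_finsetSum _ fun i _ => hf i).sub (L1.integrable_coeFn g)),
    L1.norm_eq_integral_norm]
  refine integral_congr_ae ?_
  have h2 : ∀ᵐ x ∂m, ∀ k, F k x = f k x := ae_all_iff.2 fun k => (hf k).coeFn_toL1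
  have h3 (N : ℕ) : (∑ k ∈ Finset.range N, F k : Lp (Cn n) 1 m) =ᵐ[m]
      fun x => ∑ k ∈ Finset.range N, F k x := by
    exact Lp.coeFn_fun_finsetSum _ _
  filter_upwards [h2, h3 N, Lp.coeFn_sub (∑ k ∈ Finset.range N, F k) g] with x hx2 hx3 hx4
  rw [hx4, Pi.sub_apply, hx3]
  simp only [hx2]

theorem wd_mem (u : FM n) (σ : Rn n → Cn n →L[ℂ] Cn n) :
    u.hat.withDensity σ
      (ContinuousLinearMap.restrictScalarsL ℂ (Cn n) (Cn n) ℝ ℝ) ∈ radonMeasures n := by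
  by_cases h : u.hat.Integrable σ
  · refine lt_of_le_of_lt (VectorMeasure.variation_WithDensity_le univ) ?_
    rw [withDensity_apply _ MeasurableSet.univ, Measure.restrict_univ]
    exact (Integrable.of_measure_le_smul (c := (‖_‖₊ : ENNReal)) ENNReal.coe_ne_top
      (VectorMeasure.variation_transpose_le _ _) h).2
  · simp [VectorMeasure.withDensity, h]

/-- Multiplication of the Fourier transform by a symbol, without discarding the point mass at the
origin. -/
def wd (σ : Rn n → Cn n →L[ℂ] Cn n) (u : FM n) : FM n :=
  ⟨u.hat.withDensity σ (ContinuousLinearMap.restrictScalarsL ℂ (Cn n) (Cn n) ℝ ℝ), wd_mem u σ⟩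

theorem op_eq_wd (σ : Rn n → Cn n →L[ℂ] Cn n) (u : FM n) :
    u.op σ = wd (({0}ᶜ : Set (Rn n)).indicator σ) u := rfl

/-- The symbol depends only on the frequency φ(x), so multiplying the image measure by σ is the same
as multiplying the density by σ∘φ before taking the image. -/
theorem wd_push {m : Measure X} {φ : X → Rn n} (hφ : Measurable φ) {f : X → Cn n}
    (hf : Integrable f m) {σ : Rn n → Cn n →L[ℂ] Cn n} (hσ : StronglyMeasurable σ)
    (h : Integrable (fun x => ‖f x‖ * ‖σ (φ x)‖) m) :
    wd σ (push m φ f) = push m φ (fun x => σ (φ x) (f x)) := by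
  have h1 : (m.withDensityᵥ f).Integrable (σ ∘ φ) := by
    rwa [integrable_variation_withDensityᵥ hf (hσ.comp_measurable hφ).aestronglyMeasurable]
  have h2 : (push m φ f).hat.Integrable σ :=
    VectorMeasure.Integrable.map hσ.aestronglyMeasurable h1
  have h3 : Integrable (fun x => σ (φ x) (f x)) m := by
    refine h.mono' ?_ (ae_of_all _ fun x => ?_)
    · exact (ContinuousLinearMap.id ℂ (Cn n →L[ℂ] Cn n)).aestronglyMeasurable_comp₂
        (hσ.comp_measurable hφ).aestronglyMeasurable hf.1
    · exact (ContinuousLinearMap.le_opNorm _ _).trans (by rw [mul_comm])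
  apply hat_injective
  change (push m φ f).hat.withDensity σ _ = _
  ext1 s hs
  rw [VectorMeasure.withDensity_apply h2, hat_push, hat_push, VectorMeasure.restrict_map _ hφ hs,
    VectorMeasure.map_apply _ hφ hs, withDensityᵥ_apply h3 (hφ hs),
    withDensityᵥ_restrict hf (hφ hs)]
  rw [VectorMeasure.integral_map hφ hσ.aestronglyMeasurable,
    integral_withDensityᵥ hf.restrict]
  · rfl
  all_goals
  · exact (integrable_variation_withDensityᵥ hf.restrict
      (hσ.comp_measurable hφ).aestronglyMeasurable).2 h.restrict

end FM
end ActiveFluid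

/-! ### Bounded Fourier multipliers and the Helmholtz projection -/

namespace ActiveFluid

open BoundedContinuousFunction Filter Topology

variable {n : ℕ} {X : Type*} {mX : MeasurableSpace X}

namespace FM

theorem wd_push_of_bound {m : Measure X} {φ : X → Rn n} (hφ : Measurable φ) {f : X → Cn n}
    (hf : Integrable f m) {σ : Rn n → Cn n →L[ℂ] Cn n} (hσ : StronglyMeasurable σ) {C : ℝ}
    (hC : ∀ ξ, ‖σ ξ‖ ≤ C) :
    wd σ (push m φ f) = push m φ (fun x => σ (φ x) (f x)) := by
  refine wd_push hφ hf hσ ((hf.norm.const_mul C).mono' ?_ (ae_of_all _ fun x => ?_))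
  · exact hf.1.norm.mul (hσ.comp_measurable hφ).aestronglyMeasurable.norm
  · rw [Real.norm_of_nonneg (by positivity), mul_comm]
    gcongr
    exact hC _

theorem integrable_symbol_apply {m : Measure X} {φ : X → Rn n} (hφ : Measurable φ) {f : X → Cn n}
    (hf : Integrable f m) {σ : Rn n → Cn n →L[ℂ] Cn n} (hσ : StronglyMeasurable σ) {C : ℝ}
    (hC : ∀ ξ, ‖σ ξ‖ ≤ C) : Integrable (fun x => σ (φ x) (f x)) m := by
  refine (hf.norm.const_mul C).mono' ?_ (ae_of_all _ fun x => ?_)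
  · exact (ContinuousLinearMap.id ℂ (Cn n →L[ℂ] Cn n)).aestronglyMeasurable_comp₂
      (hσ.comp_measurable hφ).aestronglyMeasurable hf.1
  · refine (ContinuousLinearMap.le_opNorm _ _).trans ?_
    gcongr
    exact hC _

/-- The Fourier multiplier with a bounded measurable symbol, as a bounded operator. -/
def multiplier (σ : Rn n → Cn n →L[ℂ] Cn n) (hσ : StronglyMeasurable σ) (C : ℝ)
    (hC : ∀ ξ, ‖σ ξ‖ ≤ C) : FM n →L[ℂ] FM n :=
  LinearMap.mkContinuous
    { toFun := wd σ
      map_add' := fun u v => by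
        obtain ⟨m, f, g, hm, -, hf, -, hg, rfl, rfl⟩ := exists_push_pair u v
        rw [← push_add hf hg, wd_push_of_bound measurable_id hf hσ hC,
          wd_push_of_bound measurable_id hg hσ hC,
          wd_push_of_bound measurable_id (f := fun x => f x + g x) (hf.add hg) hσ hC,
          ← push_add (integrable_symbol_apply measurable_id hf hσ hC)
            (integrable_symbol_apply measurable_id hg hσ hC)]
        simp
      map_smul' := fun c u => by
        obtain ⟨f, -, hf, e⟩ := exists_push u u.hat.variation .rfl
        rw [e, ← push_smul, wd_push_of_bound measurable_id hf hσ hC,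
          wd_push_of_bound measurable_id (f := fun x => c • f x) (hf.smul c) hσ hC,
          RingHom.id_apply, ← push_smul]
        simp } C (fun u => by
        obtain ⟨f, -, hf, e⟩ := exists_push u u.hat.variation .rfl
        rw [e]
        change ‖wd σ _‖ ≤ _
        rw [wd_push_of_bound measurable_id hf hσ hC,
          norm_push_id (integrable_symbol_apply measurable_id hf hσ hC), norm_push_id hf,
          ← integral_const_mul]
        refine integral_mono (integrable_symbol_apply measurable_id hf hσ hC).norm
          (hf.norm.const_mul C) fun x => (ContinuousLinearMap.le_opNorm _ _).trans ?_
        gcongr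
        exact hC _)

theorem multiplier_push {m : Measure X} {φ : X → Rn n} (hφ : Measurable φ) {f : X → Cn n}
    (hf : Integrable f m) {σ : Rn n → Cn n →L[ℂ] Cn n} (hσ : StronglyMeasurable σ) {C : ℝ}
    (hC : ∀ ξ, ‖σ ξ‖ ≤ C) :
    multiplier σ hσ C hC (push m φ f) = push m φ (fun x => σ (φ x) (f x)) :=
  wd_push_of_bound hφ hf hσ hC

theorem norm_multiplier_le {σ : Rn n → Cn n →L[ℂ] Cn n} (hσ : StronglyMeasurable σ) {C : ℝ}
    (hC : ∀ ξ, ‖σ ξ‖ ≤ C) : ‖multiplier σ hσ C hC‖ ≤ C :=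
  LinearMap.mkContinuous_norm_le _ ((norm_nonneg _).trans (hC 0)) _

/-- The symbol `p · I`. -/
def scalarSymbol (p : Rn n →ᵇ ℂ) (ξ : Rn n) : Cn n →L[ℂ] Cn n :=
  p ξ • ContinuousLinearMap.id ℂ (Cn n)

theorem stronglyMeasurable_scalarSymbol (p : Rn n →ᵇ ℂ) :
    StronglyMeasurable (scalarSymbol p) :=
  (p.continuous.smul continuous_const).stronglyMeasurable

theorem norm_scalarSymbol_le (p : Rn n →ᵇ ℂ) (ξ : Rn n) : ‖scalarSymbol p ξ‖ ≤ ‖p‖ := by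
  refine ContinuousLinearMap.opNorm_le_bound _ (norm_nonneg _) fun z => ?_
  simp only [scalarSymbol, _root_.smul_apply, ContinuousLinearMap.id_apply, norm_smul]
  gcongr
  exact p.norm_coe_le_norm ξ

/-- The Fourier multiplier with a scalar bounded continuous symbol. -/
def sm : (Rn n →ᵇ ℂ) →L[ℂ] FM n →L[ℂ] FM n :=
  LinearMap.mkContinuous
    { toFun := fun p => multiplier (scalarSymbol p) (stronglyMeasurable_scalarSymbol p) ‖p‖
        (norm_scalarSymbol_le p)
      map_add' := fun p q => by
        ext1 u
        obtain ⟨f, -, hf, e⟩ := exists_push u u.hat.variation .rfl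
        rw [e]
        simp only [_root_.add_apply]
        rw [multiplier_push measurable_id hf, multiplier_push measurable_id hf,
          multiplier_push measurable_id hf, ← push_add]
        · simp [scalarSymbol, add_smul]
        · exact integrable_symbol_apply measurable_id hf (stronglyMeasurable_scalarSymbol p)
            (norm_scalarSymbol_le p)
        · exact integrable_symbol_apply measurable_id hf (stronglyMeasurable_scalarSymbol q)
            (norm_scalarSymbol_le q)
      map_smul' := fun c p => by
        ext1 u
        obtain ⟨f, -, hf, e⟩ := exists_push u u.hat.variation .rfl
        rw [e]
        simp only [_root_.smul_apply, RingHom.id_apply]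
        rw [multiplier_push measurable_id hf, multiplier_push measurable_id hf, ← push_smul]
        simp [scalarSymbol, smul_smul] } 1 (fun p => by
        rw [one_mul]
        exact norm_multiplier_le (stronglyMeasurable_scalarSymbol p) (norm_scalarSymbol_le p))

theorem sm_push {m : Measure X} {φ : X → Rn n} (hφ : Measurable φ) {f : X → Cn n}
    (hf : Integrable f m) (p : Rn n →ᵇ ℂ) :
    sm p (push m φ f) = push m φ (fun x => p (φ x) • f x) :=
  multiplier_push hφ hf (stronglyMeasurable_scalarSymbol p) (norm_scalarSymbol_le p)

theorem norm_sm_le (p : Rn n →ᵇ ℂ) : ‖sm p‖ ≤ ‖p‖ :=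
  norm_multiplier_le (stronglyMeasurable_scalarSymbol p) (norm_scalarSymbol_le p)

theorem norm_sm_apply_le (p : Rn n →ᵇ ℂ) (u : FM n) : ‖sm p u‖ ≤ ‖p‖ * ‖u‖ :=
  (ContinuousLinearMap.le_opNorm _ _).trans (by gcongr; exact norm_sm_le p)

theorem integrable_bcf_smul {m : Measure X} {φ : X → Rn n} (hφ : Measurable φ) {f : X → Cn n}
    (hf : Integrable f m) (p : Rn n →ᵇ ℂ) : Integrable (fun x => p (φ x) • f x) m :=
  integrable_symbol_apply hφ hf (stronglyMeasurable_scalarSymbol p) (norm_scalarSymbol_le p)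

theorem sm_sm (p q : Rn n →ᵇ ℂ) (u : FM n) : sm p (sm q u) = sm (p * q) u := by
  obtain ⟨f, -, hf, e⟩ := exists_push u u.hat.variation .rfl
  rw [e, sm_push measurable_id hf, sm_push measurable_id hf,
    sm_push measurable_id (integrable_bcf_smul measurable_id hf q)]
  simp [smul_smul]

theorem sm_one (u : FM n) : sm 1 u = u := by
  obtain ⟨f, -, hf, e⟩ := exists_push u u.hat.variation .rfl
  rw [e, sm_push measurable_id hf]
  simp

/-- The norm of the difference is ∫ |p_i - q| |f|, so dominated convergence applies. Pointwise
convergence of uniformly bounded symbols thus gives strong convergence, which is what is available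
for the semigroup at τ = 0 and for difference quotients. -/
theorem tendsto_sm {ι : Type*} {l : Filter ι} [l.IsCountablyGenerated] {p : ι → Rn n →ᵇ ℂ}
    {q : Rn n →ᵇ ℂ} {C : ℝ} (hC : ∀ᶠ i in l, ∀ ξ, ‖p i ξ‖ ≤ C)
    (h : ∀ ξ, Tendsto (fun i => p i ξ) l (𝓝 (q ξ))) (u : FM n) :
    Tendsto (fun i => sm (p i) u) l (𝓝 (sm q u)) := by
  obtain ⟨f, -, hf, e⟩ := exists_push u u.hat.variation .rfl
  rw [e, tendsto_iff_norm_sub_tendsto_zero]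
  have key : ∀ i, ‖sm (p i) (push u.hat.variation id f) - sm q (push u.hat.variation id f)‖ =
      ∫ ξ, ‖(p i ξ - q ξ) • f ξ‖ ∂u.hat.variation := by
    intro i
    rw [← _root_.sub_apply, ← map_sub, sm_push measurable_id hf,
      norm_push_id (integrable_bcf_smul measurable_id hf _)]
    rfl
  simp only [key]
  rw [← integral_zero (Rn n) ℝ (μ := u.hat.variation)]
  refine tendsto_integral_filter_of_dominated_convergence (fun ξ => (C + ‖q‖) * ‖f ξ‖) ?_ ?_
    (hf.norm.const_mul _) ?_
  · refine Eventually.of_forall fun i => ?_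
    exact (integrable_bcf_smul measurable_id hf (p i - q)).1.norm
  · filter_upwards [hC] with i hi
    refine ae_of_all _ fun ξ => ?_
    rw [norm_norm, norm_smul]
    gcongr
    exact (norm_sub_le _ _).trans (add_le_add (hi ξ) (q.norm_coe_le_norm ξ))
  · refine ae_of_all _ fun ξ => ?_
    have := ((h ξ).sub_const (q ξ)).smul_const (f ξ)
    simpa using this.norm

/-- Each p_i annihilates the density outside a null set. Countably many such null sets can be
united, and off their union some p_i(ξ) is nonzero. -/
theorem eq_zero_of_forall_sm_eq_zero {ι : Type*} [Countable ι] {p : ι → Rn n →ᵇ ℂ}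
    (hp : ∀ ξ, ∃ i, p i ξ ≠ 0) {u : FM n} (h : ∀ i, sm (p i) u = 0) : u = 0 := by
  obtain ⟨f, -, hf, e⟩ := exists_push u u.hat.variation .rfl
  rw [e] at h ⊢
  rw [push_id_eq_zero_iff hf]
  have : ∀ i, (fun ξ => p i ξ • f ξ) =ᵐ[u.hat.variation] 0 := by
    intro i
    have h1 := h i
    rw [sm_push measurable_id hf] at h1
    exact (push_id_eq_zero_iff (integrable_bcf_smul measurable_id hf _)).1 h1
  filter_upwards [ae_all_iff.2 this] with ξ hξ
  obtain ⟨i, hi⟩ := hp ξ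
  simpa [hi] using hξ i

theorem sm_injective {p : Rn n →ᵇ ℂ} (hp : ∀ ξ, p ξ ≠ 0) : Function.Injective (sm p) := by
  intro u v huv
  rw [← sub_eq_zero]
  refine eq_zero_of_forall_sm_eq_zero (ι := Unit) (p := fun _ => p) (fun ξ => ⟨(), hp ξ⟩)
    fun _ => ?_
  rw [map_sub, huv, sub_self]

/-! ### The Helmholtz projection -/

/-- The real vector `ξ` as a complex vector. -/
def complexify (ξ : Rn n) : Cn n := WithLp.toLp 2 fun i => (ξ i : ℂ)

theorem norm_complexify (ξ : Rn n) : ‖complexify ξ‖ = ‖ξ‖ := by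
  simp [EuclideanSpace.norm_eq, complexify]

theorem continuous_complexify : Continuous (complexify : Rn n → Cn n) := by
  refine (PiLp.continuous_toLp 2 _).comp (continuous_pi fun i => ?_)
  fun_prop

/-- The bilinear pairing `ξ · z`. -/
def dotc (ξ : Rn n) (z : Cn n) : ℂ := ∑ i, (ξ i : ℂ) * z i

theorem dotc_eq_inner (ξ : Rn n) (z : Cn n) : dotc ξ z = inner ℂ (complexify ξ) z := by
  simp [dotc, complexify, PiLp.inner_apply, mul_comm]

theorem norm_dotc_le (ξ : Rn n) (z : Cn n) : ‖dotc ξ z‖ ≤ ‖ξ‖ * ‖z‖ := by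
  rw [dotc_eq_inner, ← norm_complexify]
  exact norm_inner_le_norm _ _

theorem dotc_complexify (ξ : Rn n) : dotc ξ (complexify ξ) = (‖ξ‖ ^ 2 : ℝ) := by
  rw [dotc_eq_inner, inner_self_eq_norm_sq_to_K, norm_complexify]
  simp

theorem helmholtzSymbol_apply (ξ : Rn n) (z : Cn n) :
    helmholtzSymbol ξ z = z - (dotc ξ z / (‖ξ‖ ^ 2 : ℝ)) • complexify ξ := by
  ext i
  simp [helmholtzSymbol, dotc, complexify, Matrix.mulVec,
    dotProduct, Finset.sum_div, Finset.sum_mul]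
  refine Finset.sum_congr rfl fun j _ => ?_
  ring

/-- The triangle inequality gives 2 instead of the sharp 1; only boundedness matters later. -/
theorem norm_helmholtzSymbol_le (ξ : Rn n) : ‖helmholtzSymbol ξ‖ ≤ 2 := by
  refine ContinuousLinearMap.opNorm_le_bound _ (by norm_num) fun z => ?_
  rw [helmholtzSymbol_apply]
  refine (norm_sub_le _ _).trans ?_
  rw [norm_smul, norm_div, norm_complexify, Complex.norm_real, Real.norm_of_nonneg (by positivity)]
  have := norm_dotc_le ξ z
  have h : ‖dotc ξ z‖ / ‖ξ‖ ^ 2 * ‖ξ‖ ≤ ‖z‖ := by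
    rcases eq_or_ne ξ 0 with rfl | h
    · simp
    · have : 0 < ‖ξ‖ := norm_pos_iff.2 h
      rw [div_mul_eq_mul_div, div_le_iff₀ (by positivity)]
      nlinarith
  linarith

theorem measurable_helmholtzSymbol : StronglyMeasurable (helmholtzSymbol : Rn n → _) := by
  have e : (helmholtzSymbol : Rn n → _) = fun ξ => ContinuousLinearMap.id ℂ (Cn n) -
      (((‖ξ‖ ^ 2)⁻¹ : ℝ) : ℂ) • ContinuousLinearMap.smulRightL ℂ (Cn n) (Cn n)
        (innerSL ℂ (complexify ξ)) (complexify ξ) := by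
    ext1 ξ
    ext1 z
    rw [helmholtzSymbol_apply, dotc_eq_inner]
    simp [smul_smul, div_eq_inv_mul]
  rw [e]
  have hc := continuous_complexify (n := n)
  refine stronglyMeasurable_const.sub (StronglyMeasurable.smul
    (f := fun ξ : Rn n => (((‖ξ‖ ^ 2)⁻¹ : ℝ) : ℂ))
    (g := fun ξ : Rn n => ContinuousLinearMap.smulRightL ℂ (Cn n) (Cn n)
        (innerSL ℂ (complexify ξ)) (complexify ξ)) ?_ ?_)
  · exact Measurable.stronglyMeasurable (by fun_prop)
  · exact Continuous.stronglyMeasurable (by fun_prop)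

/-- The symbol of the Helmholtz projection, with the value `0` at the origin. -/
def helmSymbol (ξ : Rn n) : Cn n →L[ℂ] Cn n :=
  ({0}ᶜ : Set (Rn n)).indicator helmholtzSymbol ξ

theorem stronglyMeasurable_helmSymbol : StronglyMeasurable (helmSymbol : Rn n → _) :=
  measurable_helmholtzSymbol.indicator (measurableSet_singleton _).compl

theorem norm_helmSymbol_le (ξ : Rn n) : ‖helmSymbol ξ‖ ≤ 2 := by
  by_cases h : ξ = 0
  · simp [helmSymbol, h]
  · simpa [helmSymbol, h] using norm_helmholtzSymbol_le ξ

theorem helmSymbol_zero : helmSymbol (0 : Rn n) = 0 := by simp [helmSymbol]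

theorem helmSymbol_of_ne {ξ : Rn n} (h : ξ ≠ 0) : helmSymbol ξ = helmholtzSymbol ξ := by
  simp [helmSymbol, h]

theorem helmSymbol_helmSymbol (ξ : Rn n) (z : Cn n) :
    helmSymbol ξ (helmSymbol ξ z) = helmSymbol ξ z := by
  by_cases h : ξ = 0
  · simp [h, helmSymbol_zero]
  · have h2 : (‖ξ‖ ^ 2 : ℝ) ≠ 0 := by simpa using h
    have h3 : dotc ξ (helmholtzSymbol ξ z) = 0 := by
      have : dotc ξ (helmholtzSymbol ξ z) =
          dotc ξ z - dotc ξ z / (‖ξ‖ ^ 2 : ℝ) * dotc ξ (complexify ξ) := by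
        rw [helmholtzSymbol_apply]
        simp only [dotc_eq_inner, inner_sub_right, inner_smul_right]
      rw [this, dotc_complexify, div_mul_cancel₀ _ (by exact_mod_cast h2), sub_self]
    rw [helmSymbol_of_ne h, helmholtzSymbol_apply ξ (helmholtzSymbol ξ z), h3]
    simp

/-- The Helmholtz projection as a bounded operator. -/
def helm : FM n →L[ℂ] FM n :=
  multiplier helmSymbol stronglyMeasurable_helmSymbol 2 norm_helmSymbol_le

theorem helm_apply (u : FM n) : helm u = helmholtz u := rfl

theorem helm_push {m : Measure X} {φ : X → Rn n} (hφ : Measurable φ) {f : X → Cn n}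
    (hf : Integrable f m) :
    helm (push m φ f) = push m φ (fun x => helmSymbol (φ x) (f x)) :=
  multiplier_push hφ hf _ _

theorem integrable_helmSymbol {m : Measure X} {φ : X → Rn n} (hφ : Measurable φ) {f : X → Cn n}
    (hf : Integrable f m) : Integrable (fun x => helmSymbol (φ x) (f x)) m :=
  integrable_symbol_apply hφ hf stronglyMeasurable_helmSymbol norm_helmSymbol_le

theorem helm_helm (u : FM n) : helm (helm u) = helm u := by
  obtain ⟨f, -, hf, e⟩ := exists_push u u.hat.variation .rfl
  rw [e, helm_push measurable_id hf, helm_push measurable_id (integrable_helmSymbol measurable_id hf)]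
  simp only [helmSymbol_helmSymbol]

theorem sm_helm (p : Rn n →ᵇ ℂ) (u : FM n) : sm p (helm u) = helm (sm p u) := by
  obtain ⟨f, -, hf, e⟩ := exists_push u u.hat.variation .rfl
  rw [e, helm_push measurable_id hf, sm_push measurable_id hf,
    sm_push measurable_id (integrable_helmSymbol measurable_id hf),
    helm_push measurable_id (integrable_bcf_smul measurable_id hf p)]
  simp

theorem helm_mem (u : FM n) : (helm u).hat {0} = 0 := by
  obtain ⟨f, -, hf, e⟩ := exists_push u u.hat.variation .rfl
  rw [e, helm_push measurable_id hf, hat_push, VectorMeasure.map_id,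
    withDensityᵥ_apply (integrable_helmSymbol measurable_id hf) (measurableSet_singleton _)]
  rw [setIntegral_congr_fun (g := fun _ => 0) (measurableSet_singleton _)]
  · simp
  · rintro x rfl
    simp [helmSymbol_zero]

/-- P is idempotent and its range has no mass at the origin. The solenoidal space is therefore the
set of fixed points of P, and this linear closed condition replaces it from here on. -/
theorem mem_FM₀σ_iff {u : FM n} : u ∈ FM₀σ n ↔ helm u = u := by
  constructor
  · rintro ⟨v, -, rfl⟩
    exact helm_helm v
  · intro h
    refine ⟨u, ?_, h⟩
    change u.hat {0} = 0
    rw [← h]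
    exact helm_mem u

/-- A Fourier multiplier composed with the Helmholtz projection. -/
theorem op_smul_helmholtzSymbol {c : Rn n → ℂ} {p : Rn n →ᵇ ℂ} (h : ∀ ξ, p ξ = c ξ) (u : FM n) :
    u.op (fun ξ => c ξ • helmholtzSymbol ξ) = sm p (helm u) := by
  obtain ⟨f, -, hf, e⟩ := exists_push u u.hat.variation .rfl
  have hs : (({0}ᶜ : Set (Rn n)).indicator fun ξ => c ξ • helmholtzSymbol ξ) =
      fun ξ => p ξ • helmSymbol ξ := by
    ext1 ξ
    by_cases hξ : ξ = 0
    · subst hξ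
      rw [helmSymbol_zero, indicator_of_notMem (by simp)]
      exact (smul_zero (A := Cn n →L[ℂ] Cn n) (p 0)).symm
    · simp [hξ, helmSymbol, h]
  rw [op_eq_wd, hs, e, helm_push measurable_id hf,
    sm_push measurable_id (integrable_helmSymbol measurable_id hf),
    wd_push_of_bound (C := ‖p‖ * 2) measurable_id hf]
  · rfl
  · exact p.continuous.stronglyMeasurable.smul stronglyMeasurable_helmSymbol
  · intro ξ
    rw [norm_smul]
    gcongr
    · exact p.norm_coe_le_norm ξ
    · exact norm_helmSymbol_le ξ

/-- `op` discards the point mass at the origin whereas `sm` keeps it. The two agree here because an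
element fixed by P has no such mass. -/
theorem op_smul_id {c : Rn n → ℂ} {p : Rn n →ᵇ ℂ} (h : ∀ ξ, p ξ = c ξ) {u : FM n}
    (hu : helm u = u) :
    u.op (fun ξ => c ξ • ContinuousLinearMap.id ℂ (Cn n)) = sm p u := by
  obtain ⟨f, -, hf, e⟩ := exists_push u u.hat.variation .rfl
  have hs : (({0}ᶜ : Set (Rn n)).indicator fun ξ => c ξ • ContinuousLinearMap.id ℂ (Cn n)) =
      fun ξ => ({0}ᶜ : Set (Rn n)).indicator (scalarSymbol p) ξ := by
    ext1 ξ
    by_cases hξ : ξ = 0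
    · simp [hξ]
    · simp [hξ, scalarSymbol, h]
  rw [op_eq_wd, hs, ← hu, e, helm_push measurable_id hf,
    sm_push measurable_id (integrable_helmSymbol measurable_id hf),
    wd_push_of_bound (C := ‖p‖) measurable_id (integrable_helmSymbol measurable_id hf)]
  · congr 1
    ext1 ξ
    by_cases hξ : ξ = 0
    · simp [hξ, helmSymbol_zero]
    · simp [hξ, scalarSymbol]
  · exact (stronglyMeasurable_scalarSymbol p).indicator (measurableSet_singleton _).compl
  · intro ξ
    by_cases hξ : ξ = 0
    · simp [hξ]
    · simpa [hξ] using norm_scalarSymbol_le p ξ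

theorem norm_helm_le (u : FM n) : ‖helm u‖ ≤ 2 * ‖u‖ :=
  (ContinuousLinearMap.le_opNorm _ _).trans
    (mul_le_mul_of_nonneg_right (norm_multiplier_le stronglyMeasurable_helmSymbol norm_helmSymbol_le)
      (norm_nonneg _))

attribute [irreducible] sm helm

end FM
end ActiveFluid

/-! ### Products, resolvent symbols, conjugation and the nonlinear terms in FM -/

namespace ActiveFluid

open BoundedContinuousFunction Filter Topology

variable {n : ℕ} {X Y : Type*} {mX : MeasurableSpace X} {mY : MeasurableSpace Y}

namespace FM

/-! ### Pointwise products -/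

/-- The constant `(2π)^(-n/2)`. -/
def fourierConst (n : ℕ) : ℝ := (2 * Real.pi) ^ (-(n : ℝ) / 2)

theorem fourierConst_pos (n : ℕ) : 0 < fourierConst n := by
  unfold fourierConst; positivity

/-- The density of the Fourier transform of a product. -/
def prodDensity (j : Fin n) (f : X → Cn n) (g : Y → Cn n) (z : X × Y) : Cn n :=
  (fourierConst n : ℂ) • f z.1 j • g z.2

theorem integrable_prodDensity {m : Measure X} {m' : Measure Y} [SFinite m] [SFinite m']
    (j : Fin n) {f : X → Cn n} {g : Y → Cn n} (hf : Integrable f m) (hg : Integrable g m') :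
    Integrable (prodDensity j f g) (m.prod m') := by
  have := (Integrable.smul_prod (hf.eval_piLp j) hg).smul (fourierConst n : ℂ)
  exact this

/-- Fubini together with e^(ix·(ξ+η)) = e^(ix·ξ) e^(ix·η). The right side carries the factor
(2π)^(-n/2) twice and the left side once; the extra factor sits in `prodDensity`. -/
theorem eval_push_prod {m : Measure X} {m' : Measure Y} [SFinite m] [SFinite m']
    {φ : X → Rn n} {ψ : Y → Rn n} (hφ : Measurable φ) (hψ : Measurable ψ)
    (j : Fin n) {f : X → Cn n} {g : Y → Cn n} (hf : Integrable f m) (hg : Integrable g m')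
    (x : Rn n) :
    push (m.prod m') (fun z => φ z.1 + ψ z.2) (prodDensity j f g) x =
      push m φ f x j • push m' ψ g x := by
  rw [eval_push (by fun_prop) (integrable_prodDensity j hf hg), eval_push hφ hf, eval_push hψ hg]
  have e : ∀ z : X × Y, Complex.exp (Complex.I * ((⟪x, φ z.1 + ψ z.2⟫_ℝ : ℝ) : ℂ)) •
      prodDensity j f g z = (fourierConst n : ℂ) •
        ((Complex.exp (Complex.I * ((⟪x, φ z.1⟫_ℝ : ℝ) : ℂ)) • f z.1) j •
        (Complex.exp (Complex.I * ((⟪x, ψ z.2⟫_ℝ : ℝ) : ℂ)) • g z.2)) := by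
    intro z
    simp only [prodDensity, inner_add_right, Complex.ofReal_add, mul_add, Complex.exp_add,
      smul_smul, PiLp.smul_apply, smul_eq_mul]
    congr 1
    ring
  simp only [e]
  rw [integral_smul, integral_prod_smul (fun y => (Complex.exp (Complex.I *
      ((⟪x, φ y⟫_ℝ : ℝ) : ℂ)) • f y) j) (fun y => Complex.exp (Complex.I *
      ((⟪x, ψ y⟫_ℝ : ℝ) : ℂ)) • g y)]
  rw [PiLp.smul_apply, eval_integral_piLp fun i => (integrable_exp_smul hφ hf x).eval_piLp i]
  rw [smul_assoc, Complex.coe_smul, smul_comm _ (fourierConst n)]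
  congr 1
  rw [smul_comm]

theorem norm_prodDensity_le (j : Fin n) (f : X → Cn n) (g : Y → Cn n) (z : X × Y) :
    ‖prodDensity j f g z‖ ≤ fourierConst n * (‖f z.1‖ * ‖g z.2‖) := by
  rw [prodDensity, norm_smul, norm_smul, Complex.norm_real,
    Real.norm_of_nonneg (fourierConst_pos n).le]
  have := (fourierConst_pos n).le
  gcongr
  exact PiLp.norm_apply_le (f z.1) j

theorem exists_density (u : FM n) : ∃ f : Rn n → Cn n,
    Integrable f u.hat.variation ∧ u = push u.hat.variation id f := by
  obtain ⟨f, -, hf, e⟩ := exists_push u u.hat.variation .rfl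
  exact ⟨f, hf, e⟩

/-- The density of `û` with respect to its total variation. -/
def density (u : FM n) : Rn n → Cn n := (exists_density u).choose

theorem integrable_density (u : FM n) : Integrable u.density u.hat.variation :=
  (exists_density u).choose_spec.1

theorem push_density (u : FM n) : push u.hat.variation id u.density = u :=
  (exists_density u).choose_spec.2.symm

theorem integral_norm_density (u : FM n) : ∫ ξ, ‖u.density ξ‖ ∂u.hat.variation = ‖u‖ := by
  rw [← norm_push_id u.integrable_density, push_density]

/-- The product `u_j v`. -/
def compMul (j : Fin n) (u v : FM n) : FM n :=
  push (u.hat.variation.prod v.hat.variation) (fun z => z.1 + z.2)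
    (prodDensity j u.density v.density)

theorem eval_compMul (j : Fin n) (u v : FM n) (x : Rn n) :
    compMul j u v x = u x j • v x := by
  have := eval_push_prod measurable_id measurable_id j u.integrable_density v.integrable_density x
  rw [push_density, push_density] at this
  exact this

theorem norm_compMul_le (j : Fin n) (u v : FM n) :
    ‖compMul j u v‖ ≤ fourierConst n * ‖u‖ * ‖v‖ := by
  refine (norm_push_le (by fun_prop) (integrable_prodDensity j u.integrable_density
    v.integrable_density)).trans ?_
  rw [mul_assoc, ← u.integral_norm_density, ← v.integral_norm_density, ← integral_prod_mul,
    ← integral_const_mul]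
  exact integral_mono (integrable_prodDensity j u.integrable_density v.integrable_density).norm
    ((u.integrable_density.norm.mul_prod v.integrable_density.norm).const_mul _)
    fun z => norm_prodDensity_le j _ _ z

/-- The product `u_j v` as a bounded bilinear map. -/
def B (j : Fin n) : FM n →L[ℂ] FM n →L[ℂ] FM n :=
  LinearMap.mkContinuous₂ (LinearMap.mk₂ ℂ (compMul j)
    (fun u u' v => eval_injective (funext fun x => by
      simp only [eval_compMul, eval_add, PiLp.add_apply, add_smul]))
    (fun c u v => eval_injective (funext fun x => by
      simp only [eval_compMul, eval_smul, PiLp.smul_apply, smul_assoc]))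
    (fun u v v' => eval_injective (funext fun x => by
      simp only [eval_compMul, eval_add, smul_add]))
    (fun c u v => eval_injective (funext fun x => by
      simp only [eval_compMul, eval_smul]; rw [smul_comm])))
    (fourierConst n) (fun u v => norm_compMul_le j u v)

theorem eval_B (j : Fin n) (u v : FM n) (x : Rn n) : B j u v x = u x j • v x :=
  eval_compMul j u v x

theorem norm_B_le (j : Fin n) (u v : FM n) : ‖B j u v‖ ≤ fourierConst n * ‖u‖ * ‖v‖ :=
  norm_compMul_le j u v

/-- `B` was built from chosen densities over the variations. By injectivity of evaluation, any other
representation of the factors yields the same product. -/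
theorem B_push {m : Measure X} {m' : Measure Y} [SFinite m] [SFinite m']
    {φ : X → Rn n} {ψ : Y → Rn n} (hφ : Measurable φ) (hψ : Measurable ψ)
    (j : Fin n) {f : X → Cn n} {g : Y → Cn n} (hf : Integrable f m) (hg : Integrable g m') :
    B j (push m φ f) (push m' ψ g) =
      push (m.prod m') (fun z => φ z.1 + ψ z.2) (prodDensity j f g) := by
  refine eval_injective (funext fun x => ?_)
  rw [eval_B]
  exact (eval_push_prod hφ hψ j hf hg x).symm

/-! ### Resolvent symbols -/

theorem one_add_sq_pos (ξ : Rn n) : 0 < 1 + ‖ξ‖ ^ 2 := by positivity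

theorem one_add_sq_ne (ξ : Rn n) : (1 + (‖ξ‖ : ℂ) ^ 2) ≠ 0 := by
  exact_mod_cast (one_add_sq_pos ξ).ne'

theorem continuous_resolvent : Continuous fun ξ : Rn n => (1 + (‖ξ‖ : ℂ) ^ 2)⁻¹ :=
  Continuous.inv₀ (by fun_prop) one_add_sq_ne

theorem norm_resolvent (ξ : Rn n) : ‖(1 + (‖ξ‖ : ℂ) ^ 2)⁻¹‖ = (1 + ‖ξ‖ ^ 2)⁻¹ := by
  rw [norm_inv]
  congr 1
  have : (1 + (‖ξ‖ : ℂ) ^ 2) = ((1 + ‖ξ‖ ^ 2 : ℝ) : ℂ) := by push_cast; rfl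
  rw [this, Complex.norm_real, Real.norm_of_nonneg (one_add_sq_pos ξ).le]

/-- The symbol `1 / (1 + |ξ|²)`. -/
def res (n : ℕ) : Rn n →ᵇ ℂ :=
  ofNormedAddCommGroup (fun ξ => (1 + (‖ξ‖ : ℂ) ^ 2)⁻¹) continuous_resolvent 1 fun ξ => by
    rw [norm_resolvent]
    exact inv_le_one_of_one_le₀ (by nlinarith [sq_nonneg ‖ξ‖])

/-- The symbol `ξ_k / (1 + |ξ|²)`. -/
def resX (k : Fin n) : Rn n →ᵇ ℂ :=
  ofNormedAddCommGroup (fun ξ => (ξ k : ℂ) * (1 + (‖ξ‖ : ℂ) ^ 2)⁻¹)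
    (Continuous.mul (by fun_prop) continuous_resolvent) 1 fun ξ => by
    rw [norm_mul, norm_resolvent, Complex.norm_real, ← div_eq_mul_inv,
      div_le_one (one_add_sq_pos ξ)]
    have := PiLp.norm_apply_le ξ k
    nlinarith [sq_nonneg (‖ξ‖ - 1), norm_nonneg ξ]

/-- The symbol `|ξ|² / (1 + |ξ|²)`. -/
def resSq (n : ℕ) : Rn n →ᵇ ℂ :=
  ofNormedAddCommGroup (fun ξ => (‖ξ‖ : ℂ) ^ 2 * (1 + (‖ξ‖ : ℂ) ^ 2)⁻¹)
    (Continuous.mul (by fun_prop) continuous_resolvent) 1 fun ξ => by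
    rw [norm_mul, norm_resolvent, norm_pow, Complex.norm_real, norm_norm, ← div_eq_mul_inv,
      div_le_one (one_add_sq_pos ξ)]
    linarith

theorem res_apply (ξ : Rn n) : res n ξ = (1 + (‖ξ‖ : ℂ) ^ 2)⁻¹ := rfl
theorem resX_apply (k : Fin n) (ξ : Rn n) :
    resX k ξ = (ξ k : ℂ) * (1 + (‖ξ‖ : ℂ) ^ 2)⁻¹ := rfl
theorem res_ne_zero (ξ : Rn n) : res n ξ ≠ 0 := by
  rw [res_apply]; exact inv_ne_zero (one_add_sq_ne ξ)

theorem sm_res_injective : Function.Injective (sm (res n)) := sm_injective res_ne_zero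

/-- `(1 - Δ)` applied to the product of `(1 - Δ)⁻¹ y` and `(1 - Δ)⁻¹ z`. -/
def Q (j : Fin n) (y z : FM n) : FM n :=
  B j y (sm (res n) z) + (2 : ℂ) • ∑ k, B j (sm (resX k) y) (sm (resX k) z)
    + B j (sm (res n) y) (sm (resSq n) z)

theorem continuous_Q_comp {T : Type*} [TopologicalSpace T] (j : Fin n) {f g : T → FM n}
    (hf : Continuous f) (hg : Continuous g) : Continuous fun t => Q j (f t) (g t) := by
  have e : (fun t => Q j (f t) (g t)) = fun t => B j (f t) (sm (res n) (g t)) +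
      (2 : ℂ) • ∑ k, B j (sm (resX k) (f t)) (sm (resX k) (g t))
      + B j (sm (res n) (f t)) (sm (resSq n) (g t)) := rfl
  rw [e]
  fun_prop

theorem sq_norm_add (ξ η : Rn n) :
    ((‖ξ + η‖ : ℂ)) ^ 2 = (‖ξ‖ : ℂ) ^ 2 + 2 * ∑ k, (ξ k : ℂ) * (η k : ℂ) + (‖η‖ : ℂ) ^ 2 := by
  have := norm_add_sq_real ξ η
  rw [PiLp.inner_apply] at this
  simp only [RCLike.inner_apply, conj_trivial] at this
  have h2 := congrArg (fun r : ℝ => (r : ℂ)) this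
  push_cast at h2
  rw [h2]
  simp only [mul_comm]

/-- A Leibniz rule, showing that the domain of 1-Δ is stable under products. After the factor
1/((1+|ξ|²)(1+|η|²)) is taken out, the three terms of `Q` contribute 1+|ξ|², 2ξ·η and |η|², which
sum to 1+|ξ+η|², the symbol of 1-Δ at the frequency of the product. -/
theorem B_res_res (j : Fin n) (y z : FM n) :
    B j (sm (res n) y) (sm (res n) z) = sm (res n) (Q j y z) := by
  obtain ⟨f, hf, e⟩ := exists_density y
  obtain ⟨g, hg, e'⟩ := exists_density z
  set m := y.hat.variation
  set m' := z.hat.variation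
  have hI := @integrable_bcf_smul n (Rn n) inferInstance
  have hB : ∀ p q : Rn n →ᵇ ℂ, B j (sm p y) (sm q z) = push (m.prod m') (fun w => w.1 + w.2)
      (prodDensity j (fun ξ => p ξ • f ξ) (fun ξ => q ξ • g ξ)) := by
    intro p q
    rw [e, e', sm_push measurable_id hf, sm_push measurable_id hg,
      B_push measurable_id measurable_id j (hI measurable_id hf p) (hI measurable_id hg q)]
    rfl
  have hBi : ∀ p q : Rn n →ᵇ ℂ, Integrable
      (prodDensity j (fun ξ => p ξ • f ξ) (fun ξ => q ξ • g ξ)) (m.prod m') := fun p q =>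
    integrable_prodDensity j (hI measurable_id hf p) (hI measurable_id hg q)
  have e1 : ∀ w : FM n, B j y w = B j (sm 1 y) w := fun w => by rw [sm_one]
  rw [Q, e1, hB, hB, hB]
  simp only [hB]
  have hS : Integrable (fun w => (2 : ℂ) • ∑ k, prodDensity j (fun ξ => resX k ξ • f ξ)
      (fun ξ => resX k ξ • g ξ) w) (m.prod m') :=
    (integrable_finsetSum _ fun k _ => hBi (resX k) (resX k)).smul (2 : ℂ)
  have hS1 : Integrable (fun w => prodDensity j (fun ξ => (1 : Rn n →ᵇ ℂ) ξ • f ξ)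
      (fun ξ => res n ξ • g ξ) w + (2 : ℂ) • ∑ k, prodDensity j (fun ξ => resX k ξ • f ξ)
      (fun ξ => resX k ξ • g ξ) w) (m.prod m') := (hBi 1 (res n)).add hS
  have hS2 : Integrable (fun w => prodDensity j (fun ξ => (1 : Rn n →ᵇ ℂ) ξ • f ξ)
      (fun ξ => res n ξ • g ξ) w + (2 : ℂ) • ∑ k, prodDensity j (fun ξ => resX k ξ • f ξ)
      (fun ξ => resX k ξ • g ξ) w + prodDensity j (fun ξ => res n ξ • f ξ)
      (fun ξ => resSq n ξ • g ξ) w) (m.prod m') := hS1.add (hBi _ _)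
  have hD : ∀ (p q : Rn n →ᵇ ℂ) (w : Rn n × Rn n), prodDensity j (fun ξ => p ξ • f ξ)
      (fun ξ => q ξ • g ξ) w = (p w.1 * q w.2) • prodDensity j f g w := by
    intro p q w
    simp only [prodDensity, PiLp.smul_apply, smul_eq_mul, smul_smul]
    congr 1
    ring
  rw [← push_finset_sum _ fun k _ => hBi _ _, ← push_smul, ← push_add (hBi _ _) hS,
    ← push_add hS1 (hBi _ _), sm_push (by fun_prop) hS2]
  · congr 1
    ext1 w
    have key : (1 + (‖w.1 + w.2‖ : ℂ) ^ 2)⁻¹ * ((1 + (‖w.2‖ : ℂ) ^ 2)⁻¹ +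
      2 * ∑ k, ((w.1 k : ℂ) * (1 + (‖w.1‖ : ℂ) ^ 2)⁻¹) * ((w.2 k : ℂ) * (1 + (‖w.2‖ : ℂ) ^ 2)⁻¹) +
      (1 + (‖w.1‖ : ℂ) ^ 2)⁻¹ * ((‖w.2‖ : ℂ) ^ 2 * (1 + (‖w.2‖ : ℂ) ^ 2)⁻¹)) =
        (1 + (‖w.1‖ : ℂ) ^ 2)⁻¹ * (1 + (‖w.2‖ : ℂ) ^ 2)⁻¹ := by
      have h1 := one_add_sq_ne w.1
      have h2 := one_add_sq_ne w.2
      have h3 := one_add_sq_ne (w.1 + w.2)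
      have h4 : ∑ k, ((w.1 k : ℂ) * (1 + (‖w.1‖ : ℂ) ^ 2)⁻¹) *
          ((w.2 k : ℂ) * (1 + (‖w.2‖ : ℂ) ^ 2)⁻¹) = (∑ k, (w.1 k : ℂ) * (w.2 k : ℂ)) *
          ((1 + (‖w.1‖ : ℂ) ^ 2)⁻¹ * (1 + (‖w.2‖ : ℂ) ^ 2)⁻¹) := by
        rw [Finset.sum_mul]
        exact Finset.sum_congr rfl fun k _ => by ring
      rw [h4, inv_mul_eq_iff_eq_mul₀ h3, sq_norm_add]
      field_simp
      ring
    simp only [hD, smul_smul, ← Finset.sum_smul, ← add_smul]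
    congr 1
    rw [show (1 : Rn n →ᵇ ℂ) w.1 = 1 from rfl, one_mul]
    exact key.symm

/-! ### Complex conjugation -/

/-- Componentwise complex conjugation on `ℂⁿ`. -/
def cconj (n : ℕ) : Cn n ≃ₗᵢ[ℝ] Cn n :=
  LinearIsometryEquiv.piLpCongrRight 2 fun _ => Complex.conjLIE

theorem cconj_apply (z : Cn n) (i : Fin n) : cconj n z i = (starRingEnd ℂ) (z i) := rfl

theorem cconj_smul (c : ℂ) (z : Cn n) : cconj n (c • z) = (starRingEnd ℂ) c • cconj n z := by
  ext i
  simp [cconj_apply]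

theorem integrable_cconj {m : Measure X} {f : X → Cn n} (hf : Integrable f m) :
    Integrable (fun x => cconj n (f x)) m :=
  (cconj n).toContinuousLinearEquiv.toContinuousLinearMap.integrable_comp hf

theorem eval_push_cconj {m : Measure X} {φ : X → Rn n} (hφ : Measurable φ) {f : X → Cn n}
    (hf : Integrable f m) (x : Rn n) :
    push m (fun y => -φ y) (fun y => cconj n (f y)) x = cconj n (push m φ f x) := by
  have hφ' : Measurable fun y => -φ y := hφ.neg
  rw [eval_push hφ' (integrable_cconj hf), eval_push hφ hf, map_smul]
  congr 1
  refine Eq.trans (integral_congr_ae (ae_of_all _ fun y => ?_))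
    ((cconj n).toContinuousLinearEquiv.toContinuousLinearMap.integral_comp_comm
      (integrable_exp_smul hφ hf x))
  change _ = cconj n (_ • _)
  simp only [cconj_smul, ← Complex.exp_conj, map_mul, Complex.conj_I, Complex.conj_ofReal,
    inner_neg_right, Complex.ofReal_neg]
  rw [mul_neg, neg_mul]

/-- Pointwise complex conjugation. -/
def conjFun (u : FM n) : FM n :=
  push u.hat.variation (fun ξ => -ξ) (fun ξ => cconj n (u.density ξ))

theorem eval_conjFun (u : FM n) (x : Rn n) : conjFun u x = cconj n (u x) := by
  have := eval_push_cconj measurable_id u.integrable_density x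
  rw [push_density] at this
  exact this

/-- Pointwise complex conjugation as a bounded real-linear operator. -/
def conj : FM n →L[ℝ] FM n :=
  LinearMap.mkContinuous
    { toFun := conjFun
      map_add' := fun u v => eval_injective (funext fun x => by
        simp only [eval_conjFun, eval_add, map_add])
      map_smul' := fun c u => eval_injective (funext fun x => by
        rw [RingHom.id_apply, ← Complex.coe_smul, ← Complex.coe_smul]
        simp only [eval_conjFun, eval_smul, cconj_smul, Complex.conj_ofReal]) } 1 (fun u => by
        refine (norm_push_le (by fun_prop) (integrable_cconj u.integrable_density)).trans ?_
        rw [one_mul, ← u.integral_norm_density]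
        simp)

theorem eval_conj (u : FM n) (x : Rn n) : conj u x = cconj n (u x) := eval_conjFun u x

theorem norm_conj_le (u : FM n) : ‖conj u‖ ≤ ‖u‖ := by
  have := (conj (n := n)).le_of_opNorm_le (LinearMap.mkContinuous_norm_le _ zero_le_one _) u
  rwa [one_mul] at this

theorem conj_push {m : Measure X} {φ : X → Rn n} (hφ : Measurable φ) {f : X → Cn n}
    (hf : Integrable f m) :
    conj (push m φ f) = push m (fun y => -φ y) (fun y => cconj n (f y)) :=
  eval_injective (funext fun x => by rw [eval_conj, eval_push_cconj hφ hf])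

theorem conj_smul (c : ℂ) (u : FM n) : conj (c • u) = (starRingEnd ℂ) c • conj u :=
  eval_injective (funext fun x => by simp only [eval_conj, eval_smul, cconj_smul])

/-- Conjugating a function conjugates its density and reflects the frequency, hence the symmetry
required of the symbols. -/
theorem conj_sm {p q : Rn n →ᵇ ℂ} (h : ∀ ξ, q (-ξ) = (starRingEnd ℂ) (p ξ)) (u : FM n) :
    conj (sm p u) = sm q (conj u) := by
  obtain ⟨f, hf, e⟩ := exists_density u
  rw [e, sm_push measurable_id hf, conj_push measurable_id hf,
    conj_push measurable_id (integrable_bcf_smul measurable_id hf p),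
    sm_push (show Measurable fun ξ : Rn n => -id ξ from measurable_neg) (integrable_cconj hf)]
  simp only [cconj_smul, id, h]

theorem helmSymbol_neg_cconj (ξ : Rn n) (z : Cn n) :
    helmSymbol (-ξ) (cconj n z) = cconj n (helmSymbol ξ z) := by
  by_cases h : ξ = 0
  · simp [h, helmSymbol_zero]
  · have h' : -ξ ≠ 0 := by simpa using h
    rw [helmSymbol_of_ne h, helmSymbol_of_ne h', helmholtzSymbol_apply, helmholtzSymbol_apply,
      map_sub, cconj_smul, norm_neg]
    have e1 : cconj n (complexify ξ) = complexify ξ := by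
      ext i; simp [cconj_apply, complexify]
    have e2 : complexify (-ξ) = -complexify ξ := by
      ext i; simp [complexify]
    have e3 : dotc (-ξ) (cconj n z) = -(starRingEnd ℂ) (dotc ξ z) := by
      simp [dotc, cconj_apply]
    rw [e1, e2, e3, map_div₀, Complex.conj_ofReal]
    simp [neg_div]

theorem conj_helm (u : FM n) : conj (helm u) = helm (conj u) := by
  obtain ⟨f, hf, e⟩ := exists_density u
  rw [e, helm_push measurable_id hf, conj_push measurable_id hf,
    conj_push measurable_id (integrable_helmSymbol measurable_id hf),
    helm_push (show Measurable fun ξ : Rn n => -id ξ from measurable_neg) (integrable_cconj hf)]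
  simp only [helmSymbol_neg_cconj, id]

theorem conj_B (j : Fin n) (u v : FM n) : conj (B j u v) = B j (conj u) (conj v) :=
  eval_injective (funext fun x => by
    simp only [eval_conj, eval_B, cconj_smul, cconj_apply])

theorem isReal_iff {u : FM n} : u.IsReal ↔ conj u = u := by
  constructor
  · intro h
    refine eval_injective (funext fun x => ?_)
    rw [eval_conj]
    ext i
    rw [cconj_apply]
    exact Complex.conj_eq_iff_im.2 (h x i)
  · intro h x j
    have := congrArg (fun w : FM n => w x j) h
    simp only [eval_conj, cconj_apply] at this
    exact Complex.conj_eq_iff_im.1 this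

theorem conj_sm_res (u : FM n) : conj (sm (res n) u) = sm (res n) (conj u) :=
  conj_sm (fun ξ => by simp [res_apply]) u

/-! ### The nonlinear terms -/

/-- Injectivity of evaluation makes the choice inside `ofFun` irrelevant. -/
theorem ofFun_eq {f : Rn n → Cn n} {w : FM n} (h : ∀ x, w x = f x) : ofFun f = w := by
  have h' : ∃ w : FM n, (w : Rn n → Cn n) = f := ⟨w, funext h⟩
  rw [ofFun, dif_pos h']
  exact eval_injective (h'.choose_spec.trans (funext h).symm)

/-- The cubic term `|u|² u`. -/
def cub (u : FM n) : FM n := ∑ j, B j u (B j (conj u) u)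

theorem eval_finset_sum {ι : Type*} (s : Finset ι) (u : ι → FM n) (x : Rn n) :
    (∑ i ∈ s, u i) x = ∑ i ∈ s, u i x := by
  simp only [← evalCLM_apply, map_sum]

theorem eval_cub (u : FM n) (x : Rn n) : cub u x = (‖u x‖ ^ 2 : ℝ) • u x := by
  rw [cub, eval_finset_sum]
  simp only [eval_B, eval_conj, cconj_apply, smul_smul, Complex.mul_conj, ← Finset.sum_smul]
  rw [← Complex.coe_smul, EuclideanSpace.norm_sq_eq]
  simp [Complex.normSq_eq_norm_sq]

theorem ofFun_cub (u : FM n) : ofFun (fun x => (‖u x‖ ^ 2 : ℝ) • u x) = cub u :=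
  ofFun_eq fun x => eval_cub u x

theorem ofFun_quad (j : Fin n) (u : FM n) : ofFun (fun x => u x j • u x) = B j u u :=
  ofFun_eq fun x => eval_B j u u x

theorem continuous_cub : Continuous (cub : FM n → FM n) := by
  unfold cub
  fun_prop

theorem continuous_quad (j : Fin n) : Continuous fun u : FM n => B j u u := by
  fun_prop

theorem conj_cub (u : FM n) : conj (cub u) = cub (conj u) := by
  simp only [cub, map_sum, conj_B]

theorem norm_quad_sub_le (j : Fin n) (u v : FM n) :
    ‖B j u u - B j v v‖ ≤ fourierConst n * (‖u‖ + ‖v‖) * ‖u - v‖ := by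
  have e : B j u u - B j v v = B j (u - v) u + B j v (u - v) := by
    simp only [map_sub, _root_.sub_apply]
    abel
  rw [e]
  refine (norm_add_le _ _).trans ?_
  have h1 := norm_B_le j (u - v) u
  have h2 := norm_B_le j v (u - v)
  linarith

theorem cub_arith {c a b d : ℝ} (ha : 0 ≤ a) (hb : 0 ≤ b) (hd : 0 ≤ d) :
    c ^ 2 * (a ^ 2 + b * a + b ^ 2) * d ≤ c ^ 2 * (a + b) ^ 2 * d := by
  have h : a ^ 2 + b * a + b ^ 2 ≤ (a + b) ^ 2 := by nlinarith [mul_nonneg ha hb]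
  have hc2 : 0 ≤ c ^ 2 := sq_nonneg c
  exact mul_le_mul_of_nonneg_right (mul_le_mul_of_nonneg_left h hc2) hd

/-- The cubic term is trilinear over the reals, so the difference telescopes into three products,
each containing one factor u - v. -/
theorem norm_cub_sub_le (u v : FM n) :
    ‖cub u - cub v‖ ≤ n * fourierConst n ^ 2 * (‖u‖ + ‖v‖) ^ 2 * ‖u - v‖ := by
  rw [cub, cub, ← Finset.sum_sub_distrib]
  have key : ∀ j : Fin n, ‖B j u (B j (conj u) u) - B j v (B j (conj v) v)‖ ≤
      fourierConst n ^ 2 * (‖u‖ + ‖v‖) ^ 2 * ‖u - v‖ := by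
    intro j
    have e : B j u (B j (conj u) u) - B j v (B j (conj v) v) =
        B j (u - v) (B j (conj u) u) + B j v (B j (conj (u - v)) u)
          + B j v (B j (conj v) (u - v)) := by
      simp only [map_sub, _root_.sub_apply]
      abel
    have hc := (fourierConst_pos n).le
    have h (a b c : FM n) : ‖B j a (B j (conj b) c)‖ ≤
        fourierConst n ^ 2 * (‖a‖ * ‖b‖ * ‖c‖) := by
      refine (norm_B_le j _ _).trans ?_
      calc fourierConst n * ‖a‖ * ‖B j (conj b) c‖
          ≤ fourierConst n * ‖a‖ * (fourierConst n * ‖b‖ * ‖c‖) := by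
            gcongr
            refine (norm_B_le j _ _).trans ?_
            gcongr
            exact norm_conj_le b
        _ = _ := by ring
    rw [e]
    refine (norm_add_le _ _).trans ((add_le_add (norm_add_le _ _) le_rfl).trans ?_)
    refine (add_le_add (add_le_add (h _ _ _) (h _ _ _)) (h _ _ _)).trans ?_
    have h1 := norm_nonneg u
    have h2 := norm_nonneg v
    calc fourierConst n ^ 2 * (‖u - v‖ * ‖u‖ * ‖u‖) + fourierConst n ^ 2 * (‖v‖ * ‖u - v‖ * ‖u‖)
          + fourierConst n ^ 2 * (‖v‖ * ‖v‖ * ‖u - v‖)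
        = fourierConst n ^ 2 * (‖u‖ ^ 2 + ‖v‖ * ‖u‖ + ‖v‖ ^ 2) * ‖u - v‖ := by ring
      _ ≤ fourierConst n ^ 2 * (‖u‖ + ‖v‖) ^ 2 * ‖u - v‖ :=
        cub_arith h1 h2 (norm_nonneg _)
  calc _ ≤ ∑ j : Fin n, fourierConst n ^ 2 * (‖u‖ + ‖v‖) ^ 2 * ‖u - v‖ :=
        norm_sum_le_of_le _ fun j _ => key j
    _ = _ := by simp; ring

/-- `(1 - Δ)` applied to the cubic term of `(1 - Δ)⁻¹ y`. -/
def cubQ (y : FM n) : FM n := ∑ j, Q j y (Q j (conj y) y)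

theorem continuous_cubQ : Continuous (cubQ : FM n → FM n) :=
  continuous_finsetSum (f := fun j y => Q j y (Q j (conj y) y)) Finset.univ fun j _ =>
    continuous_Q_comp j continuous_id (continuous_Q_comp j conj.continuous continuous_id)

theorem cub_res (y : FM n) : cub (sm (res n) y) = sm (res n) (cubQ y) := by
  simp only [cub, cubQ, map_sum, conj_sm_res, B_res_res]

attribute [irreducible] B conj Q cub cubQ

end FM
end ActiveFluid

/-! ### Integral equations with weakly singular kernels -/

namespace ActiveFluid

namespace Duhamel

open Filter Topology BoundedContinuousFunction

variable {E : Type*} [NormedAddCommGroup E] [NormedSpace ℝ E]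

/-! ### Weakly singular kernels -/

/-- The kernel `τ^(-θ) e^(-kτ)`. -/
def sing (θ k τ : ℝ) : ℝ := τ ^ (-θ) * Real.exp (-(k * τ))

theorem sing_nonneg {θ k τ : ℝ} (hτ : 0 ≤ τ) : 0 ≤ sing θ k τ := by
  unfold sing; positivity

theorem sing_le {θ k τ : ℝ} (hk : 0 ≤ k) (hτ : 0 ≤ τ) : sing θ k τ ≤ τ ^ (-θ) := by
  unfold sing
  refine mul_le_of_le_one_right (by positivity) (Real.exp_le_one_iff.2 ?_)
  have := mul_nonneg hk hτ
  linarith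

theorem measurable_sing (θ k : ℝ) : Measurable (sing θ k) := by
  unfold sing; fun_prop

theorem integrableOn_sing {θ k : ℝ} (hθ : θ < 1) (hk : 0 < k) :
    IntegrableOn (sing θ k) (Ioi 0) := by
  have := integrableOn_rpow_mul_exp_neg_mul_rpow (p := 1) (s := -θ) (b := k) (by linarith)
    one_pos hk
  refine this.congr_fun (fun x _ => ?_) measurableSet_Ioi
  simp [sing]

/-- `∫₀^∞ τ^(-θ) e^(-kτ) dτ`. -/
def singMass (θ k : ℝ) : ℝ := (1 / k) ^ (1 - θ) * Real.Gamma (1 - θ)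

theorem integral_sing {θ k : ℝ} (hθ : θ < 1) (hk : 0 < k) :
    ∫ τ in Ioi 0, sing θ k τ = singMass θ k := by
  rw [singMass, ← Real.integral_rpow_mul_exp_neg_mul_Ioi (by linarith) hk]
  simp [sing]

theorem singMass_pos {θ k : ℝ} (hθ : θ < 1) (hk : 0 < k) : 0 < singMass θ k := by
  have := Real.Gamma_pos_of_pos (show 0 < 1 - θ by linarith)
  unfold singMass; positivity

theorem intervalIntegrable_sing {θ k : ℝ} (hθ : θ < 1) (hk : 0 ≤ k) {a b : ℝ} (hab : a ≤ b) :
    IntervalIntegrable (fun s => sing θ k (b - s)) volume a b := by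
  have h1 : IntervalIntegrable (fun x : ℝ => x ^ (-θ)) volume (b - a) (b - b) :=
    intervalIntegral.intervalIntegrable_rpow' (by linarith)
  have h2 := h1.comp_sub_left b
  simp only [sub_sub_cancel] at h2
  refine h2.mono_fun' ((measurable_sing θ k).comp (by fun_prop)).aestronglyMeasurable ?_
  refine (ae_restrict_mem measurableSet_uIoc).mono fun s hs => ?_
  rw [uIoc_of_le hab] at hs
  beta_reduce
  rw [Real.norm_of_nonneg (sing_nonneg (by linarith [hs.2]))]
  exact sing_le hk (by linarith [hs.2])

theorem integral_sing_le {θ k : ℝ} (hθ : θ < 1) (hk : 0 < k) {a b : ℝ} (hab : a ≤ b) :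
    ∫ s in a..b, sing θ k (b - s) ≤ singMass θ k := by
  rw [intervalIntegral.integral_comp_sub_left (sing θ k) b, sub_self,
    intervalIntegral.integral_of_le (by linarith), ← integral_sing hθ hk]
  refine setIntegral_mono_set (integrableOn_sing hθ hk) ?_ (ae_of_all _ fun x hx => hx.1)
  exact (ae_restrict_mem measurableSet_Ioi).mono fun x hx => sing_nonneg (le_of_lt hx)

/-! ### Convolution with a weakly singular kernel -/

variable {G : ℝ → ℝ → E} {θ k C : ℝ}

omit [NormedSpace ℝ E] in
theorem aestronglyMeasurable_conv {a t : ℝ}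
    (hG : ContinuousOn (Function.uncurry G) (Ioi 0 ×ˢ Ioo a t)) :
    AEStronglyMeasurable (fun s => G (t - s) s) (volume.restrict (Ioo a t)) := by
  refine ContinuousOn.aestronglyMeasurable ?_ measurableSet_Ioo
  exact hG.comp (f := fun s => (t - s, s)) (by fun_prop) fun s hs => ⟨by simpa using hs.2, hs⟩

omit [NormedSpace ℝ E] in
theorem intervalIntegrable_conv {a t : ℝ}
    (hG : ContinuousOn (Function.uncurry G) (Ioi 0 ×ˢ Ioo a t))
    (hθ : θ < 1) (hk : 0 ≤ k) (hC : ∀ τ, 0 < τ → ∀ s ∈ Ioo a t, ‖G τ s‖ ≤ C * sing θ k τ)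
    (hat : a ≤ t) : IntervalIntegrable (fun s => G (t - s) s) volume a t := by
  refine ((intervalIntegrable_sing hθ hk hat).const_mul C).mono_fun' ?_ ?_
  · rw [uIoc_of_le hat, restrict_Ioo_eq_restrict_Ioc.symm]
    exact aestronglyMeasurable_conv hG
  · rw [uIoc_of_le hat, restrict_Ioo_eq_restrict_Ioc.symm]
    exact (ae_restrict_mem measurableSet_Ioo).mono fun s hs => hC _ (by linarith [hs.2]) s hs

theorem norm_integral_conv_le {f : ℝ → E} (hθ : θ < 1) (hk : 0 ≤ k) {a t : ℝ} (hat : a ≤ t)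
    (hC : ∀ s, a ≤ s → s < t → ‖f s‖ ≤ C * sing θ k (t - s)) :
    ‖∫ s in a..t, f s‖ ≤ C * ∫ s in a..t, sing θ k (t - s) := by
  rw [← intervalIntegral.integral_const_mul]
  refine intervalIntegral.norm_integral_le_of_norm_le hat ?_
    ((intervalIntegrable_sing hθ hk hat).const_mul C)
  have : ∀ᵐ s : ℝ, s ≠ t := by simp [ae_iff]
  filter_upwards [this] with s hs hs'
  exact hC s hs'.1.le (lt_of_le_of_ne hs'.2 hs)

/-- The substitution τ = t - s fixes the singularity at τ = 0 and moves t into the regular argument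
and the domain of integration. Dominated convergence then applies with majorant C τ^(-θ). -/
theorem continuousOn_conv [CompleteSpace E]
    (hG : ContinuousOn (Function.uncurry G) (Ioi 0 ×ˢ univ))
    (hθ : θ < 1) (hk : 0 ≤ k) (hC0 : 0 ≤ C) (hC : ∀ τ, 0 < τ → ∀ s, ‖G τ s‖ ≤ C * sing θ k τ)
    (a : ℝ) : ContinuousOn (fun t => ∫ s in a..t, G (t - s) s) (Ici a) := by
  have e : ∀ t ∈ Ici a, ∫ s in a..t, G (t - s) s =
      ∫ τ, (Ioo 0 (t - a)).indicator (fun τ => G τ (t - τ)) τ := by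
    intro t ht
    have := intervalIntegral.integral_comp_sub_left (a := a) (b := t) (fun τ => G τ (t - τ)) t
    simp only [sub_sub_cancel, sub_self] at this
    rw [this, intervalIntegral.integral_of_le (by linarith [mem_Ici.1 ht]),
      integral_Ioc_eq_integral_Ioo, integral_indicator measurableSet_Ioo]
  refine ContinuousOn.congr ?_ e
  refine Continuous.continuousOn (continuous_iff_continuousAt.2 fun t₀ => ?_)
  refine tendsto_integral_filter_of_dominated_convergence
    -- The margin 1 lets one majorant serve all t < t₀ + 1.
    ((Ioo 0 (t₀ - a + 1)).indicator fun τ => C * τ ^ (-θ)) ?_ ?_ ?_ ?_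
  · refine Eventually.of_forall fun t => ?_
    rw [aestronglyMeasurable_indicator_iff measurableSet_Ioo]
    refine ContinuousOn.aestronglyMeasurable ?_ measurableSet_Ioo
    exact hG.comp (f := fun τ => (τ, t - τ)) (by fun_prop) fun s hs => ⟨hs.1, trivial⟩
  · filter_upwards [Iio_mem_nhds (show t₀ < t₀ + 1 by linarith)] with t ht
    refine ae_of_all _ fun τ => ?_
    by_cases hτ : τ ∈ Ioo 0 (t - a)
    · have : τ ∈ Ioo 0 (t₀ - a + 1) := ⟨hτ.1, by linarith [hτ.2, mem_Iio.1 ht]⟩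
      rw [indicator_of_mem hτ, indicator_of_mem this]
      refine (hC τ hτ.1 _).trans ?_
      gcongr
      exact sing_le hk hτ.1.le
    · rw [indicator_of_notMem hτ, norm_zero]
      refine indicator_nonneg (fun τ hτ => ?_) _
      have := hτ.1.le
      positivity
  · rw [integrable_indicator_iff measurableSet_Ioo]
    have h1 : IntervalIntegrable (fun x : ℝ => C * x ^ (-θ)) volume 0 (t₀ - a + 1) :=
      (intervalIntegral.intervalIntegrable_rpow' (by linarith)).const_mul C
    exact h1.1.mono_set Ioo_subset_Ioc_self
  -- The indicator of the moving interval is continuous in t at t₀ except at the single endpoint τ =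
  -- t₀ - a, which is a null set.
  · have : ∀ᵐ τ : ℝ, τ ≠ t₀ - a := by simp [ae_iff]
    filter_upwards [this] with τ hτ
    by_cases h0 : 0 < τ
    · rcases lt_or_gt_of_ne hτ with h | h
      · have ev : ∀ᶠ t in 𝓝 t₀, G τ (t - τ) = (Ioo 0 (t - a)).indicator (fun τ => G τ (t - τ)) τ := by
          filter_upwards [Ioi_mem_nhds (show a + τ < t₀ by linarith)] with t ht
          have hm : τ ∈ Ioo 0 (t - a) := ⟨h0, by linarith [mem_Ioi.1 ht]⟩
          rw [indicator_of_mem hm]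
        refine Tendsto.congr' ev ?_
        have hm : τ ∈ Ioo 0 (t₀ - a) := ⟨h0, h⟩
        rw [indicator_of_mem hm]
        have : ContinuousAt (Function.uncurry G) (τ, t₀ - τ) :=
          hG.continuousAt ((isOpen_Ioi.prod isOpen_univ).mem_nhds ⟨h0, trivial⟩)
        exact this.tendsto.comp (f := fun t => (τ, t - τ)) (by
          refine Continuous.tendsto' ?_ _ _ rfl
          fun_prop)
      · have ev : ∀ᶠ t in 𝓝 t₀, 0 = (Ioo 0 (t - a)).indicator (fun τ => G τ (t - τ)) τ := by
          filter_upwards [Iio_mem_nhds (show t₀ < a + τ by linarith)] with t ht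
          rw [indicator_of_notMem]
          exact fun h' => by linarith [mem_Iio.1 ht, h'.2]
        refine Tendsto.congr' ev ?_
        rw [indicator_of_notMem (fun h' => by linarith [h'.2])]
        exact tendsto_const_nhds
    · have : ∀ t, (Ioo 0 (t - a)).indicator (fun τ => G τ (t - τ)) τ = 0 := fun t =>
        indicator_of_notMem (fun h => h0 h.1) _
      simp only [this]
      exact tendsto_const_nhds

/-! ### A Gronwall inequality for weakly singular kernels -/

/-- The mass of the kernel is a constant times k^(-(1-θ)), so a strong exponential weight makes it
arbitrarily small. -/
theorem exists_mul_singMass_lt (hθ : θ < 1) (L : ℝ) : ∃ k, 0 < k ∧ L * singMass θ k < 1 := by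
  have h : Tendsto (fun k : ℝ => L * singMass θ k) atTop (𝓝 (L * (0 * Real.Gamma (1 - θ)))) := by
    refine Tendsto.const_mul _ (Tendsto.mul_const _ ?_)
    have h1 := tendsto_rpow_neg_atTop (show 0 < 1 - θ by linarith)
    refine h1.congr' ?_
    filter_upwards [eventually_gt_atTop 0] with k hk
    rw [one_div, Real.inv_rpow hk.le, Real.rpow_neg hk.le]
  rw [zero_mul, mul_zero] at h
  obtain ⟨k, h1, h2⟩ := ((h.eventually (Iio_mem_nhds one_pos)).and (eventually_gt_atTop 0)).exists
  exact ⟨k, h2, h1⟩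

/-- At a maximum point of e^(-kt) φ(t), with maximum M, the weight turns the kernel into τ^(-θ)
e^(-kτ), and the hypothesis gives M ≤ L · `singMass θ k` · M. For large k the factor is less than 1,
so M = 0. -/
theorem eq_zero_of_le_integral {φ : ℝ → ℝ} {a T L : ℝ} (hθ : θ < 1) (hL : 0 ≤ L)
    (hφ : ContinuousOn φ (Icc a T)) (h0 : ∀ t ∈ Icc a T, 0 ≤ φ t)
    (h : ∀ t ∈ Icc a T, φ t ≤ L * ∫ s in a..t, sing θ 0 (t - s) * φ s) :
    ∀ t ∈ Icc a T, φ t = 0 := by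
  intro t ht
  obtain ⟨k, hk, hk1⟩ := exists_mul_singMass_lt hθ L
  obtain ⟨t₁, ht₁, hmax⟩ := isCompact_Icc.exists_isMaxOn ⟨t, ht⟩
    (show ContinuousOn (fun t => Real.exp (-(k * t)) * φ t) (Icc a T) by fun_prop)
  set M := Real.exp (-(k * t₁)) * φ t₁ with hM
  have hM0 : 0 ≤ M := mul_nonneg (Real.exp_pos _).le (h0 t₁ ht₁)
  have hb : ∀ s ∈ Icc a T, φ s ≤ Real.exp (k * s) * M := by
    intro s hs
    have : Real.exp (-(k * s)) * φ s ≤ M := hmax hs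
    calc φ s = Real.exp (k * s) * (Real.exp (-(k * s)) * φ s) := by
          rw [← mul_assoc, ← Real.exp_add]; simp
      _ ≤ _ := by gcongr
  have hI : ∫ s in a..t₁, sing θ 0 (t₁ - s) * φ s ≤
      Real.exp (k * t₁) * M * singMass θ k := by
    have h1 : ∫ s in a..t₁, sing θ 0 (t₁ - s) * φ s ≤
        ∫ s in a..t₁, (Real.exp (k * t₁) * M) * sing θ k (t₁ - s) := by
      have hi := (intervalIntegrable_sing hθ hk.le ht₁.1).const_mul (Real.exp (k * t₁) * M)
      have hp : ∀ s ∈ Icc a t₁, sing θ 0 (t₁ - s) * φ s ≤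
          (Real.exp (k * t₁) * M) * sing θ k (t₁ - s) := by
        intro s hs
        have hs' : s ∈ Icc a T := ⟨hs.1, hs.2.trans ht₁.2⟩
        calc sing θ 0 (t₁ - s) * φ s ≤ sing θ 0 (t₁ - s) * (Real.exp (k * s) * M) := by
              gcongr
              · exact sing_nonneg (by linarith [hs.2])
              · exact hb s hs'
          _ = (t₁ - s) ^ (-θ) * Real.exp (k * s) * M := by simp [sing]; ring
          _ = (t₁ - s) ^ (-θ) * (Real.exp (k * t₁) * Real.exp (-(k * (t₁ - s)))) * M := by
              rw [← Real.exp_add]; ring_nf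
          _ = _ := by simp only [sing]; ring
      refine intervalIntegral.integral_mono_on ht₁.1 (hi.mono_fun' ?_ ?_) hi hp
      · rw [uIoc_of_le ht₁.1]
        refine AEStronglyMeasurable.mul
          ((measurable_sing θ 0).comp (by fun_prop)).aestronglyMeasurable ?_
        exact ((hφ.mono (Icc_subset_Icc le_rfl ht₁.2)).mono Ioc_subset_Icc_self
          ).aestronglyMeasurable measurableSet_Ioc
      · refine (ae_restrict_mem measurableSet_uIoc).mono fun s hs => ?_
        rw [uIoc_of_le ht₁.1] at hs
        have hs' : s ∈ Icc a t₁ := Ioc_subset_Icc_self hs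
        beta_reduce
        rw [Real.norm_of_nonneg (mul_nonneg (sing_nonneg (by linarith [hs.2]))
          (h0 s ⟨hs'.1, hs'.2.trans ht₁.2⟩))]
        exact hp s hs'
    refine h1.trans ?_
    rw [intervalIntegral.integral_const_mul]
    gcongr
    exact integral_sing_le hθ hk ht₁.1
  have h2 : φ t₁ = Real.exp (k * t₁) * M := by
    rw [hM, ← mul_assoc, ← Real.exp_add]; simp
  have h3 := (h t₁ ht₁).trans (mul_le_mul_of_nonneg_left hI hL)
  rw [h2] at h3
  have h4 : M ≤ L * singMass θ k * M := by
    have := Real.exp_pos (k * t₁)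
    refine le_of_mul_le_mul_left ?_ this
    linarith
  have h5 : M = 0 := by nlinarith
  have := hb t ht
  rw [h5, mul_zero] at this
  exact le_antisymm this (h0 t ht)

/-! ### Mild solutions of semilinear equations -/

/-- One half of the exponential decay is passed on to the solution, the other half keeps the kernel
integrable on (0,∞). -/
theorem sing_split (θ k τ : ℝ) : sing θ k τ = Real.exp (-(k / 2 * τ)) * sing θ (k / 2) τ := by
  rw [sing, sing, mul_left_comm, ← Real.exp_add]
  congr 2
  ring

/-- The integrands `N τ u` are locally Lipschitz in `u`, with a weakly singular constant. -/
structure IsSingularNonlinearity (N : ℝ → E → E) (θ μ C : ℝ) : Prop where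
  lt_one : θ < 1
  pos : 0 < μ
  nonneg : 0 ≤ C
  continuousOn : ContinuousOn (Function.uncurry N) (Ioi 0 ×ˢ univ)
  map_zero : ∀ τ, 0 < τ → N τ 0 = 0
  lipschitz : ∀ τ, 0 < τ → ∀ u v, ‖N τ u - N τ v‖ ≤
    C * sing θ μ τ * ((1 + ‖u‖ + ‖v‖) * (‖u‖ + ‖v‖) * ‖u - v‖)

namespace IsSingularNonlinearity

variable {N : ℝ → E → E} {μ : ℝ} (hN : IsSingularNonlinearity N θ μ C)
include hN

omit [NormedSpace ℝ E] in
theorem norm_le {τ : ℝ} (hτ : 0 < τ) (u : E) :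
    ‖N τ u‖ ≤ C * sing θ μ τ * ((1 + ‖u‖) * ‖u‖ * ‖u‖) := by
  simpa [hN.map_zero τ hτ] using hN.lipschitz τ hτ u 0

omit [NormedSpace ℝ E] in
theorem norm_le_of_le {τ M : ℝ} (hτ : 0 < τ) {u : E} (hu : ‖u‖ ≤ M) :
    ‖N τ u‖ ≤ C * ((1 + M) * M * M) * sing θ μ τ := by
  refine (hN.norm_le hτ u).trans ?_
  rw [mul_right_comm]
  have := hN.nonneg
  have := sing_nonneg (θ := θ) (k := μ) hτ.le
  have : 0 ≤ M := (norm_nonneg u).trans hu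
  gcongr

omit [NormedSpace ℝ E] in
theorem intervalIntegrable {a t M : ℝ} (hat : a ≤ t) {u : ℝ → E} (hu : ContinuousOn u (Ioo a t))
    (hM : ∀ s ∈ Ioo a t, ‖u s‖ ≤ M) :
    IntervalIntegrable (fun s => N (t - s) (u s)) volume a t := by
  refine intervalIntegrable_conv (G := fun τ s => N τ (u s)) ?_ hN.lt_one hN.pos.le
    (fun τ hτ s hs => hN.norm_le_of_le hτ (hM s hs)) hat
  exact hN.continuousOn.comp (f := fun p : ℝ × ℝ => (p.1, u p.2))
    (continuousOn_fst.prodMk (hu.comp continuousOn_snd fun p hp => hp.2)) fun p hp => ⟨hp.1, trivial⟩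

theorem continuousOn_integral [CompleteSpace E] {a M : ℝ} {u : ℝ → E} (hu : Continuous u)
    (hM : ∀ s, ‖u s‖ ≤ M) :
    ContinuousOn (fun t => ∫ s in a..t, N (t - s) (u s)) (Ici a) := by
  have hM0 : 0 ≤ M := (norm_nonneg _).trans (hM 0)
  have := hN.nonneg
  refine continuousOn_conv (G := fun τ s => N τ (u s)) ?_ hN.lt_one hN.pos.le
    (C := C * ((1 + M) * M * M)) (by positivity)
    (fun τ hτ s => hN.norm_le_of_le hτ (hM s)) a
  exact hN.continuousOn.comp (f := fun p : ℝ × ℝ => (p.1, u p.2))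
    (continuousOn_fst.prodMk (by fun_prop)) fun p hp => ⟨hp.1, trivial⟩

/-- On a compact interval both solutions are bounded, so the nonlinearity is Lipschitz along them
and the singular Gronwall inequality applies to ‖u - v‖. No smallness is needed. -/
theorem eqOn_of_eq_integral {a T : ℝ} {u v f : ℝ → E} (hu : ContinuousOn u (Icc a T))
    (hv : ContinuousOn v (Icc a T))
    (eu : ∀ t ∈ Icc a T, u t = f t - ∫ s in a..t, N (t - s) (u s))
    (ev : ∀ t ∈ Icc a T, v t = f t - ∫ s in a..t, N (t - s) (v s)) : EqOn u v (Icc a T) := by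
  obtain ⟨M₁, hM₁⟩ := isCompact_Icc.exists_bound_of_continuousOn hu
  obtain ⟨M₂, hM₂⟩ := isCompact_Icc.exists_bound_of_continuousOn hv
  have hC := hN.nonneg
  intro t ht
  have hM₁0 : 0 ≤ M₁ := (norm_nonneg _).trans (hM₁ t ht)
  have hM₂0 : 0 ≤ M₂ := (norm_nonneg _).trans (hM₂ t ht)
  have key : ∀ t ∈ Icc a T, ‖u t - v t‖ = 0 := by
    refine eq_zero_of_le_integral (θ := θ) (L := C * ((1 + M₁ + M₂) * (M₁ + M₂)))
      hN.lt_one (by positivity) (hu.sub hv).norm (fun _ _ => norm_nonneg _) fun t ht => ?_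
    have hsub : Ioo a t ⊆ Icc a T := fun s hs => ⟨hs.1.le, hs.2.le.trans ht.2⟩
    have iu := hN.intervalIntegrable ht.1 (hu.mono hsub) fun s hs => hM₁ s (hsub hs)
    have iv := hN.intervalIntegrable ht.1 (hv.mono hsub) fun s hs => hM₂ s (hsub hs)
    rw [eu t ht, ev t ht, sub_sub_sub_cancel_left, ← intervalIntegral.integral_sub iv iu,
      ← intervalIntegral.integral_const_mul]
    refine intervalIntegral.norm_integral_le_of_norm_le ht.1 ?_ ?_
    · have : ∀ᵐ s : ℝ, s ≠ t := by simp [ae_iff]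
      filter_upwards [this] with s hs hs'
      have hst : 0 < t - s := by linarith [lt_of_le_of_ne hs'.2 hs]
      have hsT : s ∈ Icc a T := ⟨hs'.1.le, hs'.2.trans ht.2⟩
      have h1 := hM₁ s hsT
      have h2 := hM₂ s hsT
      rw [norm_sub_rev]
      refine (hN.lipschitz _ hst _ _).trans ?_
      have h3 : sing θ μ (t - s) ≤ sing θ 0 (t - s) := by
        simpa [sing] using sing_le (θ := θ) hN.pos.le hst.le
      have h4 := sing_nonneg (θ := θ) (k := 0) hst.le
      calc _ ≤ C * sing θ 0 (t - s) * ((1 + M₁ + M₂) * (M₁ + M₂) * ‖u s - v s‖) := by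
            gcongr
        _ = _ := by ring
    · have hi := (intervalIntegrable_sing hN.lt_one le_rfl ht.1).mul_continuousOn
        (g := fun s => ‖u s - v s‖) (by
          rw [uIcc_of_le ht.1]
          exact ((hu.sub hv).norm).mono (Icc_subset_Icc le_rfl ht.2))
      exact hi.const_mul _
  exact sub_eq_zero.1 (norm_eq_zero.1 (key t ht))

/-- Banach's fixed point theorem for f(t) = e^(μt/2) u(t) in the closed ball of radius 2r of bounded
continuous functions. The nonlinearity is at least quadratic, so its Lipschitz constant on the ball
is small with r. -/
theorem exists_eq_integral [CompleteSpace E] {S : ℝ → E} {r : ℝ} (hr : 0 ≤ r)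
    (hS : ContinuousOn S (Ici 0)) (hSr : ∀ t, 0 ≤ t → ‖S t‖ ≤ Real.exp (-(μ * t)) * r)
    (hsmall : C * singMass θ (μ / 2) * ((1 + 4 * r) * (4 * r)) ≤ 1 / 2) :
    ∃ u : ℝ → E, ContinuousOn u (Ici 0) ∧
      (∀ t, 0 ≤ t → ‖u t‖ ≤ Real.exp (-(μ / 2 * t)) * (2 * r)) ∧
      ∀ t, 0 ≤ t → u t = S t - ∫ s in (0 : ℝ)..t, N (t - s) (u s) := by
  have hμ := hN.pos
  have hC := hN.nonneg
  have hθ := hN.lt_one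
  set K := C * singMass θ (μ / 2) with hK
  have hK0 : 0 ≤ K := mul_nonneg hC (singMass_pos hθ (by positivity)).le
  -- `w f` is the unweighted function belonging to f. Replacing s by max s 0 extends everything to
  -- the whole line, so that the fixed point argument can run in `ℝ →ᵇ E`.
  set w : (ℝ →ᵇ E) → ℝ → E := fun f s => Real.exp (-(μ / 2 * max s 0)) • f s with hw
  have hwc : ∀ f, Continuous (w f) := fun f => by
    have := f.continuous
    simp only [hw]; fun_prop
  have hwn : ∀ f s, ‖w f s‖ ≤ Real.exp (-(μ / 2 * max s 0)) * ‖f‖ := fun f s => by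
    rw [hw, norm_smul, Real.norm_of_nonneg (Real.exp_pos _).le]
    gcongr
    exact f.norm_coe_le_norm s
  have hwn' : ∀ f s, ‖w f s‖ ≤ ‖f‖ := fun f s => by
    refine (hwn f s).trans (mul_le_of_le_one_left (norm_nonneg _) (Real.exp_le_one_iff.2 ?_))
    have : 0 ≤ max s 0 := le_max_right _ _
    have : 0 ≤ μ / 2 * max s 0 := by positivity
    linarith
  have hdiff : ∀ f g t, 0 ≤ t → ‖(∫ s in (0 : ℝ)..t, N (t - s) (w f s)) -
      ∫ s in (0 : ℝ)..t, N (t - s) (w g s)‖ ≤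
        Real.exp (-(μ / 2 * t)) * (K * ((1 + ‖f‖ + ‖g‖) * (‖f‖ + ‖g‖)) * ‖f - g‖) := by
    intro f g t ht
    have jf := hN.intervalIntegrable ht (hwc f).continuousOn fun s _ => hwn' f s
    have jg := hN.intervalIntegrable ht (hwc g).continuousOn fun s _ => hwn' g s
    rw [← intervalIntegral.integral_sub jf jg]
    set A := (1 + ‖f‖ + ‖g‖) * (‖f‖ + ‖g‖) with hA
    refine (norm_integral_conv_le (θ := θ) (k := μ / 2)
      (C := Real.exp (-(μ / 2 * t)) * (C * A * ‖f - g‖))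
      hθ (by positivity) ht fun s hs hst => ?_).trans ?_
    · have hst' : 0 < t - s := by linarith
      refine (hN.lipschitz _ hst' _ _).trans ?_
      have e1 : ‖w f s - w g s‖ ≤ Real.exp (-(μ / 2 * s)) * ‖f - g‖ := by
        have := hwn (f - g) s
        rw [max_eq_left hs] at this
        simpa [hw, smul_sub, max_eq_left hs] using this
      -- The weights in the Lipschitz factor are simply dropped: the one weight kept on the
      -- difference already recombines with the kernel to e^(-μt/2).
      have e2 : (1 + ‖w f s‖ + ‖w g s‖) * (‖w f s‖ + ‖w g s‖) ≤ A := by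
        rw [hA]
        have := hwn' f s
        have := hwn' g s
        gcongr
      have h4 := sing_nonneg (θ := θ) (k := μ / 2) hst'.le
      rw [sing_split]
      calc _ ≤ C * (Real.exp (-(μ / 2 * (t - s))) * sing θ (μ / 2) (t - s)) *
            (A * (Real.exp (-(μ / 2 * s)) * ‖f - g‖)) := by gcongr
        _ = (Real.exp (-(μ / 2 * (t - s))) * Real.exp (-(μ / 2 * s))) * (C * A * ‖f - g‖) *
            sing θ (μ / 2) (t - s) := by ring
        _ = _ := by rw [← Real.exp_add]; ring_nf
    · have := integral_sing_le hθ (show 0 < μ / 2 by positivity) ht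
      calc _ ≤ Real.exp (-(μ / 2 * t)) * (C * A * ‖f - g‖) * singMass θ (μ / 2) := by gcongr
        _ = _ := by rw [hK]; ring
  have hz : ∀ t, 0 ≤ t → ∫ s in (0 : ℝ)..t, N (t - s) (w 0 s) = 0 := by
    intro t ht
    rw [intervalIntegral.integral_of_le ht, integral_Ioc_eq_integral_Ioo]
    refine (setIntegral_congr_fun measurableSet_Ioo fun s hs => ?_).trans (integral_zero ℝ E)
    have : w 0 s = 0 := by simp [hw]
    rw [this, hN.map_zero _ (by linarith [hs.2])]
  have hbound : ∀ f t, 0 ≤ t → ‖Real.exp (μ / 2 * t) •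
      (S t - ∫ s in (0 : ℝ)..t, N (t - s) (w f s))‖ ≤
        r + K * ((1 + ‖f‖) * ‖f‖) * ‖f‖ := by
    intro f t ht
    have h1 := hdiff f 0 t ht
    rw [hz t ht, sub_zero] at h1
    simp only [norm_zero, add_zero, sub_zero] at h1
    rw [norm_smul, Real.norm_of_nonneg (Real.exp_pos _).le]
    have h2 : ‖S t‖ ≤ Real.exp (-(μ / 2 * t)) * r := by
      refine (hSr t ht).trans ?_
      gcongr
      linarith
    calc _ ≤ Real.exp (μ / 2 * t) * (Real.exp (-(μ / 2 * t)) * r +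
          Real.exp (-(μ / 2 * t)) * (K * ((1 + ‖f‖) * ‖f‖) * ‖f‖)) := by
          gcongr
          exact (norm_sub_le _ _).trans (add_le_add h2 h1)
      _ = (Real.exp (μ / 2 * t) * Real.exp (-(μ / 2 * t))) *
          (r + K * ((1 + ‖f‖) * ‖f‖) * ‖f‖) := by ring
      _ = _ := by rw [← Real.exp_add]; simp
  have hΦ : ∀ f : ℝ →ᵇ E, ∃ g : ℝ →ᵇ E, ∀ t, g t = Real.exp (μ / 2 * max t 0) •
      (S (max t 0) - ∫ s in (0 : ℝ)..max t 0, N (max t 0 - s) (w f s)) := by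
    intro f
    have hc : ContinuousOn (fun t => Real.exp (μ / 2 * t) •
        (S t - ∫ s in (0 : ℝ)..t, N (t - s) (w f s))) (Ici 0) := by
      refine ContinuousOn.smul (by fun_prop) (hS.sub ?_)
      exact hN.continuousOn_integral (hwc f) (hwn' f)
    have hm : Continuous fun t : ℝ => max t 0 := by fun_prop
    exact ⟨ofNormedAddCommGroup _ (hc.comp_continuous hm fun t => mem_Ici.2 (le_max_right _ _)) _
      fun t => hbound f _ (le_max_right t 0), fun t => rfl⟩
  choose Φ hΦ using hΦ
  have hmaps : MapsTo Φ (Metric.closedBall 0 (2 * r)) (Metric.closedBall 0 (2 * r)) := by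
    intro f hf
    rw [mem_closedBall_zero_iff] at hf ⊢
    refine (BoundedContinuousFunction.norm_le (by positivity)).2 fun t => ?_
    rw [hΦ]
    refine (hbound f _ (le_max_right t 0)).trans ?_
    have : K * ((1 + ‖f‖) * ‖f‖) * ‖f‖ ≤ 1 / 2 * (2 * r) := by
      refine mul_le_mul ?_ hf (norm_nonneg _) (by norm_num)
      refine le_trans ?_ hsmall
      gcongr <;> linarith
    linarith
  have hcontr : ContractingWith (1 / 2) (hmaps.restrict Φ _ _) := by
    refine ⟨by exact one_half_lt_one, LipschitzWith.of_dist_le_mul fun f g => ?_⟩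
    have hf := mem_closedBall_zero_iff.1 f.2
    have hg := mem_closedBall_zero_iff.1 g.2
    rw [Subtype.dist_eq, Subtype.dist_eq, dist_eq_norm, dist_eq_norm]
    refine (BoundedContinuousFunction.norm_le (by positivity)).2 fun t => ?_
    have ht : 0 ≤ max t 0 := le_max_right _ _
    have e : ((hmaps.restrict Φ _ _ f : ℝ →ᵇ E) - (hmaps.restrict Φ _ _ g : ℝ →ᵇ E)) t =
        -(Real.exp (μ / 2 * max t 0) •
        ((∫ s in (0 : ℝ)..max t 0, N (max t 0 - s) (w f.1 s)) -
          ∫ s in (0 : ℝ)..max t 0, N (max t 0 - s) (w g.1 s))) := by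
      change Φ f.1 t - Φ g.1 t = _
      rw [hΦ, hΦ, ← smul_sub, sub_sub_sub_cancel_left, ← smul_neg, neg_sub]
    rw [e, norm_neg, norm_smul, Real.norm_of_nonneg (Real.exp_pos _).le]
    calc _ ≤ Real.exp (μ / 2 * max t 0) * (Real.exp (-(μ / 2 * max t 0)) *
          (K * ((1 + ‖f.1‖ + ‖g.1‖) * (‖f.1‖ + ‖g.1‖)) * ‖f.1 - g.1‖)) := by
          gcongr
          exact hdiff _ _ _ ht
      _ = K * ((1 + ‖f.1‖ + ‖g.1‖) * (‖f.1‖ + ‖g.1‖)) * ‖f.1 - g.1‖ := by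
          rw [← mul_assoc, ← Real.exp_add]; simp
      _ ≤ _ := by
          gcongr
          -- Both functions have norm at most 2r, so the sum of the norms is at most 4r; this is the
          -- origin of 4r in `hsmall`.
          refine le_trans (mul_le_mul_of_nonneg_left ?_ hK0) (hsmall.trans (by simp))
          exact mul_le_mul (by linarith) (by linarith) (by positivity) (by positivity)
  obtain ⟨f, hf, hfix, -⟩ := hcontr.exists_fixedPoint'
    (Metric.isClosed_closedBall.isComplete) hmaps
    (x := 0) (by simpa using hr) (edist_ne_top _ _)
  rw [mem_closedBall_zero_iff] at hf
  have hwf : ∀ t, 0 ≤ t → w f t = S t - ∫ s in (0 : ℝ)..t, N (t - s) (w f s) := by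
    intro t ht
    have h1 : f t = Real.exp (μ / 2 * t) • (S t - ∫ s in (0 : ℝ)..t, N (t - s) (w f s)) := by
      have := hΦ f t
      rw [max_eq_left ht, hfix] at this
      exact this
    have h2 : w f t = Real.exp (-(μ / 2 * t)) • f t := by simp only [hw, max_eq_left ht]
    rw [h2, h1, smul_smul, ← Real.exp_add]
    simp
  refine ⟨w f, (hwc f).continuousOn, fun t ht => ?_, hwf⟩
  have := hwn f t
  rw [max_eq_left ht] at this
  exact this.trans (by gcongr)

end IsSingularNonlinearity

end Duhamel
end ActiveFluid

/-! ### The analytic semigroup of a coercive fourth-order symbol -/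

namespace ActiveFluid

namespace Duhamel

open Filter Topology

/-- Clamping s to [a, t₀+1] turns the local bounds into a uniform one and does not change the
integral for t near t₀. -/
theorem continuousOn_conv_of_local {E : Type*} [NormedAddCommGroup E] [NormedSpace ℝ E]
    [CompleteSpace E] {G : ℝ → ℝ → E} {θ k a : ℝ}
    (hG : ContinuousOn (Function.uncurry G) (Ioi 0 ×ˢ Ici a)) (hθ : θ < 1) (hk : 0 ≤ k)
    (hC : ∀ T, ∃ C, 0 ≤ C ∧ ∀ τ, 0 < τ → ∀ s ∈ Icc a T, ‖G τ s‖ ≤ C * sing θ k τ) :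
    ContinuousOn (fun t => ∫ s in a..t, G (t - s) s) (Ici a) := by
  intro t₀ ht₀
  obtain ⟨C, hC0, hC⟩ := hC (t₀ + 1)
  have haT : a ≤ t₀ + 1 := by linarith [mem_Ici.1 ht₀]
  set c : ℝ → ℝ := fun s => max a (min s (t₀ + 1)) with hc
  have hcm : ∀ s, c s ∈ Icc a (t₀ + 1) := fun s =>
    ⟨le_max_left _ _, max_le haT (min_le_right _ _)⟩
  have hcc : Continuous c := by fun_prop
  have h1 : ContinuousOn (fun t => ∫ s in a..t, G (t - s) (c s)) (Ici a) := by
    refine continuousOn_conv (G := fun τ s => G τ (c s)) ?_ hθ hk hC0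
      (fun τ hτ s => hC τ hτ _ (hcm s)) a
    exact hG.comp (f := fun p : ℝ × ℝ => (p.1, c p.2)) (by fun_prop) fun p hp =>
      ⟨hp.1, (hcm p.2).1⟩
  refine (h1 t₀ ht₀).congr_of_eventuallyEq ?_ ?_
  · filter_upwards [self_mem_nhdsWithin, mem_nhdsWithin_of_mem_nhds
      (Iio_mem_nhds (show t₀ < t₀ + 1 by linarith))] with t ht ht'
    refine intervalIntegral.integral_congr fun s hs => ?_
    rw [uIcc_of_le ht] at hs
    have : c s = s := by
      rw [hc]; simp [hs.1, hs.2.trans (le_of_lt ht')]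
    simp only [this]
  · refine intervalIntegral.integral_congr fun s hs => ?_
    rw [uIcc_of_le ht₀] at hs
    have : c s = s := by
      rw [hc]; simp [hs.1, hs.2.trans (show t₀ ≤ t₀ + 1 by linarith)]
    simp only [this]

end Duhamel

namespace FM

open BoundedContinuousFunction Filter Topology Duhamel

variable {n : ℕ}

/-- Split off the fixed argument g: there the convergence is strong, while the remainder is
controlled by the uniform bound on the symbols times ‖f_i - g‖. -/
theorem tendsto_sm_apply {ι : Type*} {l : Filter ι} [l.IsCountablyGenerated] {p : ι → Rn n →ᵇ ℂ}
    {q : Rn n →ᵇ ℂ} {C : ℝ} (hC : ∀ᶠ i in l, ∀ ξ, ‖p i ξ‖ ≤ C)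
    (h : ∀ ξ, Tendsto (fun i => p i ξ) l (𝓝 (q ξ))) {f : ι → FM n} {g : FM n}
    (hf : Tendsto f l (𝓝 g)) : Tendsto (fun i => sm (p i) (f i)) l (𝓝 (sm q g)) := by
  have h1 : Tendsto (fun i => sm (p i) (f i - g)) l (𝓝 0) := by
    refine squeeze_zero_norm' (a := fun i => max C 0 * ‖f i - g‖) ?_ ?_
    · filter_upwards [hC] with i hi
      refine (norm_sm_apply_le _ _).trans ?_
      gcongr
      exact (norm_le (le_max_right _ _)).2 fun ξ => (hi ξ).trans (le_max_left _ _)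
    · have := (tendsto_iff_norm_sub_tendsto_zero.1 hf).const_mul (max C 0)
      simpa using this
  have h2 := h1.add (tendsto_sm hC h g)
  rw [zero_add] at h2
  refine h2.congr fun i => ?_
  rw [map_sub, sub_add_cancel]

/-- The symbol `a` is even, continuous, and comparable to `(1 + |ξ|²)²`. -/
structure IsCoerciveSymbol (a : Rn n → ℝ) (d D : ℝ) : Prop where
  continuous : Continuous a
  even : ∀ ξ, a (-ξ) = a ξ
  pos : 0 < d
  le : ∀ ξ, d * (1 + ‖ξ‖ ^ 2) ^ 2 ≤ a ξ
  ge : ∀ ξ, a ξ ≤ D * (1 + ‖ξ‖ ^ 2) ^ 2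

open Classical in
/-- The bounded continuous symbol `p e^(-τa)` (and `0` if this is not bounded and continuous). -/
def heat (a : Rn n → ℝ) (p : Rn n → ℂ) (τ : ℝ) : Rn n →ᵇ ℂ :=
  if h : Continuous (fun ξ => p ξ * (Real.exp (-τ * a ξ) : ℂ)) ∧
      ∃ C, ∀ ξ, ‖p ξ * (Real.exp (-τ * a ξ) : ℂ)‖ ≤ C then
    ofNormedAddCommGroup _ h.1 h.2.choose h.2.choose_spec else 0

theorem heat_apply_of_bound {a : Rn n → ℝ} {p : Rn n → ℂ} {τ C : ℝ} (ha : Continuous a)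
    (hp : Continuous p) (hC : ∀ ξ, ‖p ξ * (Real.exp (-τ * a ξ) : ℂ)‖ ≤ C) (ξ : Rn n) :
    heat a p τ ξ = p ξ * (Real.exp (-τ * a ξ) : ℂ) := by
  have h : Continuous (fun ξ => p ξ * (Real.exp (-τ * a ξ) : ℂ)) ∧
      ∃ C, ∀ ξ, ‖p ξ * (Real.exp (-τ * a ξ) : ℂ)‖ ≤ C := ⟨by fun_prop, C, hC⟩
  rw [heat, dif_pos h]
  rfl

attribute [irreducible] heat

/-- The continuous symbol `p` has order at most `4θ`. -/
structure IsOrder (p : Rn n → ℂ) (θ : ℝ) : Prop where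
  continuous : Continuous p
  le : ∀ ξ, ‖p ξ‖ ≤ (1 + ‖ξ‖ ^ 2) ^ (2 * θ)

theorem one_le_one_add_sq (ξ : Rn n) : 1 ≤ 1 + ‖ξ‖ ^ 2 := by
  have := sq_nonneg ‖ξ‖
  linarith

theorem IsOrder.mono {p : Rn n → ℂ} {θ θ' : ℝ} (hp : IsOrder p θ) (h : θ ≤ θ') : IsOrder p θ' :=
  ⟨hp.continuous, fun ξ => (hp.le ξ).trans
    (Real.rpow_le_rpow_of_exponent_le (one_le_one_add_sq ξ) (by linarith))⟩

theorem IsOrder.mul {p q : Rn n → ℂ} {θ θ' : ℝ} (hp : IsOrder p θ) (hq : IsOrder q θ') :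
    IsOrder (fun ξ => p ξ * q ξ) (θ + θ') := by
  refine ⟨hp.continuous.mul hq.continuous, fun ξ => ?_⟩
  rw [norm_mul, mul_add, Real.rpow_add (one_add_sq_pos ξ)]
  exact mul_le_mul (hp.le ξ) (hq.le ξ) (norm_nonneg _) (by positivity)

theorem isOrder_one : IsOrder (fun _ : Rn n => (1 : ℂ)) 0 := ⟨by fun_prop, fun ξ => by simp⟩

/-- The symbol `i ξ_j` of `∂_j`. -/
def derivSym (j : Fin n) (ξ : Rn n) : ℂ := Complex.I * (ξ j : ℂ)

theorem norm_derivSym_le (j : Fin n) (ξ : Rn n) : ‖derivSym j ξ‖ ≤ ‖ξ‖ := by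
  rw [derivSym, norm_mul, Complex.norm_I, one_mul, Complex.norm_real]
  exact PiLp.norm_apply_le ξ j

theorem continuous_derivSym (j : Fin n) : Continuous (derivSym j) := by
  unfold derivSym; fun_prop

theorem isOrder_derivSym (j : Fin n) : IsOrder (derivSym j) (1 / 4) := by
  refine ⟨continuous_derivSym j, fun ξ => (norm_derivSym_le j ξ).trans ?_⟩
  rw [show (2 * (1 / 4) : ℝ) = 1 / 2 by norm_num, ← Real.sqrt_eq_rpow]
  exact Real.le_sqrt_of_sq_le (by linarith)

/-- The symbol `1 + |ξ|²` of `1 - Δ`. -/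
def rho (ξ : Rn n) : ℂ := 1 + (‖ξ‖ : ℂ) ^ 2

theorem norm_rho (ξ : Rn n) : ‖rho ξ‖ = 1 + ‖ξ‖ ^ 2 := by
  have : rho ξ = ((1 + ‖ξ‖ ^ 2 : ℝ) : ℂ) := by simp [rho]
  rw [this, Complex.norm_real, Real.norm_of_nonneg (one_add_sq_pos ξ).le]

theorem isOrder_rho : IsOrder (rho : Rn n → ℂ) (1 / 2) := by
  refine ⟨by unfold rho; fun_prop, fun ξ => ?_⟩
  rw [norm_rho]; simp

theorem rho_mul_res (ξ : Rn n) : rho ξ * res n ξ = 1 := mul_inv_cancel₀ (one_add_sq_ne ξ)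

namespace IsCoerciveSymbol

variable {a : Rn n → ℝ} {d D : ℝ} (ha : IsCoerciveSymbol a d D)
include ha

theorem le_self (ξ : Rn n) : d ≤ a ξ := by
  refine le_trans ?_ (ha.le ξ)
  exact le_mul_of_one_le_right ha.pos.le (one_le_pow₀ (one_le_one_add_sq ξ))

theorem nonneg (ξ : Rn n) : 0 ≤ a ξ := ha.pos.le.trans (ha.le_self ξ)

/-- With ρ = 1+|ξ|² and x = τdρ², the symbol is at most ρ^(2θ) e^(-x) = (τd)^(-θ) x^θ e^(-x). Half
of e^(-x) absorbs x^θ ≤ 2e^(x/2); the other half gives e^(-dτ/2) because ρ ≥ 1. -/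
theorem norm_mul_exp_le {p : Rn n → ℂ} {θ τ : ℝ} (hp : IsOrder p θ) (hθ0 : 0 ≤ θ) (hθ : θ ≤ 1)
    (hτ : 0 < τ) (ξ : Rn n) :
    ‖p ξ * (Real.exp (-τ * a ξ) : ℂ)‖ ≤ 2 * d ^ (-θ) * sing θ (d / 2) τ := by
  have hd := ha.pos
  have hρ := one_le_one_add_sq ξ
  have hρ0 := one_add_sq_pos ξ
  set ρ := 1 + ‖ξ‖ ^ 2
  set x := τ * d * ρ ^ 2 with hx
  have hx0 : 0 < x := by positivity
  have h1 : Real.exp (-τ * a ξ) ≤ Real.exp (-x) := by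
    refine Real.exp_le_exp.2 ?_
    have := mul_le_mul_of_nonneg_left (ha.le ξ) hτ.le
    rw [hx]; linarith
  have h2 : ρ ^ (2 * θ) = x ^ θ * ((τ * d) ^ (-θ)) := by
    rw [hx, Real.mul_rpow (by positivity) (by positivity), mul_right_comm,
      ← Real.rpow_add (by positivity), ← Real.rpow_natCast, ← Real.rpow_mul hρ0.le]
    simp
  have h3 : x ^ θ ≤ 2 * Real.exp (x / 2) := by
    have h4 : x ^ θ ≤ 1 + x := by
      rcases le_total x 1 with h | h
      · exact (Real.rpow_le_one hx0.le h hθ0).trans (by linarith)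
      · calc x ^ θ ≤ x ^ (1 : ℝ) := Real.rpow_le_rpow_of_exponent_le h hθ
          _ ≤ _ := by rw [Real.rpow_one]; linarith
    have := Real.add_one_le_exp (x / 2)
    linarith
  have h5 : Real.exp (-(x / 2)) ≤ Real.exp (-(d / 2 * τ)) := by
    refine Real.exp_le_exp.2 ?_
    have : 1 ≤ ρ ^ 2 := by nlinarith
    have : τ * d * 1 ≤ x := by rw [hx]; gcongr
    linarith
  rw [norm_mul, Complex.norm_real, Real.norm_of_nonneg (Real.exp_pos _).le]
  calc ‖p ξ‖ * Real.exp (-τ * a ξ) ≤ ρ ^ (2 * θ) * Real.exp (-x) := by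
        gcongr
        exact hp.le ξ
    _ ≤ 2 * Real.exp (x / 2) * ((τ * d) ^ (-θ)) * Real.exp (-x) := by rw [h2]; gcongr
    _ = 2 * (τ * d) ^ (-θ) * Real.exp (-(x / 2)) := by
        rw [show -(x / 2) = x / 2 + -x by ring, Real.exp_add]; ring
    _ ≤ 2 * (τ * d) ^ (-θ) * Real.exp (-(d / 2 * τ)) := by gcongr
    _ = _ := by rw [Real.mul_rpow hτ.le hd.le, sing]; ring

theorem heat_apply {p : Rn n → ℂ} {θ τ : ℝ} (hp : IsOrder p θ) (hθ0 : 0 ≤ θ) (hθ : θ ≤ 1)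
    (hτ : 0 < τ) (ξ : Rn n) : heat a p τ ξ = p ξ * (Real.exp (-τ * a ξ) : ℂ) :=
  heat_apply_of_bound ha.continuous hp.continuous (ha.norm_mul_exp_le hp hθ0 hθ hτ) ξ

theorem norm_heat_le {p : Rn n → ℂ} {θ τ : ℝ} (hp : IsOrder p θ) (hθ0 : 0 ≤ θ) (hθ : θ ≤ 1)
    (hτ : 0 < τ) : ‖heat a p τ‖ ≤ 2 * d ^ (-θ) * sing θ (d / 2) τ := by
  refine (norm_le ?_).2 fun ξ => ?_
  · have := sing_nonneg (θ := θ) (k := d / 2) hτ.le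
    have := ha.pos
    positivity
  · rw [ha.heat_apply hp hθ0 hθ hτ]
    exact ha.norm_mul_exp_le hp hθ0 hθ hτ ξ

theorem norm_exp_le {τ : ℝ} (hτ : 0 ≤ τ) (ξ : Rn n) :
    ‖(1 : ℂ) * (Real.exp (-τ * a ξ) : ℂ)‖ ≤ Real.exp (-(d * τ)) := by
  rw [one_mul, Complex.norm_real, Real.norm_of_nonneg (Real.exp_pos _).le]
  refine Real.exp_le_exp.2 ?_
  have := mul_le_mul_of_nonneg_left (ha.le_self ξ) hτ
  linarith

theorem heat_one_apply {τ : ℝ} (hτ : 0 ≤ τ) (ξ : Rn n) :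
    heat a (fun _ => 1) τ ξ = (Real.exp (-τ * a ξ) : ℂ) := by
  rw [heat_apply_of_bound ha.continuous continuous_const (ha.norm_exp_le hτ), one_mul]

theorem norm_heat_one_le {τ : ℝ} (hτ : 0 ≤ τ) :
    ‖heat a (fun _ => 1) τ‖ ≤ Real.exp (-(d * τ)) := by
  refine (norm_le (Real.exp_pos _).le).2 fun ξ => ?_
  rw [ha.heat_one_apply hτ, ← one_mul (Complex.ofReal _)]
  exact ha.norm_exp_le hτ ξ

theorem norm_heat_one_le_one {τ : ℝ} (hτ : 0 ≤ τ) : ‖heat a (fun _ => 1) τ‖ ≤ 1 := by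
  refine (ha.norm_heat_one_le hτ).trans (Real.exp_le_one_iff.2 ?_)
  have := mul_nonneg ha.pos.le hτ
  linarith

/-- Joint continuity of `(τ, f) ↦ p(D) e^(-τA) f` for `τ > 0`. -/
theorem continuousOn_heat {p : Rn n → ℂ} {θ : ℝ} (hp : IsOrder p θ) (hθ0 : 0 ≤ θ) (hθ : θ ≤ 1) :
    ContinuousOn (fun z : ℝ × FM n => sm (heat a p z.1) z.2) (Ioi 0 ×ˢ univ) := by
  rintro ⟨τ, f⟩ ⟨hτ, -⟩
  have hτ : 0 < τ := hτ
  -- Staying above τ/2 keeps away from the singularity at 0 and gives the uniform bound on the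
  -- symbols.
  have hnear : ∀ᶠ z : ℝ × FM n in 𝓝 (τ, f), τ / 2 < z.1 :=
    continuous_fst.continuousAt.eventually (Ioi_mem_nhds (show τ / 2 < τ by linarith))
  refine ContinuousAt.continuousWithinAt (tendsto_sm_apply (p := fun z : ℝ × FM n => heat a p z.1)
    (C := 2 * d ^ (-θ) * (τ / 2) ^ (-θ)) ?_ ?_ continuous_snd.continuousAt)
  · filter_upwards [hnear] with z hz ξ
    have hz0 : 0 < z.1 := by linarith
    refine ((heat a p z.1).norm_coe_le_norm ξ).trans ((ha.norm_heat_le hp hθ0 hθ hz0).trans ?_)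
    have := ha.pos
    have h1 : z.1 ^ (-θ) ≤ (τ / 2) ^ (-θ) :=
      Real.rpow_le_rpow_of_nonpos (by linarith) hz.le (by linarith)
    have h2 := sing_le (θ := θ) (k := d / 2) (by positivity) hz0.le
    gcongr
    exact h2.trans h1
  · intro ξ
    rw [ha.heat_apply hp hθ0 hθ hτ]
    have hc : Tendsto (fun z : ℝ × FM n => p ξ * (Real.exp (-z.1 * a ξ) : ℂ)) (𝓝 (τ, f))
        (𝓝 (p ξ * (Real.exp (-τ * a ξ) : ℂ))) := by
      refine Continuous.tendsto' ?_ _ _ rfl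
      fun_prop
    refine hc.congr' ?_
    filter_upwards [hnear] with z hz
    rw [ha.heat_apply hp hθ0 hθ (by linarith)]

/-- Joint continuity of `(τ, f) ↦ e^(-τA) f` for `τ ≥ 0`. -/
theorem continuousOn_heat_one :
    ContinuousOn (fun z : ℝ × FM n => sm (heat a (fun _ => 1) z.1) z.2) (Ici 0 ×ˢ univ) := by
  rintro ⟨τ, f⟩ ⟨hτ, -⟩
  have hev : ∀ᶠ z : ℝ × FM n in 𝓝[Ici 0 ×ˢ univ] (τ, f), 0 ≤ z.1 := by
    filter_upwards [self_mem_nhdsWithin] with z hz using hz.1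
  refine tendsto_sm_apply (p := fun z : ℝ × FM n => heat a (fun _ => 1) z.1) (C := 1) ?_ ?_
    continuous_snd.continuousAt.continuousWithinAt
  · filter_upwards [hev] with z hz ξ
    exact (BoundedContinuousFunction.norm_coe_le_norm _ ξ).trans (ha.norm_heat_one_le_one hz)
  · intro ξ
    rw [ha.heat_one_apply hτ]
    have hc : Tendsto (fun z : ℝ × FM n => (Real.exp (-z.1 * a ξ) : ℂ)) (𝓝[Ici 0 ×ˢ univ] (τ, f))
        (𝓝 (Real.exp (-τ * a ξ) : ℂ)) := by
      refine (Continuous.tendsto' ?_ _ _ rfl).mono_left nhdsWithin_le_nhds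
      fun_prop
    refine hc.congr' ?_
    filter_upwards [hev] with z hz
    rw [ha.heat_one_apply hz]

theorem heat_mul {p : Rn n → ℂ} {θ : ℝ} (hp : IsOrder p θ) (hθ0 : 0 ≤ θ) (hθ : θ ≤ 1)
    {σ τ : ℝ} (hσ : 0 ≤ σ) (hτ : 0 < τ) :
    heat a (fun _ => 1) σ * heat a p τ = heat a p (σ + τ) := by
  ext1 ξ
  rw [BoundedContinuousFunction.mul_apply, ha.heat_one_apply hσ, ha.heat_apply hp hθ0 hθ hτ,
    ha.heat_apply hp hθ0 hθ (by linarith)]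
  push_cast
  rw [show -((σ : ℂ) + τ) * a ξ = -σ * a ξ + -τ * a ξ by ring, Complex.exp_add]
  ring

theorem heat_one_mul {σ τ : ℝ} (hσ : 0 ≤ σ) (hτ : 0 ≤ τ) :
    heat a (fun _ => 1) σ * heat a (fun _ => 1) τ = heat a (fun _ => 1) (σ + τ) := by
  ext1 ξ
  rw [BoundedContinuousFunction.mul_apply, ha.heat_one_apply hσ, ha.heat_one_apply hτ,
    ha.heat_one_apply (by linarith)]
  push_cast
  rw [show -((σ : ℂ) + τ) * a ξ = -σ * a ξ + -τ * a ξ by ring, Complex.exp_add]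

theorem heat_zero : heat a (fun _ => 1) 0 = 1 := by
  ext1 ξ
  rw [ha.heat_one_apply le_rfl]
  simp

end IsCoerciveSymbol

/-! ### The Duhamel integrand -/

/-- `q(D) e^(-τA) P (F + ∑ⱼ ∂ⱼ fⱼ)`. -/
def forcing (a : Rn n → ℝ) (q : Rn n → ℂ) (τ : ℝ) (F : FM n) (f : Fin n → FM n) : FM n :=
  sm (heat a q τ) (helm F) + ∑ j, sm (heat a (fun ξ => q ξ * derivSym j ξ) τ) (helm (f j))

theorem helm_forcing (a : Rn n → ℝ) (q : Rn n → ℂ) (τ : ℝ) (F : FM n) (f : Fin n → FM n) :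
    helm (forcing a q τ F f) = forcing a q τ F f := by
  simp only [forcing, map_add, map_sum, ← sm_helm, helm_helm]

theorem forcing_sub (a : Rn n → ℝ) (q : Rn n → ℂ) (τ : ℝ) (F G : FM n) (f g : Fin n → FM n) :
    forcing a q τ F f - forcing a q τ G g = forcing a q τ (F - G) (fun j => f j - g j) := by
  simp only [forcing, map_sub, Finset.sum_sub_distrib]
  abel

namespace IsCoerciveSymbol

variable {a : Rn n → ℝ} {d D : ℝ} (ha : IsCoerciveSymbol a d D)
include ha

/-- The constant 4 is the product of the bounds 2 for P and 2 for the heat symbol, and ∂_j adds 1/4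
to the order. The term F is estimated at the same order θ + 1/4, so that a single kernel covers the
whole sum. -/
theorem norm_forcing_le {q : Rn n → ℂ} {θ : ℝ} (hq : IsOrder q θ) (hθ0 : 0 ≤ θ)
    (hθ : θ + 1 / 4 ≤ 1) {τ : ℝ} (hτ : 0 < τ) (F : FM n) (f : Fin n → FM n) :
    ‖forcing a q τ F f‖ ≤
      4 * d ^ (-(θ + 1 / 4)) * (‖F‖ + ∑ j, ‖f j‖) * sing (θ + 1 / 4) (d / 2) τ := by
  have hK : ∀ {p : Rn n → ℂ}, IsOrder p (θ + 1 / 4) → ∀ w : FM n, ‖sm (heat a p τ) (helm w)‖ ≤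
      4 * d ^ (-(θ + 1 / 4)) * sing (θ + 1 / 4) (d / 2) τ * ‖w‖ := by
    intro p hp w
    refine (norm_sm_apply_le _ _).trans ?_
    have h1 := ha.norm_heat_le hp (by linarith) hθ hτ
    have h2 := norm_helm_le w
    calc _ ≤ (2 * d ^ (-(θ + 1 / 4)) * sing (θ + 1 / 4) (d / 2) τ) * (2 * ‖w‖) :=
          mul_le_mul h1 h2 (norm_nonneg _) ((norm_nonneg _).trans h1)
      _ = _ := by ring
  refine (norm_add_le _ _).trans ((add_le_add (hK (hq.mono (by linarith)) F)
    (norm_sum_le_of_le _ fun j _ => hK (hq.mul (isOrder_derivSym j)) (f j))).trans (le_of_eq ?_))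
  rw [← Finset.mul_sum]
  ring

theorem continuousOn_forcing {q : Rn n → ℂ} {θ : ℝ} (hq : IsOrder q θ) (hθ0 : 0 ≤ θ)
    (hθ : θ + 1 / 4 ≤ 1) {T : Type*} [TopologicalSpace T] {s : Set T} {σ : T → ℝ} {F : T → FM n}
    {f : T → Fin n → FM n} (hσ : ContinuousOn σ s) (hσ0 : ∀ t ∈ s, 0 < σ t)
    (hF : ContinuousOn F s) (hf : ∀ j, ContinuousOn (fun t => f t j) s) :
    ContinuousOn (fun t => forcing a q (σ t) (F t) (f t)) s := by
  have hK : ∀ {p : Rn n → ℂ}, IsOrder p (θ + 1 / 4) → ∀ {w : T → FM n}, ContinuousOn w s →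
      ContinuousOn (fun t => sm (heat a p (σ t)) (helm (w t))) s := by
    intro p hp w hw
    have h1 : ContinuousOn (fun t => helm (w t)) s := helm.continuous.comp_continuousOn hw
    have h2 : ContinuousOn (fun t => (σ t, helm (w t))) s := hσ.prodMk h1
    exact (ha.continuousOn_heat hp (by linarith) hθ).comp h2 fun t ht => ⟨hσ0 t ht, trivial⟩
  unfold forcing
  exact (hK (hq.mono (by linarith)) hF).add
    (continuousOn_finsetSum _ fun j _ => hK (hq.mul (isOrder_derivSym j)) (hf j))

end IsCoerciveSymbol

end FM
end ActiveFluid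

/-! ### Coercivity, Lipschitz bounds and the Duhamel formula -/

namespace ActiveFluid
namespace FM

open BoundedContinuousFunction Filter Topology Duhamel

variable {n : ℕ}

/-! ### The symbol of the active fluid operator -/

theorem exists_coercive {Γ₀ Γ₂ α : ℝ} (hΓ₂ : 0 < Γ₂)
    (hstable : (Γ₀ < 0 ∧ Γ₀ ^ 2 / Γ₂ < 4 * α) ∨ (0 ≤ Γ₀ ∧ 0 < α)) :
    ∃ d, 0 < d ∧ ∀ r : ℝ, 0 ≤ r → d * (1 + r ^ 2) ≤ Γ₂ * r ^ 2 + Γ₀ * r + α := by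
  rcases hstable with ⟨-, h⟩ | ⟨h0, hα⟩
  · rw [div_lt_iff₀ hΓ₂] at h
    have hα : 0 < α := by nlinarith [sq_nonneg Γ₀]
    -- With this d, 4(Γ₂-d)(α-d) = Γ₀² + 4d² ≥ Γ₀², so the quadratic left after subtracting d(1+r²)
    -- has nonpositive discriminant.
    set d := (4 * α * Γ₂ - Γ₀ ^ 2) / (4 * (α + Γ₂)) with hd
    have hd0 : 0 < d := div_pos (by linarith) (by positivity)
    have e : d * (4 * (α + Γ₂)) = 4 * α * Γ₂ - Γ₀ ^ 2 := div_mul_cancel₀ _ (by positivity)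
    have hdΓ : d < Γ₂ := by
      rw [hd, div_lt_iff₀ (by positivity)]
      nlinarith [sq_nonneg Γ₀]
    refine ⟨d, hd0, fun r _ => ?_⟩
    have h1 : 0 ≤ 4 * (Γ₂ - d) * ((Γ₂ - d) * r ^ 2 + Γ₀ * r + (α - d)) := by
      nlinarith [sq_nonneg (2 * (Γ₂ - d) * r + Γ₀), sq_nonneg d]
    have h2 : 0 ≤ (Γ₂ - d) * r ^ 2 + Γ₀ * r + (α - d) := by
      by_contra hneg
      have := mul_neg_of_pos_of_neg (show 0 < 4 * (Γ₂ - d) by linarith) (not_le.1 hneg)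
      linarith
    linarith
  · refine ⟨min Γ₂ α, lt_min hΓ₂ hα, fun r hr => ?_⟩
    have h1 := min_le_left Γ₂ α
    have h2 := min_le_right Γ₂ α
    nlinarith [mul_nonneg h0 hr, sq_nonneg r, mul_le_mul_of_nonneg_right h1 (sq_nonneg r)]

theorem isCoerciveSymbol_symbolAd (n : ℕ) {Γ₀ Γ₂ α : ℝ} (hΓ₂ : 0 < Γ₂)
    (hstable : (Γ₀ < 0 ∧ Γ₀ ^ 2 / Γ₂ < 4 * α) ∨ (0 ≤ Γ₀ ∧ 0 < α)) :
    ∃ d D, IsCoerciveSymbol (symbolAd Γ₀ Γ₂ α : Rn n → ℝ) d D := by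
  obtain ⟨d, hd, h⟩ := exists_coercive hΓ₂ hstable
  -- The factor 1/2 comes from (1+r)² ≤ 2(1+r²), applied with r = |ξ|².
  refine ⟨d / 2, Γ₂ + |Γ₀| + |α|, ?_, fun ξ => by simp [symbolAd], by positivity, fun ξ => ?_,
    fun ξ => ?_⟩
  · unfold symbolAd; fun_prop
  · have := h (‖ξ‖ ^ 2) (by positivity)
    rw [symbolAd]
    nlinarith [mul_nonneg hd.le (sq_nonneg (1 - ‖ξ‖ ^ 2))]
  · rw [symbolAd]
    have h0 : 0 ≤ ‖ξ‖ ^ 2 := by positivity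
    have h1 : Γ₀ * ‖ξ‖ ^ 2 ≤ |Γ₀| * (1 + ‖ξ‖ ^ 2) ^ 2 :=
      mul_le_mul (le_abs_self _) (by nlinarith) h0 (abs_nonneg _)
    have h2 : α ≤ |α| * (1 + ‖ξ‖ ^ 2) ^ 2 :=
      (le_abs_self α).trans (le_mul_of_one_le_right (abs_nonneg _)
        (one_le_pow₀ (one_le_one_add_sq ξ)))
    have h3 : Γ₂ * ‖ξ‖ ^ 4 ≤ Γ₂ * (1 + ‖ξ‖ ^ 2) ^ 2 := by
      gcongr
      nlinarith
    linarith

section Nonlinearity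

variable {lam₀ Γ₀ Γ₂ α β d D : ℝ}

theorem semigroup_eq (ha : IsCoerciveSymbol (symbolAd Γ₀ Γ₂ α : Rn n → ℝ) d D) {t : ℝ}
    (ht : 0 ≤ t) {u : FM n} (hu : helm u = u) :
    semigroup Γ₀ Γ₂ α t u = sm (heat (symbolAd Γ₀ Γ₂ α) (fun _ => 1) t) u :=
  op_smul_id (ha.heat_one_apply ht) hu

/-- The cubic part of the nonlinearity. -/
def cubicPart (β : ℝ) (u : FM n) : FM n := (β : ℂ) • cub u

/-- The flux of the convective part of the nonlinearity. -/
def flux (lam₀ : ℝ) (u : FM n) (j : Fin n) : FM n := (lam₀ : ℂ) • B j u u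

theorem semigroupH_eq (ha : IsCoerciveSymbol (symbolAd Γ₀ Γ₂ α : Rn n → ℝ) d D) {τ : ℝ}
    (hτ : 0 < τ) (u : FM n) : semigroupH lam₀ Γ₀ Γ₂ α β τ u =
      forcing (symbolAd Γ₀ Γ₂ α) (fun _ => 1) τ (cubicPart β u) (flux lam₀ u) := by
  have h1 : (FM.ofFun fun x => (‖u x‖ ^ 2 : ℝ) • u x).op
      (fun ξ => (Real.exp (-τ * symbolAd Γ₀ Γ₂ α ξ) : ℂ) • helmholtzSymbol ξ) =
      sm (heat (symbolAd Γ₀ Γ₂ α) (fun _ => 1) τ) (helm (cub u)) := by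
    rw [ofFun_cub]
    exact op_smul_helmholtzSymbol (ha.heat_one_apply hτ.le) _
  have h2 : ∀ j, (FM.ofFun fun x => u x j • u x).op
      (fun ξ => (Complex.I * (ξ j : ℂ) * (Real.exp (-τ * symbolAd Γ₀ Γ₂ α ξ) : ℂ)) •
        helmholtzSymbol ξ) =
      sm (heat (symbolAd Γ₀ Γ₂ α) (fun ξ => 1 * derivSym j ξ) τ) (helm (B j u u)) := by
    intro j
    rw [ofFun_quad]
    refine op_smul_helmholtzSymbol (fun ξ => ?_) _
    rw [ha.heat_apply (isOrder_one.mul (isOrder_derivSym j)) (by norm_num) (by norm_num) hτ,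
      one_mul, derivSym]
  rw [semigroupH, h1]
  simp only [h2, forcing, cubicPart, flux, map_smul, ← Finset.smul_sum]
  rw [Complex.coe_smul, Complex.coe_smul]

theorem continuous_cubicPart : Continuous (cubicPart β : FM n → FM n) :=
  (continuous_cub.const_smul (β : ℂ) : Continuous fun u : FM n => (β : ℂ) • cub u)

theorem continuous_flux (j : Fin n) : Continuous fun u : FM n => flux lam₀ u j :=
  ((continuous_quad j).const_smul (lam₀ : ℂ) : Continuous fun u : FM n => (lam₀ : ℂ) • B j u u)

theorem cubicPart_zero : cubicPart β (0 : FM n) = 0 := by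
  have := norm_cub_sub_le (n := n) 0 0
  have h : cub (0 : FM n) = 0 := by
    rw [cub]; simp
  rw [cubicPart, h, smul_zero]

theorem flux_zero (j : Fin n) : flux lam₀ (0 : FM n) j = 0 := by
  rw [flux, map_zero, smul_zero]

theorem sq_mul_le {p q w : ℝ} (hp : 0 ≤ p) (hq : 0 ≤ q) (hw : 0 ≤ w) :
    (p + q) ^ 2 * w ≤ (1 + p + q) * (p + q) * w :=
  mul_le_mul_of_nonneg_right (by nlinarith) hw

theorem add_mul_le {p q w : ℝ} (hp : 0 ≤ p) (hq : 0 ≤ q) (hw : 0 ≤ w) :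
    (p + q) * w ≤ (1 + p + q) * (p + q) * w :=
  mul_le_mul_of_nonneg_right (by nlinarith) hw

/-- The factor (1+‖u‖+‖v‖)(‖u‖+‖v‖) dominates both the linear Lipschitz factor of the flux and the
quadratic one of the cubic term. -/
theorem norm_nonlinear_sub_le (lam₀ β : ℝ) (u v : FM n) :
    ‖cubicPart β u - cubicPart β v‖ + ∑ j, ‖flux lam₀ u j - flux lam₀ v j‖ ≤
      (|β| * n * fourierConst n ^ 2 + n * (|lam₀| * fourierConst n)) *
        ((1 + ‖u‖ + ‖v‖) * (‖u‖ + ‖v‖) * ‖u - v‖) := by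
  have hc := (fourierConst_pos n).le
  have hu := norm_nonneg u
  have hv := norm_nonneg v
  have hw := norm_nonneg (u - v)
  have e1 := sq_mul_le hu hv hw
  have e2 := add_mul_le hu hv hw
  set s := ‖u‖ + ‖v‖ with hs
  have h1 : ‖cubicPart β u - cubicPart β v‖ ≤
      |β| * n * fourierConst n ^ 2 * ((1 + ‖u‖ + ‖v‖) * s * ‖u - v‖) := by
    rw [cubicPart, cubicPart, ← smul_sub, norm_smul, Complex.norm_real, Real.norm_eq_abs]
    calc |β| * ‖cub u - cub v‖ ≤ |β| * (n * fourierConst n ^ 2 * s ^ 2 * ‖u - v‖) := by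
          gcongr
          exact norm_cub_sub_le u v
      _ = |β| * n * fourierConst n ^ 2 * (s ^ 2 * ‖u - v‖) := by ring
      _ ≤ _ := by gcongr
  have h2 : ∀ j, ‖flux lam₀ u j - flux lam₀ v j‖ ≤
      |lam₀| * fourierConst n * ((1 + ‖u‖ + ‖v‖) * s * ‖u - v‖) := by
    intro j
    rw [flux, flux, ← smul_sub, norm_smul, Complex.norm_real, Real.norm_eq_abs]
    calc |lam₀| * ‖B j u u - B j v v‖ ≤ |lam₀| * (fourierConst n * s * ‖u - v‖) := by
          gcongr
          exact norm_quad_sub_le j u v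
      _ = |lam₀| * fourierConst n * (s * ‖u - v‖) := by ring
      _ ≤ _ := by gcongr
  have h3 : ∑ j, ‖flux lam₀ u j - flux lam₀ v j‖ ≤
      n * (|lam₀| * fourierConst n * ((1 + ‖u‖ + ‖v‖) * s * ‖u - v‖)) := by
    refine (Finset.sum_le_sum fun j _ => h2 j).trans (le_of_eq ?_)
    simp
  calc _ ≤ _ := add_le_add h1 h3
    _ = _ := by ring

/-- The exponent 1/4 is the cost of one derivative against a fourth-order operator. -/
theorem isSingularNonlinearity_semigroupH
    (ha : IsCoerciveSymbol (symbolAd Γ₀ Γ₂ α : Rn n → ℝ) d D) (lam₀ β : ℝ) :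
    ∃ C, IsSingularNonlinearity (fun τ (u : FM n) => semigroupH lam₀ Γ₀ Γ₂ α β τ u)
      (1 / 4) (d / 2) C := by
  have hc := (fourierConst_pos n).le
  have hd := ha.pos
  refine ⟨4 * d ^ (-(1 / 4) : ℝ) * (|β| * n * fourierConst n ^ 2 + n * (|lam₀| * fourierConst n)),
    by norm_num, by positivity, by positivity, ?_, fun τ hτ => ?_, fun τ hτ u v => ?_⟩
  · refine ContinuousOn.congr (f := fun z : ℝ × FM n => forcing (symbolAd Γ₀ Γ₂ α) (fun _ => 1) z.1
      (cubicPart β z.2) (flux lam₀ z.2)) ?_ fun z hz => semigroupH_eq ha hz.1 z.2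
    exact ha.continuousOn_forcing isOrder_one le_rfl (by norm_num) continuousOn_fst
      (fun t ht => ht.1) (continuous_cubicPart.comp continuous_snd).continuousOn
      fun j => ((continuous_flux j).comp continuous_snd).continuousOn
  · rw [semigroupH_eq ha hτ]
    simp [forcing, cubicPart_zero, flux_zero]
  · rw [semigroupH_eq ha hτ, semigroupH_eq ha hτ, forcing_sub]
    refine (ha.norm_forcing_le isOrder_one le_rfl (by norm_num) hτ _ _).trans ?_
    rw [zero_add]
    have h1 := norm_nonlinear_sub_le lam₀ β u v
    have h2 := sing_nonneg (θ := 1 / 4) (k := d / 2) hτ.le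
    calc _ ≤ 4 * d ^ (-(1 / 4) : ℝ) * ((|β| * n * fourierConst n ^ 2 +
          n * (|lam₀| * fourierConst n)) * ((1 + ‖u‖ + ‖v‖) * (‖u‖ + ‖v‖) * ‖u - v‖)) *
          sing (1 / 4) (d / 2) τ := by gcongr
      _ = _ := by ring

end Nonlinearity

/-! ### The variation of constants formula -/

/-- `q(D)` applied to the solution of `u' + A u = -P (F + ∑ⱼ ∂ⱼ fⱼ)`, `u(t₀) = U`. -/
def duhamel (a : Rn n → ℝ) (q : Rn n → ℂ) (t₀ : ℝ) (U : FM n) (F : ℝ → FM n)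
    (f : ℝ → Fin n → FM n) (t : ℝ) : FM n :=
  sm (heat a q (t - t₀)) U - ∫ s in t₀..t, forcing a q (t - s) (F s) (f s)

theorem forcing_sm (a : Rn n → ℝ) (q : Rn n → ℂ) (τ : ℝ) (p : Rn n →ᵇ ℂ) (F : FM n)
    (f : Fin n → FM n) :
    forcing a q τ (sm p F) (fun j => sm p (f j)) = sm p (forcing a q τ F f) := by
  simp only [forcing, map_add, map_sum, ← sm_helm, sm_sm, mul_comm p]

namespace IsCoerciveSymbol

variable {a : Rn n → ℝ} {d D : ℝ} (ha : IsCoerciveSymbol a d D) {q : Rn n → ℂ} {θ t₀ t : ℝ}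
  {U : FM n} {F : ℝ → FM n} {f : ℝ → Fin n → FM n}
include ha

/-- The symbols of 1-Δ and its inverse cancel. The multiplier (1-Δ)p(D)e^(-τA) is bounded for τ > 0,
so membership in the domain of 1-Δ is expressed with bounded operators only. -/
theorem sm_res_heat_rho {p : Rn n → ℂ} {θ τ : ℝ} (hp : IsOrder p θ) (hθ0 : 0 ≤ θ)
    (hθ : 1 / 2 + θ ≤ 1) (hτ : 0 < τ) (u : FM n) :
    sm (res n) (sm (heat a (fun ξ => rho ξ * p ξ) τ) u) = sm (heat a p τ) u := by
  rw [sm_sm]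
  congr 2
  ext1 ξ
  rw [BoundedContinuousFunction.mul_apply, ha.heat_apply (isOrder_rho.mul hp) (by linarith) hθ hτ,
    ha.heat_apply hp hθ0 (by linarith) hτ]
  linear_combination p ξ * (Real.exp (-τ * a ξ) : ℂ) * rho_mul_res ξ

theorem sm_res_forcing {τ : ℝ} (hτ : 0 < τ) (F : FM n) (f : Fin n → FM n) :
    sm (res n) (forcing a rho τ F f) = forcing a (fun _ => 1) τ F f := by
  have h1 := fun u => ha.sm_res_heat_rho isOrder_one le_rfl (by norm_num) hτ u
  have h2 := fun j u => ha.sm_res_heat_rho (isOrder_derivSym j) (by norm_num) (by norm_num) hτ u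
  simp only [mul_one] at h1
  simp only [forcing, map_add, map_sum, h1, h2, one_mul]

theorem intervalIntegrable_forcing (hq : IsOrder q θ) (hθ0 : 0 ≤ θ) (hθ : θ + 1 / 4 < 1)
    (ht : t₀ ≤ t) (hF : ContinuousOn F (Icc t₀ t)) (hf : ∀ j, ContinuousOn (fun s => f s j) (Icc t₀ t)) :
    IntervalIntegrable (fun s => forcing a q (t - s) (F s) (f s)) volume t₀ t := by
  obtain ⟨M, hM⟩ := isCompact_Icc.exists_bound_of_continuousOn
    (f := fun s => ‖F s‖ + ∑ j, ‖f s j‖) (s := Icc t₀ t) (hF.norm.add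
      (continuousOn_finsetSum _ fun j _ => (hf j).norm))
  have hd := ha.pos
  refine intervalIntegrable_conv (G := fun τ s => forcing a q τ (F s) (f s))
    (C := 4 * d ^ (-(θ + 1 / 4)) * M) (k := d / 2) ?_ hθ (by positivity)
    (fun τ hτ s hs => ?_) ht
  · exact ha.continuousOn_forcing hq hθ0 hθ.le (σ := fun p : ℝ × ℝ => p.1)
      (F := fun p => F p.2) (f := fun p => f p.2) continuousOn_fst
      (fun p hp => hp.1) ((hF.mono Ioo_subset_Icc_self).comp continuousOn_snd fun p hp => hp.2)
      fun j => ((hf j).mono Ioo_subset_Icc_self).comp continuousOn_snd fun p hp => hp.2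
  · refine (ha.norm_forcing_le hq hθ0 hθ.le hτ _ _).trans ?_
    have := sing_nonneg (θ := θ + 1 / 4) (k := d / 2) hτ.le
    gcongr
    exact (le_abs_self _).trans (hM s (Ioo_subset_Icc_self hs))

theorem continuousOn_integral_forcing (hq : IsOrder q θ) (hθ0 : 0 ≤ θ) (hθ : θ + 1 / 4 < 1)
    (hF : ContinuousOn F (Ici t₀)) (hf : ∀ j, ContinuousOn (fun s => f s j) (Ici t₀)) :
    ContinuousOn (fun t => ∫ s in t₀..t, forcing a q (t - s) (F s) (f s)) (Ici t₀) := by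
  have hd := ha.pos
  refine continuousOn_conv_of_local (G := fun τ s => forcing a q τ (F s) (f s))
    (k := d / 2) (θ := θ + 1 / 4) ?_ hθ (by positivity) fun T => ?_
  · exact ha.continuousOn_forcing hq hθ0 hθ.le (σ := fun p : ℝ × ℝ => p.1)
      (F := fun p => F p.2) (f := fun p => f p.2) continuousOn_fst
      (fun p hp => hp.1) (hF.comp continuousOn_snd fun p hp => hp.2)
      fun j => (hf j).comp continuousOn_snd fun p hp => hp.2
  · obtain ⟨M, hM⟩ := isCompact_Icc.exists_bound_of_continuousOn
      (f := fun s => ‖F s‖ + ∑ j, ‖f s j‖) (s := Icc t₀ T)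
      ((hF.norm.add (continuousOn_finsetSum _ fun j _ => (hf j).norm)).mono fun s hs => hs.1)
    refine ⟨4 * d ^ (-(θ + 1 / 4)) * max M 0, by positivity, fun τ hτ s hs => ?_⟩
    refine (ha.norm_forcing_le hq hθ0 hθ.le hτ _ _).trans ?_
    have := sing_nonneg (θ := θ + 1 / 4) (k := d / 2) hτ.le
    gcongr
    exact ((le_abs_self _).trans (hM s hs)).trans (le_max_left _ _)

theorem continuousOn_duhamel (hq : IsOrder q θ) (hθ0 : 0 ≤ θ) (hθ : θ + 1 / 4 < 1) (U : FM n)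
    (hF : ContinuousOn F (Ici t₀)) (hf : ∀ j, ContinuousOn (fun s => f s j) (Ici t₀)) :
    ContinuousOn (duhamel a q t₀ U F f) (Ioi t₀) := by
  unfold duhamel
  refine ContinuousOn.sub ?_ ((ha.continuousOn_integral_forcing hq hθ0 hθ hF hf).mono
    Ioi_subset_Ici_self)
  have h := ha.continuousOn_heat hq hθ0 (by linarith)
  have h2 : ContinuousOn (fun t : ℝ => (t - t₀, U)) (Ioi t₀) := by fun_prop
  exact h.comp h2 fun t ht => ⟨mem_Ioi.2 (sub_pos.2 ht), trivial⟩

theorem norm_duhamel_le (hq : IsOrder q θ) (hθ0 : 0 ≤ θ) (hθ : θ + 1 / 4 < 1) (U : FM n)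
    (ht : t₀ < t) {M : ℝ} (hM : ∀ s ∈ Icc t₀ t, ‖F s‖ + ∑ j, ‖f s j‖ ≤ M) :
    ‖duhamel a q t₀ U F f t‖ ≤ 2 * d ^ (-θ) * (t - t₀) ^ (-θ) * ‖U‖ +
      4 * d ^ (-(θ + 1 / 4)) * M * singMass (θ + 1 / 4) (d / 2) := by
  have hd := ha.pos
  have ht' : 0 < t - t₀ := sub_pos.2 ht
  have hM0 : 0 ≤ M := le_trans (by positivity) (hM t ⟨ht.le, le_rfl⟩)
  refine (norm_sub_le _ _).trans (add_le_add ?_ ?_)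
  · refine (norm_sm_apply_le _ _).trans ?_
    gcongr
    refine (ha.norm_heat_le hq hθ0 (by linarith) ht').trans ?_
    gcongr
    exact sing_le (by positivity) ht'.le
  · refine (norm_integral_conv_le (C := 4 * d ^ (-(θ + 1 / 4)) * M) (θ := θ + 1 / 4) (k := d / 2)
      hθ (by positivity) ht.le fun s hs hst => ?_).trans ?_
    · refine (ha.norm_forcing_le hq hθ0 hθ.le (sub_pos.2 hst) _ _).trans ?_
      have := sing_nonneg (θ := θ + 1 / 4) (k := d / 2) (sub_pos.2 hst).le
      gcongr
      exact hM s ⟨hs, hst.le⟩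
    · gcongr
      exact integral_sing_le hθ (by positivity) ht.le

/-- The gain of two derivatives: 1-Δ has order 1/2 and the divergence 1/4, so the Duhamel integral
with 1-Δ inside still converges and the resolvent can be pulled out of it. -/
theorem duhamel_one_eq (ht : t₀ < t) (U : FM n) (hF : ContinuousOn F (Icc t₀ t))
    (hf : ∀ j, ContinuousOn (fun s => f s j) (Icc t₀ t)) :
    duhamel a (fun _ => 1) t₀ U F f t = sm (res n) (duhamel a rho t₀ U F f t) := by
  have hi := ha.intervalIntegrable_forcing isOrder_rho (by norm_num) (by norm_num) ht.le hF hf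
  have h1 := ha.sm_res_heat_rho isOrder_one le_rfl (by norm_num) (sub_pos.2 ht) U
  simp only [mul_one] at h1
  rw [duhamel, duhamel, map_sub, h1, ← ContinuousLinearMap.intervalIntegral_comp_comm _ hi]
  congr 1
  rw [intervalIntegral.integral_of_le ht.le, intervalIntegral.integral_of_le ht.le,
    integral_Ioc_eq_integral_Ioo, integral_Ioc_eq_integral_Ioo]
  refine setIntegral_congr_fun measurableSet_Ioo fun s hs => ?_
  exact (ha.sm_res_forcing (sub_pos.2 hs.2) _ _).symm

theorem duhamel_sm (hq : IsOrder q θ) (hθ0 : 0 ≤ θ) (hθ : θ + 1 / 4 < 1) (ht : t₀ ≤ t)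
    (p : Rn n →ᵇ ℂ) (U : FM n) (hF : ContinuousOn F (Icc t₀ t))
    (hf : ∀ j, ContinuousOn (fun s => f s j) (Icc t₀ t)) :
    duhamel a q t₀ (sm p U) (fun s => sm p (F s)) (fun s j => sm p (f s j)) t =
      sm p (duhamel a q t₀ U F f t) := by
  have hi := ha.intervalIntegrable_forcing hq hθ0 hθ ht hF hf
  rw [duhamel, duhamel, map_sub, sm_sm, sm_sm, mul_comm,
    ← ContinuousLinearMap.intervalIntegral_comp_comm _ hi]
  simp only [forcing_sm]

theorem sm_heat_forcing {σ τ : ℝ} (hσ : 0 ≤ σ) (hτ : 0 < τ) (F : FM n) (f : Fin n → FM n) :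
    sm (heat a (fun _ => 1) σ) (forcing a (fun _ => 1) τ F f) =
      forcing a (fun _ => 1) (σ + τ) F f := by
  simp only [forcing, map_add, map_sum, sm_sm, ha.heat_mul isOrder_one le_rfl zero_le_one hσ hτ,
    ha.heat_mul (isOrder_one.mul (isOrder_derivSym _)) (by norm_num) (by norm_num) hσ hτ]

/-- The semigroup law moves e^(-(t-t₁)A) under the integral up to t₁, and the two adjacent intervals
join. -/
theorem duhamel_restart {t₁ : ℝ} (h₁ : t₀ ≤ t₁) (ht : t₁ ≤ t) (U : FM n)
    (hF : ContinuousOn F (Icc t₀ t)) (hf : ∀ j, ContinuousOn (fun s => f s j) (Icc t₀ t)) :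
    duhamel a (fun _ => 1) t₀ U F f t =
      duhamel a (fun _ => 1) t₁ (duhamel a (fun _ => 1) t₀ U F f t₁) F f t := by
  have hsub : Icc t₀ t₁ ⊆ Icc t₀ t := Icc_subset_Icc le_rfl ht
  have hi := ha.intervalIntegrable_forcing isOrder_one le_rfl (by norm_num) (h₁.trans ht) hF hf
  have hi₁ := ha.intervalIntegrable_forcing isOrder_one le_rfl (by norm_num) h₁ (hF.mono hsub)
    fun j => (hf j).mono hsub
  have hu : uIcc t₀ t₁ ⊆ uIcc t₀ t := by
    rw [uIcc_of_le h₁, uIcc_of_le (h₁.trans ht)]; exact hsub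
  have hu' : uIcc t₁ t ⊆ uIcc t₀ t := by
    rw [uIcc_of_le ht, uIcc_of_le (h₁.trans ht)]; exact Icc_subset_Icc h₁ le_rfl
  simp only [duhamel]
  rw [map_sub, sm_sm, ha.heat_one_mul (by linarith) (by linarith),
    ← ContinuousLinearMap.intervalIntegral_comp_comm _ hi₁,
    ← intervalIntegral.integral_add_adjacent_intervals (hi.mono_set hu) (hi.mono_set hu')]
  have e : ∫ s in t₀..t₁, sm (heat a (fun _ => 1) (t - t₁))
      (forcing a (fun _ => 1) (t₁ - s) (F s) (f s)) =
      ∫ s in t₀..t₁, forcing a (fun _ => 1) (t - s) (F s) (f s) := by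
    rw [intervalIntegral.integral_of_le h₁, intervalIntegral.integral_of_le h₁,
      integral_Ioc_eq_integral_Ioo, integral_Ioc_eq_integral_Ioo]
    refine setIntegral_congr_fun measurableSet_Ioo fun s hs => ?_
    rw [ha.sm_heat_forcing (sub_nonneg.2 ht) (sub_pos.2 hs.2), sub_add_sub_cancel]
  rw [e, sub_add_sub_cancel, sub_sub]

end IsCoerciveSymbol

end FM
end ActiveFluid

/-! ### The nonlinearity on regular functions, and the evolution equation -/

namespace ActiveFluid
namespace FM

open BoundedContinuousFunction Filter Topology Duhamel

variable {n : ℕ} {lam₀ β : ℝ}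

/-! ### The nonlinearity on the range of the resolvent -/

/-- `(1 - Δ)` applied to the cubic term of `(1 - Δ)⁻¹ y`. -/
def cubicPartQ (β : ℝ) (y : FM n) : FM n := (β : ℂ) • cubQ y

/-- `(1 - Δ)` applied to the flux of `(1 - Δ)⁻¹ y`. -/
def fluxQ (lam₀ : ℝ) (y : FM n) (j : Fin n) : FM n := (lam₀ : ℂ) • Q j y y

theorem cubicPart_res (y : FM n) : cubicPart β (sm (res n) y) = sm (res n) (cubicPartQ β y) := by
  rw [cubicPart, cub_res, cubicPartQ, map_smul]

theorem flux_res (y : FM n) (j : Fin n) :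
    flux lam₀ (sm (res n) y) j = sm (res n) (fluxQ lam₀ y j) := by
  rw [flux, B_res_res, fluxQ, map_smul]

theorem continuous_cubicPartQ : Continuous (cubicPartQ β : FM n → FM n) :=
  (continuous_cubQ.const_smul (β : ℂ) : Continuous fun u : FM n => (β : ℂ) • cubQ u)

theorem continuous_fluxQ (j : Fin n) : Continuous fun u : FM n => fluxQ lam₀ u j :=
  ((continuous_Q_comp j continuous_id continuous_id).const_smul (lam₀ : ℂ) :
    Continuous fun u : FM n => (lam₀ : ℂ) • Q j u u)

/-- The symbol `i ξ_j / (1 + |ξ|²)`. -/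
def dres (j : Fin n) : Rn n →ᵇ ℂ := Complex.I • resX j

theorem dres_apply (j : Fin n) (ξ : Rn n) : dres j ξ = derivSym j ξ * res n ξ := by
  change Complex.I * resX j ξ = _
  rw [resX_apply, res_apply, derivSym, mul_assoc]

/-- `P(β|u|²u + λ₀(u·∇)u)` for `u = (1 - Δ)⁻² z`. -/
def source (lam₀ β : ℝ) (z : FM n) : FM n :=
  helm (cubicPart β (sm (res n) (sm (res n) z))) +
    ∑ j, sm (dres j) (helm (fluxQ lam₀ (sm (res n) z) j))

theorem continuous_source : Continuous (source lam₀ β : FM n → FM n) := by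
  have h1 : Continuous fun z : FM n => sm (res n) z := (sm (res n)).continuous
  have h2 : Continuous fun z : FM n => sm (res n) (sm (res n) z) := h1.comp h1
  have h3 : Continuous fun z : FM n => helm (cubicPart β (sm (res n) (sm (res n) z))) :=
    helm.continuous.comp (continuous_cubicPart.comp h2)
  have h4 : ∀ j, Continuous fun z : FM n => sm (dres j) (helm (fluxQ lam₀ (sm (res n) z) j)) :=
    fun j => (sm (dres j)).continuous.comp (helm.continuous.comp ((continuous_fluxQ j).comp h1))
  exact h3.add (continuous_finsetSum _ fun j _ => h4 j)

namespace IsCoerciveSymbol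

variable {a : Rn n → ℝ} {d D : ℝ} (ha : IsCoerciveSymbol a d D)
include ha

/-- For u in the range of the squared resolvent, the divergence is absorbed into the bounded symbol
`dres`. The Duhamel integrand becomes the semigroup applied to a continuous source, with no singular
kernel left. -/
theorem forcing_res_res {τ : ℝ} (hτ : 0 < τ) (z : FM n) :
    forcing a (fun _ => 1) τ (cubicPart β (sm (res n) (sm (res n) z)))
      (flux lam₀ (sm (res n) (sm (res n) z))) =
      sm (heat a (fun _ => 1) τ) (source lam₀ β z) := by
  have e : ∀ (j : Fin n) (w : FM n), sm (heat a (fun ξ => 1 * derivSym j ξ) τ)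
      (helm (sm (res n) w)) = sm (heat a (fun _ => 1) τ) (sm (dres j) (helm w)) := by
    intro j w
    rw [← sm_helm, sm_sm, sm_sm]
    congr 2
    ext1 ξ
    rw [BoundedContinuousFunction.mul_apply, BoundedContinuousFunction.mul_apply,
      ha.heat_apply (isOrder_one.mul (isOrder_derivSym j)) (by norm_num) (by norm_num) hτ,
      ha.heat_one_apply hτ.le, dres_apply]
    ring
  simp only [forcing, source, map_add, map_sum, flux_res, e]

/-! ### The generator -/

theorem norm_elliptic_le (ξ : Rn n) : ‖(a ξ : ℂ) * (res n ξ * res n ξ)‖ ≤ D := by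
  have h0 := one_add_sq_pos ξ
  rw [norm_mul, norm_mul, res_apply, norm_resolvent, Complex.norm_real,
    Real.norm_of_nonneg (ha.nonneg ξ), ← mul_inv, ← sq, ← div_eq_mul_inv, div_le_iff₀ (by positivity)]
  exact ha.ge ξ

/-- The symbol `a(ξ) / (1 + |ξ|²)²`. -/
def elliptic : Rn n →ᵇ ℂ :=
  ofNormedAddCommGroup (fun ξ => (a ξ : ℂ) * (res n ξ * res n ξ))
    (by have := ha.continuous; have := (res n).continuous; fun_prop) D ha.norm_elliptic_le

theorem elliptic_apply (ξ : Rn n) : ha.elliptic ξ = (a ξ : ℂ) * (res n ξ * res n ξ) := rfl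

/-- Since the exponential is 1-Lipschitz on (-∞,0], the symbols of the difference quotients, divided
by (1+|ξ|²)², are bounded by a/(1+|ξ|²)² ≤ D. They converge pointwise, so strong convergence
follows. -/
theorem hasDerivWithinAt_heat {τ₀ : ℝ} (hτ₀ : 0 ≤ τ₀) (w : FM n) :
    HasDerivWithinAt (fun τ => sm (heat a (fun _ => 1) τ) (sm (res n) (sm (res n) w)))
      (-sm (heat a (fun _ => 1) τ₀) (sm ha.elliptic w)) (Ici 0) τ₀ := by
  rw [hasDerivWithinAt_iff_tendsto_slope]
  set p : ℝ → Rn n →ᵇ ℂ := fun τ => ((τ - τ₀ : ℝ) : ℂ)⁻¹ •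
    ((heat a (fun _ => 1) τ - heat a (fun _ => 1) τ₀) * (res n * res n)) with hp
  have hpa : ∀ τ ξ, p τ ξ = ((τ - τ₀ : ℝ) : ℂ)⁻¹ *
      ((heat a (fun _ => 1) τ ξ - heat a (fun _ => 1) τ₀ ξ) * (res n ξ * res n ξ)) :=
    fun τ ξ => rfl
  have e1 : ∀ τ, slope (fun τ => sm (heat a (fun _ => 1) τ) (sm (res n) (sm (res n) w))) τ₀ τ =
      sm (p τ) w := by
    intro τ
    rw [slope_def_module, hp, map_smul, _root_.smul_apply, ← sm_sm, ← sm_sm, map_sub,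
      _root_.sub_apply, ← Complex.ofReal_inv, Complex.coe_smul]
  have e2 : -sm (heat a (fun _ => 1) τ₀) (sm ha.elliptic w) =
      sm (-(heat a (fun _ => 1) τ₀ * ha.elliptic)) w := by
    rw [sm_sm, map_neg, _root_.neg_apply]
  rw [e2]
  refine Tendsto.congr (fun τ => (e1 τ).symm) ?_
  have hev : ∀ᶠ τ in 𝓝[Ici 0 \ {τ₀}] τ₀, 0 ≤ τ ∧ τ ≠ τ₀ := by
    filter_upwards [self_mem_nhdsWithin] with τ hτ using ⟨hτ.1, hτ.2⟩
  refine tendsto_sm (C := D) ?_ ?_ w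
  · filter_upwards [hev] with τ hτ ξ
    have hne : τ - τ₀ ≠ 0 := sub_ne_zero.2 hτ.2
    have hD := ha.norm_elliptic_le ξ
    rw [norm_mul] at hD
    rw [hpa, ha.heat_one_apply hτ.1, ha.heat_one_apply hτ₀, ← Complex.ofReal_sub, norm_mul,
      norm_mul, norm_inv, Complex.norm_real, Complex.norm_real]
    rw [Complex.norm_real, Real.norm_of_nonneg (ha.nonneg ξ)] at hD
    have hexp : ‖Real.exp (-τ * a ξ) - Real.exp (-τ₀ * a ξ)‖ ≤ ‖τ - τ₀‖ * a ξ := by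
      have hl : ∀ x ∈ Iic (0 : ℝ), ‖Real.exp x‖ ≤ 1 := fun x hx => by
        rw [Real.norm_of_nonneg (Real.exp_pos _).le]
        exact Real.exp_le_one_iff.2 hx
      have := Convex.norm_image_sub_le_of_norm_hasDerivWithin_le (f := Real.exp) (f' := Real.exp)
        (s := Iic (0 : ℝ)) (x := -τ₀ * a ξ) (y := -τ * a ξ) (C := 1)
        (fun x _ => (Real.hasDerivAt_exp x).hasDerivWithinAt) hl (convex_Iic 0)
        (by have := mul_nonneg hτ₀ (ha.nonneg ξ); simp only [mem_Iic]; linarith)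
        (by have := mul_nonneg hτ.1 (ha.nonneg ξ); simp only [mem_Iic]; linarith)
      refine this.trans (le_of_eq ?_)
      rw [one_mul, ← sub_mul, norm_mul, Real.norm_of_nonneg (ha.nonneg ξ), ← norm_neg]
      congr 2
      ring
    have hpos : 0 < ‖τ - τ₀‖ := norm_pos_iff.2 hne
    calc _ ≤ ‖τ - τ₀‖⁻¹ * (‖τ - τ₀‖ * a ξ * ‖res n ξ * res n ξ‖) := by gcongr
      _ = a ξ * ‖res n ξ * res n ξ‖ := by field_simp
      _ ≤ D := hD
  · intro ξ
    have hd : HasDerivAt (fun τ : ℝ => (Real.exp (-τ * a ξ) : ℂ))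
        ((Real.exp (-τ₀ * a ξ) * (-1 * a ξ) : ℝ) : ℂ) τ₀ :=
      HasDerivAt.ofReal_comp (((hasDerivAt_id τ₀).neg.mul_const (a ξ)).exp)
    have hs := (hasDerivWithinAt_iff_tendsto_slope (s := Ici 0)).1 hd.hasDerivWithinAt
    have hs' := hs.mul_const (res n ξ * res n ξ)
    have e3 : (-(heat a (fun _ => 1) τ₀ * ha.elliptic)) ξ =
        ((Real.exp (-τ₀ * a ξ) * (-1 * a ξ) : ℝ) : ℂ) * (res n ξ * res n ξ) := by
      rw [BoundedContinuousFunction.neg_apply, BoundedContinuousFunction.mul_apply,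
        ha.heat_one_apply hτ₀, elliptic_apply]
      push_cast
      ring
    rw [e3]
    refine hs'.congr' ?_
    filter_upwards [hev] with τ hτ
    rw [hpa, ha.heat_one_apply hτ.1, ha.heat_one_apply hτ₀, slope_def_module, ← Complex.ofReal_inv,
      ← mul_assoc, Complex.real_smul]
    ring

/-- By joint continuity up to the diagonal, where the semigroup is the identity, the integrand
differs from h(t₀) by less than ε on a short interval. -/
theorem hasDerivWithinAt_integral_heat {h : ℝ → FM n} {t₀ : ℝ} (hh : ContinuousOn h (Ici t₀)) :
    HasDerivWithinAt (fun t => ∫ s in t₀..t, sm (heat a (fun _ => 1) (t - s)) (h s)) (h t₀)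
      (Ici t₀) t₀ := by
  have hjoint : ContinuousOn (fun z : ℝ × ℝ => sm (heat a (fun _ => 1) (z.1 - z.2)) (h z.2))
      {z | t₀ ≤ z.2 ∧ z.2 ≤ z.1} := by
    have h1 : ContinuousOn (fun z : ℝ × ℝ => (z.1 - z.2, h z.2)) {z | t₀ ≤ z.2 ∧ z.2 ≤ z.1} :=
      ContinuousOn.prodMk (by fun_prop) (hh.comp continuousOn_snd fun z hz => hz.1)
    exact ha.continuousOn_heat_one.comp h1 fun z hz => ⟨mem_Ici.2 (sub_nonneg.2 hz.2), trivial⟩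
  rw [hasDerivWithinAt_iff_isLittleO, Asymptotics.isLittleO_iff]
  intro ε hε
  have hc := hjoint (t₀, t₀) ⟨le_rfl, le_rfl⟩
  obtain ⟨δ, hδ, hball⟩ := Metric.continuousWithinAt_iff.1 hc ε hε
  filter_upwards [self_mem_nhdsWithin, mem_nhdsWithin_of_mem_nhds
    (Iio_mem_nhds (show t₀ < t₀ + δ by linarith))] with t ht ht'
  have ht : t₀ ≤ t := ht
  have ht' : t < t₀ + δ := ht'
  have hi : IntervalIntegrable (fun s => sm (heat a (fun _ => 1) (t - s)) (h s)) volume t₀ t := by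
    refine ContinuousOn.intervalIntegrable ?_
    rw [uIcc_of_le ht]
    exact hjoint.comp (f := fun s => (t, s)) (by fun_prop) fun s hs => ⟨hs.1, hs.2⟩
  have hb : ‖∫ s in t₀..t, (sm (heat a (fun _ => 1) (t - s)) (h s) - h t₀)‖ ≤ ε * |t - t₀| := by
    refine intervalIntegral.norm_integral_le_of_norm_le_const fun s hs => ?_
    rw [uIoc_of_le ht] at hs
    have hd : dist (t, s) (t₀, t₀) < δ := by
      rw [Prod.dist_eq, Real.dist_eq, Real.dist_eq, abs_of_nonneg (by linarith),
        abs_of_nonneg (by linarith [hs.1])]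
      exact max_lt (by linarith) (by linarith [hs.2])
    have := hball ⟨hs.1.le, hs.2⟩ hd
    rw [dist_eq_norm] at this
    simp only [sub_self, ha.heat_zero, sm_one] at this
    exact this.le
  rw [intervalIntegral.integral_sub hi intervalIntegrable_const,
    intervalIntegral.integral_const] at hb
  rw [intervalIntegral.integral_same, sub_zero, Real.norm_eq_abs]
  exact hb

/-- The variation of constants formula yields a solution of the differential equation. -/
theorem hasDerivAt_of_duhamel {u z h : ℝ → FM n} {t₀ : ℝ}
    (hz : ContinuousOn z (Ioi t₀)) (hh : ContinuousOn h (Ioi t₀))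
    (huz : ∀ t, t₀ < t → u t = sm (res n) (sm (res n) (z t)))
    (hu : ∀ t₁ t, t₀ < t₁ → t₁ ≤ t → u t = sm (heat a (fun _ => 1) (t - t₁)) (u t₁) -
      ∫ s in t₁..t, sm (heat a (fun _ => 1) (t - s)) (h s)) {t : ℝ} (ht : t₀ < t) :
    HasDerivAt u (-(sm ha.elliptic (z t) + h t)) t := by
  -- Restarting the formula at t₁ gives only a right derivative there, since the semigroup runs
  -- forward.
  have hright : ∀ t₁, t₀ < t₁ →
      HasDerivWithinAt u (-(sm ha.elliptic (z t₁) + h t₁)) (Ici t₁) t₁ := by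
    intro t₁ ht₁
    have h1 : HasDerivWithinAt
        (fun t => sm (heat a (fun _ => 1) (t - t₁)) (sm (res n) (sm (res n) (z t₁))))
        (-sm ha.elliptic (z t₁)) (Ici t₁) t₁ := by
      have h2 := ha.hasDerivWithinAt_heat (τ₀ := t₁ - t₁) (sub_self t₁).ge (z t₁)
      have h0 : heat a (fun _ => 1) (t₁ - t₁) = 1 := by rw [sub_self, ha.heat_zero]
      rw [h0, sm_one] at h2
      have h3 := h2.scomp t₁ (h := fun t => t - t₁) (s := Ici t₁)
        ((hasDerivAt_id t₁).sub_const t₁).hasDerivWithinAt fun t ht => by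
          simpa using ht
      exact h3.congr_deriv (one_smul _ _)
    have h4 := h1.sub (ha.hasDerivWithinAt_integral_heat (hh.mono (Ici_subset_Ioi.2 ht₁)))
    rw [neg_add, ← sub_eq_add_neg]
    refine h4.congr (fun t ht => ?_) ?_
    · rw [hu t₁ t ht₁ ht, huz t₁ ht₁]
      rfl
    · rw [hu t₁ t₁ ht₁ le_rfl, huz t₁ ht₁]
      rfl
  set g : ℝ → FM n := fun t => -(sm ha.elliptic (z t) + h t) with hg
  have hgc : ContinuousOn g (Ioi t₀) :=
    (((sm ha.elliptic).continuous.comp_continuousOn hz).add hh).neg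
  have huc : ContinuousOn u (Ioi t₀) :=
    ((sm (res n)).continuous.comp_continuousOn ((sm (res n)).continuous.comp_continuousOn hz)).congr
      fun t ht => huz t ht
  obtain ⟨t₁, ht₁, ht₁'⟩ := exists_between ht
  have hint : ∀ s, t₁ ≤ s → IntervalIntegrable g volume t₁ s := fun s hs => by
    refine (hgc.mono ?_).intervalIntegrable
    rw [uIcc_of_le hs]
    exact fun x hx => ht₁.trans_le hx.1
  -- A continuous function whose right derivative is g, with g continuous, is a primitive of g; this
  -- upgrades the right derivative to a two-sided one.
  have hFTC : ∀ s, t₁ ≤ s → ∫ r in t₁..s, g r = u s - u t₁ := by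
    intro s hs
    refine intervalIntegral.integral_eq_sub_of_hasDeriv_right ?_ (fun r hr => ?_) (hint s hs)
    · rw [uIcc_of_le hs]
      exact huc.mono fun x hx => ht₁.trans_le hx.1
    · rw [min_eq_left hs] at hr
      exact (hright r (ht₁.trans hr.1)).mono Ioi_subset_Ici_self
  have hder : HasDerivAt (fun s => ∫ r in t₁..s, g r) (g t) t := by
    refine intervalIntegral.integral_hasDerivAt_right (hint t ht₁'.le) ?_
      (hgc.continuousAt (Ioi_mem_nhds ht))
    exact hgc.stronglyMeasurableAtFilter isOpen_Ioi t ht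
  refine (hder.const_add (u t₁)).congr_of_eventuallyEq ?_
  filter_upwards [Ioi_mem_nhds ht₁'] with s hs
  rw [hFTC s (le_of_lt hs), add_sub_cancel]

/-- Solutions of the differential equation satisfy the variation of constants formula. -/
theorem duhamel_of_hasDerivAt {v z h : ℝ → FM n} {t₁ t : ℝ} (ht : t₁ ≤ t)
    (hv : ContinuousOn v (Icc t₁ t)) (hh : ContinuousOn h (Icc t₁ t))
    (hvz : ∀ s ∈ Ioo t₁ t, v s = sm (res n) (sm (res n) (z s)))
    (hder : ∀ s ∈ Ioo t₁ t, HasDerivAt v (-(sm ha.elliptic (z s) + h s)) s) :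
    v t = sm (heat a (fun _ => 1) (t - t₁)) (v t₁) -
      ∫ s in t₁..t, sm (heat a (fun _ => 1) (t - s)) (h s) := by
  have hcomp : ∀ {g : ℝ → FM n}, ContinuousOn g (Icc t₁ t) →
      ContinuousOn (fun s => sm (heat a (fun _ => 1) (t - s)) (g s)) (Icc t₁ t) := by
    intro g hg
    have h1 : ContinuousOn (fun s => (t - s, g s)) (Icc t₁ t) :=
      ContinuousOn.prodMk (by fun_prop) hg
    exact ha.continuousOn_heat_one.comp h1 fun s hs => ⟨mem_Ici.2 (sub_nonneg.2 hs.2), trivial⟩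
  have hi : IntervalIntegrable (fun s => -sm (heat a (fun _ => 1) (t - s)) (h s)) volume t₁ t := by
    refine ContinuousOn.intervalIntegrable ?_
    rw [uIcc_of_le ht]
    exact (hcomp hh).neg
  -- The terms with A cancel in the derivative of s ↦ e^(-(t-s)A) v(s), leaving -e^(-(t-s)A) h(s),
  -- which is integrated from t₁ to t.
  have key := intervalIntegral.integral_eq_sub_of_hasDeriv_right
    (f := fun s => sm (heat a (fun _ => 1) (t - s)) (v s)) (by
      rw [uIcc_of_le ht]; exact hcomp hv) (fun s hs => ?_) hi
  · rw [intervalIntegral.integral_neg] at key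
    simp only [sub_self, ha.heat_zero, sm_one] at key
    rw [sub_eq_add_neg _ (∫ s in t₁..t, _), key]
    abel
  · rw [min_eq_left ht, max_eq_right ht] at hs
    have hts : 0 < t - s := sub_pos.2 hs.2
    refine HasDerivAt.hasDerivWithinAt ?_
    rw [hasDerivAt_iff_tendsto_slope]
    have hnear : ∀ᶠ r in 𝓝[≠] s, r < t :=
      mem_nhdsWithin_of_mem_nhds (Iio_mem_nhds hs.2)
    -- Product rule by hand: the difference quotient splits into the moving semigroup on the slope
    -- of v, plus the slope of the semigroup on the fixed v(s). The second part needs v(s) in the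
    -- range of the squared resolvent.
    have h1 : Tendsto (fun r => sm (heat a (fun _ => 1) (t - r)) (slope v s r)) (𝓝[≠] s)
        (𝓝 (sm (heat a (fun _ => 1) (t - s)) (-(sm ha.elliptic (z s) + h s)))) := by
      refine tendsto_sm_apply (p := fun r => heat a (fun _ => 1) (t - r)) (C := 1) ?_ ?_
        (hasDerivAt_iff_tendsto_slope.1 (hder s hs))
      · filter_upwards [hnear] with r hr ξ
        exact (BoundedContinuousFunction.norm_coe_le_norm _ ξ).trans
          (ha.norm_heat_one_le_one (by linarith))
      · intro ξ
        rw [ha.heat_one_apply hts.le]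
        have hc : Tendsto (fun r : ℝ => (Real.exp (-(t - r) * a ξ) : ℂ)) (𝓝[≠] s)
            (𝓝 (Real.exp (-(t - s) * a ξ) : ℂ)) :=
          (Continuous.tendsto' (by fun_prop) _ _ rfl).mono_left nhdsWithin_le_nhds
        refine hc.congr' ?_
        filter_upwards [hnear] with r hr
        rw [ha.heat_one_apply (by linarith)]
    have h2 : HasDerivAt (fun r => sm (heat a (fun _ => 1) (t - r)) (v s))
        (sm (heat a (fun _ => 1) (t - s)) (sm ha.elliptic (z s))) s := by
      have h3 := (ha.hasDerivWithinAt_heat hts.le (z s)).hasDerivAt (Ici_mem_nhds hts)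
      have h4 := h3.scomp s ((hasDerivAt_id s).const_sub t)
      rw [hvz s hs]
      exact h4.congr_deriv (by simp)
    have h5 := h1.add (hasDerivAt_iff_tendsto_slope.1 h2)
    have e : sm (heat a (fun _ => 1) (t - s)) (-(sm ha.elliptic (z s) + h s)) +
        sm (heat a (fun _ => 1) (t - s)) (sm ha.elliptic (z s)) =
        -sm (heat a (fun _ => 1) (t - s)) (h s) := by
      rw [map_neg, map_add]; abel
    rw [e] at h5
    refine h5.congr fun r => ?_
    simp only [slope_def_module]
    rw [ContinuousLinearMap.map_smul_of_tower, ← smul_add, map_sub]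
    congr 1
    abel

end IsCoerciveSymbol

end FM
end ActiveFluid

/-! ### Smoothing of mild solutions; differentiating functions in FM -/

namespace ActiveFluid
namespace FM

open BoundedContinuousFunction Filter Topology Duhamel

variable {n : ℕ} {lam₀ Γ₀ Γ₂ α β : ℝ}

/-! ### Smoothing of mild solutions -/

namespace IsCoerciveSymbol

theorem eq_duhamel {d D : ℝ} (ha : IsCoerciveSymbol (symbolAd Γ₀ Γ₂ α : Rn n → ℝ) d D)
    {U : FM n} {v : ℝ → FM n} {t₀ t : ℝ} (ht : t₀ ≤ t) :
    sm (heat (symbolAd Γ₀ Γ₂ α) (fun _ => 1) (t - t₀)) U -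
      ∫ s in t₀..t, semigroupH lam₀ Γ₀ Γ₂ α β (t - s) (v s) =
    duhamel (symbolAd Γ₀ Γ₂ α) (fun _ => 1) t₀ U (fun s => cubicPart β (v s))
      (fun s => flux lam₀ (v s)) t := by
  rw [duhamel]
  congr 1
  rw [intervalIntegral.integral_of_le ht, intervalIntegral.integral_of_le ht,
    integral_Ioc_eq_integral_Ioo, integral_Ioc_eq_integral_Ioo]
  exact setIntegral_congr_fun measurableSet_Ioo fun s hs => semigroupH_eq ha (sub_pos.2 hs.2) _

variable {a : Rn n → ℝ} {d D : ℝ} (ha : IsCoerciveSymbol a d D)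
include ha

/-- The witness is 1-Δ applied to the Duhamel formula. The bound (t-t₀)^(-1/2) is the cost of 1-Δ on
the initial value and is integrable at t₀; the integral term stays bounded on bounded intervals. -/
theorem exists_res_eq {u : ℝ → FM n} {U : FM n} {F : ℝ → FM n} {f : ℝ → Fin n → FM n} {t₀ : ℝ}
    (hF : ContinuousOn F (Ici t₀)) (hf : ∀ j, ContinuousOn (fun s => f s j) (Ici t₀))
    (hu : ∀ t, t₀ ≤ t → u t = duhamel a (fun _ => 1) t₀ U F f t) :
    ∃ y : ℝ → FM n, ContinuousOn y (Ioi t₀) ∧ (∀ t, t₀ < t → u t = sm (res n) (y t)) ∧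
      ∀ T, ∃ C, ∀ t ∈ Ioc t₀ T, ‖y t‖ ≤ C * ((t - t₀) ^ (-(1 / 2) : ℝ) + 1) := by
  refine ⟨duhamel a rho t₀ U F f, ha.continuousOn_duhamel isOrder_rho (by norm_num) (by norm_num)
    U hF hf, fun t ht => ?_, fun T => ?_⟩
  · rw [hu t ht.le]
    exact ha.duhamel_one_eq ht U (hF.mono fun s hs => hs.1) fun j => (hf j).mono fun s hs => hs.1
  · obtain ⟨M, hM⟩ := isCompact_Icc.exists_bound_of_continuousOn
      (f := fun s => ‖F s‖ + ∑ j, ‖f s j‖) (s := Icc t₀ T)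
      ((hF.norm.add (continuousOn_finsetSum _ fun j _ => (hf j).norm)).mono fun s hs => hs.1)
    have hd := ha.pos
    refine ⟨max (2 * d ^ (-(1 / 2) : ℝ) * ‖U‖) (4 * d ^ (-(1 / 2 + 1 / 4) : ℝ) * M *
      singMass (1 / 2 + 1 / 4) (d / 2)), fun t ht => ?_⟩
    refine (ha.norm_duhamel_le isOrder_rho (by norm_num) (by norm_num) U ht.1
      fun s hs => (le_abs_self _).trans (hM s ⟨hs.1, hs.2.trans ht.2⟩)).trans ?_
    have h0 : 0 ≤ (t - t₀) ^ (-(1 / 2) : ℝ) := Real.rpow_nonneg (by linarith [ht.1]) _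
    rw [mul_add, mul_one]
    refine add_le_add ?_ (le_max_right _ _)
    rw [mul_right_comm]
    gcongr
    exact le_max_left _ _

/-- Four derivatives plus the divergence would give the nonintegrable kernel τ^(-5/4), so two
derivatives are gained twice. The second pass works because (1-Δ)u solves an integral equation with
the nonlinearity `cubicPartQ`, `fluxQ`, again continuous on FM. -/
theorem exists_smoothing {u : ℝ → FM n} {U : FM n} (huc : ContinuousOn u (Ici 0))
    (hu : ∀ t, 0 ≤ t → u t = duhamel a (fun _ => 1) 0 U (fun s => cubicPart β (u s))
      (fun s => flux lam₀ (u s)) t) :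
    ∃ y z : ℝ → FM n, ContinuousOn y (Ioi 0) ∧ ContinuousOn z (Ioi 0) ∧
      (∀ t, 0 < t → u t = sm (res n) (y t)) ∧ (∀ t, 0 < t → y t = sm (res n) (z t)) ∧
      (∀ t, 0 < t → HasDerivAt u (-(sm ha.elliptic (z t) + source lam₀ β (z t))) t) ∧
      ∀ T, ∃ C, ∀ t ∈ Ioc 0 T, ‖y t‖ ≤ C * (t ^ (-(1 / 2) : ℝ) + 1) := by
  have hF : ContinuousOn (fun s => cubicPart β (u s)) (Ici 0) :=
    continuous_cubicPart.comp_continuousOn huc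
  have hf : ∀ j, ContinuousOn (fun s => flux lam₀ (u s) j) (Ici 0) := fun j =>
    (continuous_flux j).comp_continuousOn huc
  obtain ⟨y, hyc, huy, hyb⟩ := ha.exists_res_eq hF hf hu
  simp only [sub_zero] at hyb
  have hrestart : ∀ ε t, 0 ≤ ε → ε ≤ t → u t = duhamel a (fun _ => 1) ε (u ε)
      (fun s => cubicPart β (u s)) (fun s => flux lam₀ (u s)) t := by
    intro ε t hε ht
    rw [hu ε hε, ← ha.duhamel_restart hε ht U (hF.mono fun s hs => hs.1)
      fun j => (hf j).mono fun s hs => hs.1]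
    exact hu t (hε.trans ht)
  -- The equation for y starts at ε > 0 because y is only known to be continuous on (0,∞). It is the
  -- equation for u with the injective resolvent cancelled.
  have hyd : ∀ ε t, 0 < ε → ε ≤ t → y t = duhamel a (fun _ => 1) ε (y ε)
      (fun s => cubicPartQ β (y s)) (fun s => fluxQ lam₀ (y s)) t := by
    intro ε t hε ht
    apply sm_res_injective
    have hsub : Icc ε t ⊆ Ioi 0 := fun s hs => hε.trans_le hs.1
    rw [← ha.duhamel_sm (F := fun s => cubicPartQ β (y s)) (f := fun s => fluxQ lam₀ (y s))
      isOrder_one le_rfl (by norm_num) ht (res n) (y ε)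
      (continuous_cubicPartQ.comp_continuousOn (hyc.mono hsub))
      fun j => (continuous_fluxQ j).comp_continuousOn (hyc.mono hsub),
      ← huy t (hε.trans_le ht), hrestart ε t hε.le ht, ← huy ε hε]
    simp only [duhamel]
    congr 1
    refine intervalIntegral.integral_congr fun s hs => ?_
    rw [uIcc_of_le ht] at hs
    simp only [huy s (hsub hs), cubicPart_res]
    congr 1
    exact funext fun j => flux_res _ j
  have hz : ∀ ε, 0 < ε → ∃ z : ℝ → FM n, ContinuousOn z (Ioi ε) ∧
      ∀ t, ε < t → y t = sm (res n) (z t) := by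
    intro ε hε
    have hsub : Ici ε ⊆ Ioi 0 := fun s hs => hε.trans_le hs
    obtain ⟨z, h1, h2, -⟩ := ha.exists_res_eq (u := y)
      (continuous_cubicPartQ.comp_continuousOn (hyc.mono hsub))
      (fun j => (continuous_fluxQ j).comp_continuousOn (hyc.mono hsub))
      fun t ht => hyd ε t hε ht
    exact ⟨z, h1, h2⟩
  have hzt : ∀ t, ∃ w, 0 < t → y t = sm (res n) w := by
    intro t
    by_cases ht : 0 < t
    · obtain ⟨z, -, h⟩ := hz (t / 2) (by linarith)
      exact ⟨z t, fun _ => h t (by linarith)⟩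
    · exact ⟨0, fun h => absurd h ht⟩
  choose z hyz using hzt
  -- The functions obtained from different ε agree where both are defined, again by injectivity of
  -- the resolvent, so continuity is local.
  have hzc : ContinuousOn z (Ioi 0) := by
    intro t ht
    have ht : 0 < t := ht
    obtain ⟨z', hz'c, hz'⟩ := hz (t / 2) (by linarith)
    have hmem : Ioi (t / 2) ∈ 𝓝 t := Ioi_mem_nhds (by linarith)
    refine ((hz'c.continuousAt hmem).congr ?_).continuousWithinAt
    filter_upwards [hmem] with s hs
    have hs : t / 2 < s := hs
    apply sm_res_injective
    rw [← hz' s hs, hyz s (by linarith)]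
  refine ⟨y, z, hyc, hzc, huy, hyz, fun t ht => ?_, hyb⟩
  refine ha.hasDerivAt_of_duhamel (t₀ := 0) hzc (continuous_source.comp_continuousOn hzc)
    (fun t ht => by rw [huy t ht, hyz t ht]) (fun t₁ t ht₁ ht => ?_) ht
  rw [hrestart t₁ t ht₁.le ht, duhamel]
  congr 1
  rw [intervalIntegral.integral_of_le ht, intervalIntegral.integral_of_le ht,
    integral_Ioc_eq_integral_Ioo, integral_Ioc_eq_integral_Ioo]
  refine setIntegral_congr_fun measurableSet_Ioo fun s hs => ?_
  rw [huy s (ht₁.trans hs.1), hyz s (ht₁.trans hs.1)]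
  exact ha.forcing_res_res (sub_pos.2 hs.2) _

end IsCoerciveSymbol

/-! ### Derivatives of the functions represented by `FM` -/

/-- The derivative of `x ↦ e^(i x·ξ) z`. -/
def expDeriv (x ξ : Rn n) (z : Cn n) : Rn n →L[ℝ] Cn n :=
  (innerSL ℝ ξ).smulRight ((Complex.I * Complex.exp (Complex.I * ((⟪x, ξ⟫_ℝ : ℝ) : ℂ))) • z)

theorem norm_expDeriv (x ξ : Rn n) (z : Cn n) : ‖expDeriv x ξ z‖ = ‖ξ‖ * ‖z‖ := by
  rw [expDeriv, ContinuousLinearMap.norm_smulRight_apply, innerSL_apply_norm, norm_smul, norm_mul,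
    Complex.norm_I, one_mul, mul_comm Complex.I, Complex.norm_exp_ofReal_mul_I, one_mul]

theorem expDeriv_single (x ξ : Rn n) (z : Cn n) (j : Fin n) :
    expDeriv x ξ z (EuclideanSpace.single j 1) =
      Complex.exp (Complex.I * ((⟪x, ξ⟫_ℝ : ℝ) : ℂ)) • derivSym j ξ • z := by
  rw [expDeriv, ContinuousLinearMap.smulRight_apply, innerSL_apply_apply,
    EuclideanSpace.inner_single_right, smul_smul, ← Complex.coe_smul, smul_smul]
  congr 1
  simp [derivSym]
  ring

theorem hasFDerivAt_exp_smul (x ξ : Rn n) (z : Cn n) :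
    HasFDerivAt (fun x => Complex.exp (Complex.I * ((⟪x, ξ⟫_ℝ : ℝ) : ℂ)) • z)
      (expDeriv x ξ z) x := by
  have h1 : HasFDerivAt (fun y : Rn n => ((⟪y, ξ⟫_ℝ : ℝ) : ℂ))
      (Complex.ofRealCLM.comp (innerSL ℝ ξ)) x := by
    have : (fun y : Rn n => ((⟪y, ξ⟫_ℝ : ℝ) : ℂ)) =
        fun y => (Complex.ofRealCLM.comp (innerSL ℝ ξ)) y := by
      ext y; simp [real_inner_comm]
    rw [this]
    exact ContinuousLinearMap.hasFDerivAt _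
  refine (((h1.const_mul Complex.I).cexp).smul_const z).congr_fderiv ?_
  ext v i
  simp [expDeriv]
  ring

section Push

variable {X : Type*} {mX : MeasurableSpace X} {m : Measure X} {φ : X → Rn n} {f : X → Cn n}

theorem integrable_expDeriv (hφ : Measurable φ) (hf : Integrable f m)
    (hf' : Integrable (fun ξ => ‖φ ξ‖ * ‖f ξ‖) m) (x : Rn n) :
    Integrable (fun ξ => expDeriv x (φ ξ) (f ξ)) m := by
  refine hf'.mono' ?_ (ae_of_all _ fun ξ => (norm_expDeriv _ _ _).le)
  have h1 : AEStronglyMeasurable (fun ξ => innerSL ℝ (φ ξ)) m :=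
    ((innerSL ℝ).continuous.measurable.comp hφ).aestronglyMeasurable
  have h2 : AEStronglyMeasurable (fun ξ =>
      (Complex.I * Complex.exp (Complex.I * ((⟪x, φ ξ⟫_ℝ : ℝ) : ℂ))) • f ξ) m := by
    have hc : AEStronglyMeasurable (fun ξ =>
        Complex.I * Complex.exp (Complex.I * ((⟪x, φ ξ⟫_ℝ : ℝ) : ℂ))) m :=
      Measurable.aestronglyMeasurable (by fun_prop)
    exact hc.smul hf.1
  exact (ContinuousLinearMap.smulRightL ℝ (Rn n) (Cn n)).aestronglyMeasurable_comp₂ h1 h2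

theorem hasFDerivAt_eval_push (hφ : Measurable φ) (hf : Integrable f m)
    (hf' : Integrable (fun ξ => ‖φ ξ‖ * ‖f ξ‖) m) (x : Rn n) :
    HasFDerivAt (push m φ f : Rn n → Cn n)
      (fourierConst n • ∫ ξ, expDeriv x (φ ξ) (f ξ) ∂m) x := by
  have e : (push m φ f : Rn n → Cn n) = fun x => fourierConst n •
      ∫ ξ, Complex.exp (Complex.I * ((⟪x, φ ξ⟫_ℝ : ℝ) : ℂ)) • f ξ ∂m :=
    funext fun x => eval_push hφ hf x
  rw [e]
  have key : HasFDerivAt (fun x => ∫ ξ, Complex.exp (Complex.I * ((⟪x, φ ξ⟫_ℝ : ℝ) : ℂ)) • f ξ ∂m)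
      (∫ ξ, expDeriv x (φ ξ) (f ξ) ∂m) x :=
    hasFDerivAt_integral_of_dominated_of_fderiv_le (bound := fun ξ => ‖φ ξ‖ * ‖f ξ‖)
      (F' := fun y ξ => expDeriv y (φ ξ) (f ξ)) (s := univ)
      Filter.univ_mem (Eventually.of_forall fun y => (integrable_exp_smul hφ hf y).1)
      (integrable_exp_smul hφ hf x) (integrable_expDeriv hφ hf hf' x).1
      (ae_of_all _ fun ξ y _ => (norm_expDeriv _ _ _).le) hf'
      (ae_of_all _ fun ξ y _ => hasFDerivAt_exp_smul y _ _)
  exact key.const_smul (fourierConst n)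

end Push

theorem norm_le_sum_derivSym (ξ : Rn n) : ‖ξ‖ ≤ ∑ j, ‖derivSym j ξ‖ := by
  have h : ξ = ∑ j, ξ j • EuclideanSpace.single j (1 : ℝ) := by
    ext i
    simp [Finset.sum_apply, Pi.single_apply]
  calc ‖ξ‖ = ‖∑ j, ξ j • EuclideanSpace.single j (1 : ℝ)‖ := by rw [← h]
    _ ≤ ∑ j, ‖derivSym j ξ‖ := norm_sum_le_of_le _ fun j _ => by
      simp [norm_smul, derivSym]

/-- Bounded symbols iξ_j p for all j make |ξ| |p f| integrable, through |ξ| ≤ Σ|ξ_j|; then the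
Fourier integral can be differentiated under the integral sign. -/
theorem hasFDerivAt_eval_sm {p : Rn n →ᵇ ℂ} (q : Fin n → Rn n →ᵇ ℂ)
    (hq : ∀ j ξ, q j ξ = derivSym j ξ * p ξ) (w : FM n) (x : Rn n) :
    ∃ L : Rn n →L[ℝ] Cn n, HasFDerivAt (sm p w : Rn n → Cn n) L x ∧
      ∀ j, L (EuclideanSpace.single j 1) = sm (q j) w x := by
  obtain ⟨f, hf, e⟩ := exists_density w
  set m := w.hat.variation
  rw [e]
  have hpf := integrable_bcf_smul measurable_id hf p
  have hf' : Integrable (fun ξ => ‖(id ξ : Rn n)‖ * ‖p (id ξ) • f ξ‖) m := by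
    have hs : Integrable (fun ξ => ∑ j, ‖q j (id ξ) • f ξ‖) m :=
      integrable_finsetSum _ fun j _ => (integrable_bcf_smul measurable_id hf (q j)).norm
    refine hs.mono' ?_ (ae_of_all _ fun ξ => ?_)
    · exact measurable_norm.aestronglyMeasurable.mul hpf.1.norm
    · rw [Real.norm_of_nonneg (by positivity)]
      simp only [hq, norm_smul, norm_mul, id]
      rw [← Finset.sum_mul, ← Finset.sum_mul, mul_assoc]
      gcongr
      exact norm_le_sum_derivSym ξ
  refine ⟨_, by rw [sm_push measurable_id hf]; exact hasFDerivAt_eval_push measurable_id hpf hf' x,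
    fun j => ?_⟩
  rw [sm_push measurable_id hf, eval_push measurable_id (integrable_bcf_smul measurable_id hf (q j)),
    _root_.smul_apply, ContinuousLinearMap.integral_apply
      (integrable_expDeriv measurable_id hpf hf' x)]
  simp only [expDeriv_single, hq, mul_smul]
  rfl

theorem partialDeriv_eval_sm {p q : Rn n →ᵇ ℂ} {j : Fin n} (Q : Fin n → Rn n →ᵇ ℂ)
    (hQ : ∀ j ξ, Q j ξ = derivSym j ξ * p ξ) (hq : Q j = q) (w : FM n) (x : Rn n) :
    partialDeriv j (sm p w) x = sm q w x := by
  obtain ⟨L, hL, h⟩ := hasFDerivAt_eval_sm Q hQ w x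
  rw [partialDeriv, hL.fderiv, h, hq]

end FM
end ActiveFluid

/-! ### Laplacian, convection and the momentum equation in FM -/

namespace ActiveFluid
namespace FM

open BoundedContinuousFunction Filter Topology Duhamel

variable {n : ℕ} {lam₀ Γ₀ Γ₂ α β : ℝ}

/-! ### The Laplacian -/

theorem fderiv_eval_sm {p : Rn n →ᵇ ℂ} (q : Fin n → Rn n →ᵇ ℂ)
    (hq : ∀ j ξ, q j ξ = derivSym j ξ * p ξ) (w : FM n) (x : Rn n) :
    fderiv ℝ (sm p w : Rn n → Cn n) x =
      ∑ j, (EuclideanSpace.proj j : Rn n →L[ℝ] ℝ).smulRight (sm (q j) w x) := by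
  obtain ⟨L, hL, h⟩ := hasFDerivAt_eval_sm q hq w x
  rw [hL.fderiv]
  refine ContinuousLinearMap.coe_injective
    ((EuclideanSpace.basisFun (Fin n) ℝ).toBasis.ext fun k => ?_)
  simp [h]

/-- The symbols q and r certify that first and second derivatives are again given by bounded
multipliers; the Laplacian sums the diagonal ones, and Σ (iξ_j)² = -|ξ|². -/
theorem laplacian_eval_sm {p s : Rn n →ᵇ ℂ} (q : Fin n → Rn n →ᵇ ℂ) (r : Fin n → Fin n → Rn n →ᵇ ℂ)
    (hq : ∀ j ξ, q j ξ = derivSym j ξ * p ξ) (hr : ∀ j k ξ, r j k ξ = derivSym k ξ * q j ξ)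
    (hs : ∀ ξ, s ξ = -((‖ξ‖ : ℂ) ^ 2) * p ξ) (w : FM n) :
    Δ (sm p w : Rn n → Cn n) = sm s w := by
  rw [InnerProductSpace.laplacian_eq_iteratedFDeriv_orthonormalBasis _
    (EuclideanSpace.basisFun (Fin n) ℝ)]
  ext1 x
  have hd : DifferentiableAt ℝ (fderiv ℝ (sm p w : Rn n → Cn n)) x := by
    rw [funext (fderiv_eval_sm q hq w)]
    refine DifferentiableAt.fun_sum fun j _ => ?_
    have h1 : DifferentiableAt ℝ (sm (q j) w : Rn n → Cn n) x := by
      obtain ⟨L, hL, -⟩ := hasFDerivAt_eval_sm (r j) (hr j) w x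
      exact hL.differentiableAt
    exact (ContinuousLinearMap.smulRightL ℝ (Rn n) (Cn n)
      (EuclideanSpace.proj j : Rn n →L[ℝ] ℝ)).differentiableAt.comp x h1
  have key : ∀ j, iteratedFDeriv ℝ 2 (sm p w : Rn n → Cn n) x
      ![EuclideanSpace.basisFun (Fin n) ℝ j, EuclideanSpace.basisFun (Fin n) ℝ j] =
      sm (r j j) w x := by
    intro j
    rw [iteratedFDeriv_two_apply]
    have e1 : (fun y => fderiv ℝ (sm p w : Rn n → Cn n) y (EuclideanSpace.single j 1)) =
        sm (q j) w := funext fun y => partialDeriv_eval_sm q hq rfl w y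
    have e2 := partialDeriv_eval_sm (j := j) (r j) (hr j) rfl w x
    rw [partialDeriv, ← e1, fderiv_clm_apply hd (differentiableAt_const _)] at e2
    simpa using e2
  simp only [key]
  have hsum : s = ∑ j, r j j := by
    ext ξ
    rw [hs, BoundedContinuousFunction.sum_apply]
    simp only [hr, hq]
    have : (‖ξ‖ : ℂ) ^ 2 = ∑ j, (ξ j : ℂ) * ξ j := by
      have h := EuclideanSpace.real_norm_sq_eq ξ
      have h2 := congrArg (fun t : ℝ => (t : ℂ)) h
      push_cast at h2
      rw [h2]
      exact Finset.sum_congr rfl fun j _ => sq _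
    rw [this, neg_mul, Finset.sum_mul, ← Finset.sum_neg_distrib]
    refine Finset.sum_congr rfl fun j _ => ?_
    rw [derivSym]
    linear_combination (-(ξ j : ℂ) ^ 2 * p ξ) * Complex.I_sq
  rw [hsum, map_sum, _root_.sum_apply, eval_finset_sum]

/-- The symbol `-ξ_k ξ_j / (1 + |ξ|²)`. -/
def ddres (k j : Fin n) : Rn n →ᵇ ℂ :=
  ofNormedAddCommGroup (fun ξ => derivSym k ξ * (derivSym j ξ * res n ξ))
    ((continuous_derivSym k).mul ((continuous_derivSym j).mul (res n).continuous)) 1 fun ξ => by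
    rw [norm_mul, norm_mul, res_apply, norm_resolvent, ← mul_assoc, ← div_eq_mul_inv,
      div_le_one (one_add_sq_pos ξ)]
    have h1 := norm_derivSym_le k ξ
    have h2 := norm_derivSym_le j ξ
    calc _ ≤ ‖ξ‖ * ‖ξ‖ := by gcongr
      _ ≤ _ := by nlinarith

theorem ddres_apply (k j : Fin n) (ξ : Rn n) :
    ddres k j ξ = derivSym k ξ * (derivSym j ξ * res n ξ) := rfl

theorem resSq_eq (ξ : Rn n) : resSq n ξ = (‖ξ‖ : ℂ) ^ 2 * res n ξ := rfl

theorem laplacian_res_res (z : FM n) :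
    Δ (sm (res n) (sm (res n) z) : Rn n → Cn n) = (-sm (resSq n * res n) z : FM n).eval := by
  rw [sm_sm, laplacian_eval_sm (s := -(resSq n * res n)) (fun j => dres j * res n)
    (fun j k => ddres k j * res n)]
  · rw [map_neg]; rfl
  · intro j ξ
    simp only [BoundedContinuousFunction.mul_apply, dres_apply]; ring
  · intro j k ξ
    simp only [BoundedContinuousFunction.mul_apply, dres_apply, ddres_apply]; ring
  · intro ξ
    simp only [BoundedContinuousFunction.mul_apply, BoundedContinuousFunction.neg_apply, resSq_eq]
    ring

theorem laplacian_resSq_res (z : FM n) :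
    Δ (-sm (resSq n * res n) z : FM n).eval = sm (resSq n * resSq n) z := by
  rw [show -sm (resSq n * res n) z = sm (-(resSq n * res n)) z by rw [map_neg]; rfl,
    laplacian_eval_sm (s := resSq n * resSq n) (fun j => -(dres j * resSq n))
    (fun j k => -(ddres k j * resSq n))]
  · intro j ξ
    simp only [BoundedContinuousFunction.mul_apply, dres_apply,
      BoundedContinuousFunction.neg_apply, resSq_eq]; ring
  · intro j k ξ
    simp only [BoundedContinuousFunction.mul_apply, dres_apply, ddres_apply,
      BoundedContinuousFunction.neg_apply]; ring
  · intro ξ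
    simp only [BoundedContinuousFunction.mul_apply, BoundedContinuousFunction.neg_apply, resSq_eq]
    ring

/-! ### Divergence and convection -/

theorem dotc_helmSymbol (ξ : Rn n) (z : Cn n) : dotc ξ (helmSymbol ξ z) = 0 := by
  by_cases h : ξ = 0
  · simp [h, dotc]
  · have h2 : ((‖ξ‖ ^ 2 : ℝ) : ℂ) ≠ 0 := by
      rw [Complex.ofReal_ne_zero]; simpa using h
    rw [helmSymbol_of_ne h, helmholtzSymbol_apply]
    have : dotc ξ (z - (dotc ξ z / (‖ξ‖ ^ 2 : ℝ)) • complexify ξ) =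
        dotc ξ z - (dotc ξ z / (‖ξ‖ ^ 2 : ℝ)) * dotc ξ (complexify ξ) := by
      simp only [dotc_eq_inner, inner_sub_right, inner_smul_right]
    rw [this, dotc_complexify, div_mul_cancel₀ _ h2, sub_self]

theorem partialDeriv_res (j : Fin n) (y : FM n) (x : Rn n) :
    partialDeriv j (sm (res n) y) x = sm (dres j) y x :=
  partialDeriv_eval_sm dres dres_apply rfl y x

theorem differentiable_res (y : FM n) : Differentiable ℝ (sm (res n) y : Rn n → Cn n) := fun x =>
  let ⟨_, hL, _⟩ := hasFDerivAt_eval_sm dres dres_apply y x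
  hL.differentiableAt

/-- An element fixed by P has a density orthogonal to ξ, so the integrand of the divergence vanishes
at every frequency. -/
theorem divergence_res {y : FM n} (hy : helm y = y) (x : Rn n) :
    ∑ j, partialDeriv j (sm (res n) y) x j = 0 := by
  simp only [partialDeriv_res]
  obtain ⟨f, hf, e⟩ := exists_density y
  set m := y.hat.variation
  have hf' := integrable_helmSymbol measurable_id hf
  have e' : y = push m id (fun ξ => helmSymbol (id ξ) (f ξ)) := by
    rw [← helm_push measurable_id hf, ← e, hy]
  have hi : ∀ j, Integrable (fun ξ => dres j (id ξ) • helmSymbol (id ξ) (f ξ)) m := fun j =>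
    integrable_bcf_smul measurable_id hf' (dres j)
  have h1 : ∀ j, (sm (dres j) y x) j = (fourierConst n : ℂ) *
      ∫ ξ, Complex.exp (Complex.I * ((⟪x, ξ⟫_ℝ : ℝ) : ℂ)) *
        (dres j ξ * helmSymbol ξ (f ξ) j) ∂m := by
    intro j
    rw [e', sm_push measurable_id hf', eval_push measurable_id (hi j), PiLp.smul_apply,
      eval_integral_piLp fun i => (integrable_exp_smul measurable_id (hi j) x).eval_piLp i]
    rw [Complex.real_smul]
    rfl
  have hi' : ∀ j, Integrable (fun ξ => Complex.exp (Complex.I * ((⟪x, ξ⟫_ℝ : ℝ) : ℂ)) *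
        (dres j ξ * helmSymbol ξ (f ξ) j)) m := fun j =>
    (integrable_exp_smul measurable_id (hi j) x).eval_piLp j
  simp only [h1]
  rw [← Finset.mul_sum, ← integral_finsetSum _ fun j _ => hi' j]
  have : ∀ ξ, ∑ j, Complex.exp (Complex.I * ((⟪x, ξ⟫_ℝ : ℝ) : ℂ)) *
        (dres j ξ * helmSymbol ξ (f ξ) j) = 0 := by
    intro ξ
    have h2 : ∀ j, Complex.exp (Complex.I * ((⟪x, ξ⟫_ℝ : ℝ) : ℂ)) *
        (dres j ξ * helmSymbol ξ (f ξ) j) = (Complex.exp (Complex.I * ((⟪x, ξ⟫_ℝ : ℝ) : ℂ)) *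
        Complex.I * res n ξ) * ((ξ j : ℂ) * helmSymbol ξ (f ξ) j) := by
      intro j
      rw [dres_apply, derivSym]; ring
    simp only [h2]
    rw [← Finset.mul_sum]
    have := dotc_helmSymbol ξ (f ξ)
    rw [dotc] at this
    rw [this, mul_zero]
  simp [this]

/-- The convective derivative of `(1 - Δ)⁻¹ y`. -/
def conv (y : FM n) : FM n := ∑ j, B j (sm (res n) y) (sm (dres j) y)

theorem eval_conv (y : FM n) (x : Rn n) : conv y x = convection (sm (res n) y) x := by
  simp only [conv, eval_finset_sum, eval_B, convection, partialDeriv_res]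

theorem continuous_conv : Continuous (conv : FM n → FM n) := by
  have h1 : ∀ p : Rn n →ᵇ ℂ, Continuous fun z : FM n => sm p z := fun p => (sm p).continuous
  have h2 : ∀ j, Continuous fun z : FM n => B j (sm (res n) z) (sm (dres j) z) := fun j =>
    ((B j).continuous.comp (h1 _)).clm_apply (h1 _)
  exact continuous_finsetSum _ fun j _ => h2 j

/-- The product rule for ∂_j(u_j u) at each point; the extra term (div u)u vanishes. -/
theorem conv_eq {y : FM n} (hy : helm y = y) : conv y = ∑ j, sm (dres j) (Q j y y) := by
  refine eval_injective (funext fun x => ?_)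
  rw [eval_conv, eval_finset_sum, convection]
  set u := sm (res n) y with hu
  have h1 : ∀ j, sm (dres j) (Q j y y) x =
      partialDeriv j u x j • u x + u x j • partialDeriv j u x := by
    intro j
    rw [← partialDeriv_res, ← B_res_res, partialDeriv]
    have e : (B j u u : Rn n → Cn n) = fun x => u x j • u x := funext fun x => eval_B j u u x
    have hd : DifferentiableAt ℝ (u : Rn n → Cn n) x := differentiable_res y x
    have hdj : HasFDerivAt (fun x => u x j)
        (((EuclideanSpace.proj j : Cn n →L[ℂ] ℂ).restrictScalars ℝ).comp (fderiv ℝ u x)) x :=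
      ((EuclideanSpace.proj j : Cn n →L[ℂ] ℂ).restrictScalars ℝ).hasFDerivAt.comp x hd.hasFDerivAt
    rw [e, show (fun x => u x j • u x) = (fun x => u x j) • (u : Rn n → Cn n) from rfl,
      (hdj.smul hd.hasFDerivAt).fderiv]
    simp [partialDeriv, add_comm]
  simp only [h1]
  rw [Finset.sum_add_distrib, ← Finset.sum_smul, divergence_res hy, zero_smul, zero_add]

/-! ### The lower order terms -/

/-- The lower order terms for `u = (1 - Δ)⁻¹ y`. -/
def lower (lam₀ α β : ℝ) (y : FM n) : FM n :=
  (lam₀ : ℂ) • conv y + (α : ℂ) • sm (res n) y + (β : ℂ) • cub (sm (res n) y)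

theorem eval_lower (y : FM n) (x : Rn n) : lower lam₀ α β y x =
    lam₀ • convection (sm (res n) y) x +
      (α + β * ‖sm (res n) y x‖ ^ 2) • sm (res n) y x := by
  simp only [lower, eval_add, eval_smul, eval_conv, eval_cub]
  simp only [Complex.coe_smul]
  rw [add_smul, mul_smul, add_assoc]

theorem lowerOrderTerms_res (y : FM n) :
    lowerOrderTerms lam₀ α β (sm (res n) y) = lower lam₀ α β y :=
  ofFun_eq fun x => eval_lower y x

theorem continuous_lower : Continuous (lower lam₀ α β : FM n → FM n) := by
  have h1 : Continuous fun z : FM n => sm (res n) z := (sm (res n)).continuous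
  exact ((continuous_conv.const_smul (lam₀ : ℂ)).add (h1.const_smul (α : ℂ))).add
    ((continuous_cub.comp h1).const_smul (β : ℂ))

/-- P fixes u and turns the convective term into the projected divergence of the flux, so the P-part
of the lower order terms is αu plus the source of the evolution equation. -/
theorem helm_lower {z : FM n} (hz : helm z = z) :
    helm (lower lam₀ α β (sm (res n) z)) =
      (α : ℂ) • sm (res n) (sm (res n) z) + source lam₀ β z := by
  have hy : helm (sm (res n) z) = sm (res n) z := by rw [← sm_helm, hz]
  simp only [lower, source, conv_eq hy, map_add, map_smul, map_sum, fluxQ, cubicPart,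
    ← Finset.smul_sum, ← sm_helm, hz]
  abel

theorem pressureGradient_res (y : FM n) :
    pressureGradient lam₀ α β (sm (res n) y) =
      -(lower lam₀ α β y - helm (lower lam₀ α β y)) := by
  rw [pressureGradient, lowerOrderTerms_res, helm_apply]

theorem continuous_pressure : Continuous fun y : FM n =>
    -(lower lam₀ α β y - helm (lower lam₀ α β y)) :=
  (continuous_lower.sub (helm.continuous.comp continuous_lower)).neg

/-- With u = (1-Δ)⁻²z, the element `sm ha.elliptic z` is A_d u, that is αu - Γ₀Δu + Γ₂Δ²u. Every
term is then the value of an element of FM, and evaluation is injective. -/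
theorem momentum_iff {d D : ℝ} (ha : IsCoerciveSymbol (symbolAd Γ₀ Γ₂ α : Rn n → ℝ) d D)
    {u z : FM n} (hu : u = sm (res n) (sm (res n) z)) (w g : FM n) :
    (∀ x, w x + lam₀ • convection u x + (α + β * ‖u x‖ ^ 2) • u x
      - Γ₀ • (Δ (u : Rn n → Cn n)) x + Γ₂ • (Δ (Δ (u : Rn n → Cn n))) x + g x = 0) ↔
    w + lower lam₀ α β (sm (res n) z) + (sm ha.elliptic z - (α : ℂ) • u) + g = 0 := by
  have hell : ha.elliptic = (Γ₂ : ℂ) • (resSq n * resSq n) + (Γ₀ : ℂ) • (resSq n * res n) +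
      (α : ℂ) • (res n * res n) := by
    ext ξ
    simp only [IsCoerciveSymbol.elliptic_apply, BoundedContinuousFunction.add_apply,
      BoundedContinuousFunction.smul_apply, BoundedContinuousFunction.mul_apply, resSq_eq,
      symbolAd, smul_eq_mul]
    push_cast
    ring
  have e1 : sm ha.elliptic z - (α : ℂ) • u = (Γ₂ : ℂ) • sm (resSq n * resSq n) z +
      (Γ₀ : ℂ) • sm (resSq n * res n) z := by
    rw [hell, hu, sm_sm]
    simp only [map_add, map_smul, _root_.add_apply, _root_.smul_apply]
    abel
  have e2 : ∀ x, w x + lam₀ • convection u x + (α + β * ‖u x‖ ^ 2) • u x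
      - Γ₀ • (Δ (u : Rn n → Cn n)) x + Γ₂ • (Δ (Δ (u : Rn n → Cn n))) x + g x =
      (w + lower lam₀ α β (sm (res n) z) + (sm ha.elliptic z - (α : ℂ) • u) + g) x := by
    intro x
    rw [e1]
    simp only [eval_add, eval_smul, eval_lower, ← hu]
    rw [hu, laplacian_res_res, laplacian_resSq_res]
    have : ∀ v : FM n, (-v) x = -(v x) := fun v => by
      rw [← neg_one_smul ℂ v, eval_smul, neg_one_smul]
    rw [this, Complex.coe_smul, Complex.coe_smul, smul_neg]
    abel
  simp only [e2]
  constructor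
  · intro h
    refine eval_injective (funext fun x => ?_)
    rw [h x]
    exact (map_zero (evalCLM x)).symm
  · intro h x
    rw [h]
    exact map_zero (evalCLM x)

end FM
end ActiveFluid

/-! ### The space FM⁴, translations, and gradients in the kernel of P -/

namespace ActiveFluid
namespace FM

open BoundedContinuousFunction Filter Topology Duhamel

variable {n : ℕ}

/-! ### The space `FM⁴` -/

theorem mem_FMSobolev_push {m : Measure (Rn n)} {f : Rn n → Cn n} (hf : Integrable f m) (s : ℕ) :
    push m id f ∈ FMSobolev n s ↔ Integrable (fun ξ => ‖f ξ‖ * ‖(‖ξ‖ ^ s : ℝ)‖) m := by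
  change (push m id f).hat.Integrable (fun ξ : Rn n => ‖ξ‖ ^ s) ↔ _
  rw [hat_push, VectorMeasure.map_id]
  exact integrable_variation_withDensityᵥ hf (by fun_prop)

theorem op_pow_four_push {m : Measure (Rn n)} {f : Rn n → Cn n} (hf : Integrable f m)
    (h : Integrable (fun ξ => ‖f ξ‖ * ‖(‖ξ‖ ^ 4 : ℝ)‖) m) :
    (push m id f).op (fun ξ => ((‖ξ‖ ^ 4 : ℝ) : ℂ) • ContinuousLinearMap.id ℂ (Cn n)) =
      push m id (fun ξ => ((‖ξ‖ ^ 4 : ℝ) : ℂ) • f ξ) := by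
  have hs : (({0}ᶜ : Set (Rn n)).indicator fun ξ => ((‖ξ‖ ^ 4 : ℝ) : ℂ) •
      ContinuousLinearMap.id ℂ (Cn n)) =
      fun ξ => ((‖ξ‖ ^ 4 : ℝ) : ℂ) • ContinuousLinearMap.id ℂ (Cn n) := by
    rw [indicator_eq_self]
    intro ξ hξ
    rw [mem_compl_singleton_iff]
    rintro rfl
    refine hξ ?_
    beta_reduce
    rw [norm_zero, zero_pow four_ne_zero, Complex.ofReal_zero]
    exact zero_smul ℂ (ContinuousLinearMap.id ℂ (Cn n))
  have hc : Continuous fun ξ : Rn n => ((‖ξ‖ ^ 4 : ℝ) : ℂ) • ContinuousLinearMap.id ℂ (Cn n) := by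
    fun_prop
  rw [op_eq_wd, hs, wd_push measurable_id hf hc.stronglyMeasurable]
  · rfl
  · refine h.mono' (hf.1.norm.mul hc.norm.aestronglyMeasurable) (ae_of_all _ fun ξ => ?_)
    rw [Real.norm_of_nonneg (by positivity)]
    gcongr
    rw [id, norm_smul, Complex.norm_real]
    exact mul_le_of_le_one_right (norm_nonneg _) ContinuousLinearMap.norm_id_le

theorem integrable_resSq_smul {m : Measure (Rn n)} {f : Rn n → Cn n} (hf : Integrable f m) :
    Integrable (fun ξ => ‖(res n * res n) (id ξ) • f ξ‖ * ‖(‖ξ‖ ^ 4 : ℝ)‖) m := by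
  have := (integrable_bcf_smul measurable_id hf (resSq n * resSq n)).norm
  refine this.congr (ae_of_all _ fun ξ => ?_)
  simp only [BoundedContinuousFunction.mul_apply, resSq_eq, norm_smul, norm_mul, norm_pow,
    Complex.norm_real, norm_norm, id]
  ring

theorem res_res_mem_FMSobolev (z : FM n) : sm (res n) (sm (res n) z) ∈ FMSobolev n 4 := by
  obtain ⟨f, hf, e⟩ := exists_density z
  rw [e, sm_sm, sm_push measurable_id hf,
    mem_FMSobolev_push (integrable_bcf_smul measurable_id hf _)]
  exact integrable_resSq_smul hf

theorem op_pow_four_res_res (z : FM n) : (sm (res n) (sm (res n) z)).op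
    (fun ξ => ((‖ξ‖ ^ 4 : ℝ) : ℂ) • ContinuousLinearMap.id ℂ (Cn n)) =
      sm (resSq n * resSq n) z := by
  obtain ⟨f, hf, e⟩ := exists_density z
  rw [e, sm_sm, sm_push measurable_id hf, sm_push measurable_id hf,
    op_pow_four_push (integrable_bcf_smul measurable_id hf _) (integrable_resSq_smul hf)]
  congr 1
  ext1 ξ
  rw [smul_smul]
  congr 1
  simp only [BoundedContinuousFunction.mul_apply, resSq_eq, id]
  push_cast
  ring

theorem one_add_pow_four_ne (ξ : Rn n) : (1 + (‖ξ‖ : ℂ) ^ 4) ≠ 0 := by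
  have : (1 + ‖ξ‖ ^ 4 : ℝ) ≠ 0 := by positivity
  exact_mod_cast this

/-- The symbol `(1 + |ξ|²)² / (1 + |ξ|⁴)`. -/
def rhoQuot (n : ℕ) : Rn n →ᵇ ℂ :=
  ofNormedAddCommGroup (fun ξ => rho ξ ^ 2 * (1 + (‖ξ‖ : ℂ) ^ 4)⁻¹)
    (Continuous.mul (by unfold rho; fun_prop) (Continuous.inv₀ (by fun_prop) one_add_pow_four_ne))
    2 fun ξ => by
    have e : (1 + (‖ξ‖ : ℂ) ^ 4) = ((1 + ‖ξ‖ ^ 4 : ℝ) : ℂ) := by push_cast; rfl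
    have h0 : 0 < 1 + ‖ξ‖ ^ 4 := by positivity
    rw [norm_mul, norm_pow, norm_rho, norm_inv, e, Complex.norm_real, Real.norm_of_nonneg h0.le,
      ← div_eq_mul_inv, div_le_iff₀ h0]
    nlinarith [sq_nonneg (‖ξ‖ ^ 2 - 1)]

/-- FM⁴ lies in the range of the squared resolvent. The preimage (1-Δ)²v is written as a bounded
multiplier applied to v + |D|⁴v, so that it inherits continuity in time from these two, which is the
continuity a classical solution provides. -/
theorem res_res_of_mem_FMSobolev {v : FM n} (hv : v ∈ FMSobolev n 4) :
    v = sm (res n) (sm (res n) (sm (rhoQuot n) (v + v.op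
      (fun ξ => ((‖ξ‖ ^ 4 : ℝ) : ℂ) • ContinuousLinearMap.id ℂ (Cn n))))) := by
  obtain ⟨f, hf, e⟩ := exists_density v
  set m := v.hat.variation
  rw [e] at hv ⊢
  have h := (mem_FMSobolev_push hf 4).1 hv
  have h' : Integrable (fun ξ => ((‖ξ‖ ^ 4 : ℝ) : ℂ) • f ξ) m := by
    refine h.mono' ?_ (ae_of_all _ fun ξ => ?_)
    · exact AEStronglyMeasurable.smul (f := fun ξ : Rn n => ((‖ξ‖ ^ 4 : ℝ) : ℂ))
        (Continuous.aestronglyMeasurable (by fun_prop)) hf.1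
    · rw [norm_smul, Complex.norm_real, mul_comm]
  have hs : Integrable (fun ξ => f ξ + ((‖ξ‖ ^ 4 : ℝ) : ℂ) • f ξ) m := hf.add h'
  rw [op_pow_four_push hf h, ← push_add hf h', sm_sm, sm_sm, sm_push measurable_id hs]
  congr 1
  ext1 ξ
  have e1 : (res n * res n * rhoQuot n) (id ξ) = (1 + (‖ξ‖ : ℂ) ^ 4)⁻¹ := by
    change res n ξ * res n ξ * (rho ξ ^ 2 * (1 + (‖ξ‖ : ℂ) ^ 4)⁻¹) = _
    have := rho_mul_res ξ
    linear_combination (1 + (‖ξ‖ : ℂ) ^ 4)⁻¹ * (rho ξ * res n ξ + 1) * this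
  have e2 : f ξ + ((‖ξ‖ ^ 4 : ℝ) : ℂ) • f ξ = (1 + (‖ξ‖ : ℂ) ^ 4) • f ξ := by
    rw [add_smul, one_smul]
    push_cast
    rfl
  rw [e1, e2, smul_smul, inv_mul_cancel₀ (one_add_pow_four_ne ξ), one_smul]

/-! ### Translations -/

/-- The symbol `e^(isξ_j)` of the translation by `s e_j`. -/
def transl (j : Fin n) (s : ℝ) : Rn n →ᵇ ℂ :=
  ofNormedAddCommGroup (fun ξ => Complex.exp (Complex.I * ((s * ξ j : ℝ) : ℂ))) (by fun_prop) 1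
    fun ξ => by rw [mul_comm, Complex.norm_exp_ofReal_mul_I]

theorem transl_apply (j : Fin n) (s : ℝ) (ξ : Rn n) :
    transl j s ξ = Complex.exp (Complex.I * ((s * ξ j : ℝ) : ℂ)) := rfl

theorem norm_transl_le (j : Fin n) (s : ℝ) (ξ : Rn n) : ‖transl j s ξ‖ ≤ 1 := by
  rw [transl_apply, mul_comm, Complex.norm_exp_ofReal_mul_I]

theorem transl_zero (j : Fin n) : transl j 0 = 1 := by
  ext ξ
  simp [transl_apply]

theorem eval_transl (j : Fin n) (s : ℝ) (u : FM n) (x : Rn n) :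
    sm (transl j s) u x = u (x + s • EuclideanSpace.single j 1) := by
  obtain ⟨f, hf, e⟩ := exists_density u
  rw [e, sm_push measurable_id hf,
    eval_push measurable_id (integrable_bcf_smul measurable_id hf (transl j s)),
    eval_push measurable_id hf]
  congr 1
  refine integral_congr_ae (ae_of_all _ fun ξ => ?_)
  beta_reduce
  rw [smul_smul, transl_apply, ← Complex.exp_add, ← mul_add, ← Complex.ofReal_add, inner_add_left,
    real_inner_smul_left, EuclideanSpace.inner_single_left]
  simp

theorem continuous_transl (j : Fin n) (u : FM n) : Continuous fun s => sm (transl j s) u := by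
  refine continuous_iff_continuousAt.2 fun s => tendsto_sm (C := 1)
    (Eventually.of_forall fun r ξ => norm_transl_le j r ξ) (fun ξ => ?_) u
  simp only [transl_apply]
  exact Continuous.tendsto' (by fun_prop) _ _ rfl

/-- Translations are strongly continuous on FM; on the range of the resolvent they are
differentiable in norm, because |ξ|/(1+|ξ|²) bounds the symbols of the difference quotients. -/
theorem hasDerivAt_transl_res (j : Fin n) (u : FM n) :
    HasDerivAt (fun s => sm (transl j s) (sm (res n) u)) (sm (dres j) u) 0 := by
  rw [hasDerivAt_iff_tendsto_slope]
  set p : ℝ → Rn n →ᵇ ℂ := fun s => ((s - 0 : ℝ) : ℂ)⁻¹ • ((transl j s - transl j 0) * res n) with hp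
  have hpa : ∀ s ξ, p s ξ = ((s - 0 : ℝ) : ℂ)⁻¹ * ((transl j s ξ - transl j 0 ξ) * res n ξ) :=
    fun s ξ => rfl
  have e1 : ∀ s, slope (fun s => sm (transl j s) (sm (res n) u)) 0 s = sm (p s) u := by
    intro s
    rw [slope_def_module, hp, map_smul, _root_.smul_apply, ← sm_sm, map_sub,
      _root_.sub_apply, ← Complex.ofReal_inv, Complex.coe_smul]
  refine Tendsto.congr (fun s => (e1 s).symm) (tendsto_sm (C := 1) ?_ ?_ u)
  · refine eventually_nhdsWithin_of_forall fun s hs ξ => ?_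
    have hs : s ≠ 0 := hs
    rw [hpa, transl_zero, transl_apply, norm_mul, norm_mul, norm_inv, sub_zero, Complex.norm_real,
      res_apply, norm_resolvent, BoundedContinuousFunction.coe_one, Pi.one_apply]
    have h1 : ‖Complex.exp (Complex.I * ((s * ξ j : ℝ) : ℂ)) - 1‖ ≤ ‖s‖ * ‖ξ‖ := by
      refine (Real.norm_exp_I_mul_ofReal_sub_one_le).trans ?_
      rw [norm_mul]
      gcongr
      exact PiLp.norm_apply_le ξ j
    have hs' : 0 < ‖s‖ := norm_pos_iff.2 hs
    calc ‖s‖⁻¹ * (‖Complex.exp (Complex.I * ((s * ξ j : ℝ) : ℂ)) - 1‖ * (1 + ‖ξ‖ ^ 2)⁻¹)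
        ≤ ‖s‖⁻¹ * (‖s‖ * ‖ξ‖ * (1 + ‖ξ‖ ^ 2)⁻¹) := by gcongr
      _ = ‖ξ‖ / (1 + ‖ξ‖ ^ 2) := by field_simp
      _ ≤ 1 := by
        rw [div_le_one (one_add_sq_pos ξ)]
        nlinarith [sq_nonneg (‖ξ‖ - 1), norm_nonneg ξ]
  · intro ξ
    have hd : HasDerivAt (fun s : ℝ => transl j s ξ) (derivSym j ξ) 0 := by
      have h1 : HasDerivAt (fun s : ℝ => ((s * ξ j : ℝ) : ℂ)) ((1 * ξ j : ℝ) : ℂ) 0 :=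
        ((hasDerivAt_id (0 : ℝ)).mul_const (ξ j)).ofReal_comp
      have h2 := (h1.const_mul Complex.I).cexp
      simpa [derivSym, transl_apply] using h2
    have hs := (hasDerivAt_iff_tendsto_slope.1 hd).mul_const (res n ξ)
    rw [dres_apply]
    refine hs.congr fun s => ?_
    rw [hpa, slope_def_module, ← Complex.ofReal_inv, Complex.real_smul]
    ring

theorem continuous_eval (u : FM n) : Continuous (u : Rn n → Cn n) := by
  obtain ⟨f, hf, e⟩ := exists_density u
  have e' : (u : Rn n → Cn n) = fun x => fourierConst n •
      ∫ ξ, Complex.exp (Complex.I * ((⟪x, id ξ⟫_ℝ : ℝ) : ℂ)) • f ξ ∂u.hat.variation := by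
    ext1 x
    conv_lhs => rw [e]
    exact eval_push measurable_id hf x
  rw [e']
  have key : Continuous fun x : Rn n =>
      ∫ ξ, Complex.exp (Complex.I * ((⟪x, id ξ⟫_ℝ : ℝ) : ℂ)) • f ξ ∂u.hat.variation := by
    refine continuous_of_dominated (fun x => (integrable_exp_smul measurable_id hf x).1)
      (bound := fun ξ => ‖f ξ‖) (fun x => ae_of_all _ fun ξ => ?_) hf.norm (ae_of_all _ fun ξ => ?_)
    · rw [norm_smul, mul_comm Complex.I, Complex.norm_exp_ofReal_mul_I, one_mul]
    · fun_prop
  exact key.const_smul (fourierConst n)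

theorem eval_integral_transl (j : Fin n) (v : FM n) (s : ℝ) (x : Rn n) :
    (∫ σ in (0 : ℝ)..s, sm (transl j σ) v) x =
      ∫ σ in (0 : ℝ)..s, v (x + σ • EuclideanSpace.single j 1) := by
  have := (evalCLM x).intervalIntegral_comp_comm
    ((continuous_transl j v).intervalIntegrable (μ := volume) 0 s)
  simp only [evalCLM_apply, eval_transl] at this
  exact this.symm

theorem hasDerivAt_integral_transl (j : Fin n) (v : FM n) :
    HasDerivAt (fun s => ∫ σ in (0 : ℝ)..s, sm (transl j σ) v) v 0 := by
  have h := intervalIntegral.integral_hasDerivAt_right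
    ((continuous_transl j v).intervalIntegrable (μ := volume) 0 0)
    ((continuous_transl j v).stronglyMeasurableAtFilter _ _) (continuous_transl j v).continuousAt
  rwa [transl_zero, sm_one] at h

/-- A pointwise derivative along e_j that belongs to FM is the Fourier derivative. The fundamental
theorem of calculus along lines writes the translate of w as w plus an integral of translates of v.
Both sides, smoothed by the resolvent, are differentiated in FM at s = 0. -/
theorem sm_dres_eq_sm_res {j : Fin n} {w v : FM n}
    (h : ∀ x s, HasDerivAt (fun s : ℝ => w (x + s • EuclideanSpace.single j 1))
      (v (x + s • EuclideanSpace.single j 1)) s) : sm (dres j) w = sm (res n) v := by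
  have e : ∀ s, sm (transl j s) w = w + ∫ σ in (0 : ℝ)..s, sm (transl j σ) v := by
    intro s
    refine eval_injective (funext fun x => ?_)
    have hc : Continuous fun σ : ℝ => v (x + σ • EuclideanSpace.single j 1) :=
      (continuous_eval v).comp (by fun_prop)
    rw [eval_add, eval_integral_transl, eval_transl,
      intervalIntegral.integral_eq_sub_of_hasDerivAt (fun σ _ => h x σ) (hc.intervalIntegrable _ _)]
    simp
  have h1 := hasDerivAt_transl_res j w
  have h2 : HasDerivAt (fun s => sm (res n) (w + ∫ σ in (0 : ℝ)..s, sm (transl j σ) v))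
      (sm (res n) v) 0 :=
    ((sm (res n)).restrictScalars ℝ).hasFDerivAt.comp_hasDerivAt 0
      ((hasDerivAt_integral_transl j v).const_add w)
  refine h1.unique (h2.congr_of_eventuallyEq (Eventually.of_forall fun s => ?_))
  beta_reduce
  rw [← e, sm_sm, sm_sm, mul_comm]

/-! ### Gradient fields -/

/-- The map `z ↦ (z_k, …, z_k)`. -/
def compMap (k : Fin n) : Cn n →L[ℂ] Cn n :=
  (EuclideanSpace.proj k : Cn n →L[ℂ] ℂ).smulRight (WithLp.toLp 2 fun _ => (1 : ℂ))

theorem compMap_apply (k i : Fin n) (z : Cn n) : compMap k z i = z k := by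
  simp [compMap]

/-- The function `x ↦ (u_k(x), …, u_k(x))`. -/
def compOp (k : Fin n) : FM n →L[ℂ] FM n :=
  multiplier (fun _ => compMap k) stronglyMeasurable_const ‖compMap k‖ fun _ => le_rfl

theorem compOp_push {X : Type*} {mX : MeasurableSpace X} {m : Measure X} {φ : X → Rn n}
    (hφ : Measurable φ) (k : Fin n) {f : X → Cn n} (hf : Integrable f m) :
    compOp k (push m φ f) = push m φ (fun x => compMap k (f x)) :=
  multiplier_push hφ hf _ _

attribute [irreducible] compOp

theorem eval_compOp (k : Fin n) (u : FM n) (x : Rn n) : compOp k u x = compMap k (u x) := by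
  obtain ⟨f, hf, e⟩ := exists_density u
  rw [e, compOp_push measurable_id k hf, eval_push measurable_id ((compMap k).integrable_comp hf),
    eval_push measurable_id hf, ContinuousLinearMap.map_smul_of_tower,
    ← (compMap k).integral_comp_comm (integrable_exp_smul measurable_id hf x)]
  simp only [map_smul]

theorem sm_compOp (p : Rn n →ᵇ ℂ) (k : Fin n) (u : FM n) :
    sm p (compOp k u) = compOp k (sm p u) := by
  obtain ⟨f, hf, e⟩ := exists_density u
  rw [e, compOp_push measurable_id k hf, sm_push measurable_id ((compMap k).integrable_comp hf),
    sm_push measurable_id hf, compOp_push measurable_id k (integrable_bcf_smul measurable_id hf p)]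
  simp only [map_smul]

theorem hasDerivAt_euclidean {w : ℝ → Cn n} {w' : Cn n} {s : ℝ}
    (h : ∀ i, HasDerivAt (fun s => w s i) (w' i) s) : HasDerivAt w w' s :=
  (PiLp.continuousLinearEquiv 2 ℝ fun _ : Fin n => ℂ).symm.hasFDerivAt.comp_hasDerivAt s
    (hasDerivAt_pi.2 h)

theorem continuous_eval_line (g : FM n) (x : Rn n) (k : Fin n) :
    Continuous fun σ : ℝ => g (x + σ • EuclideanSpace.single k 1) :=
  (continuous_eval g).comp (by fun_prop)

theorem hasDerivAt_line_of_fderiv {g : Rn n → Cn n} {q : Rn n → ℂ} (hq : Differentiable ℝ q)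
    (h : ∀ x j, fderiv ℝ q x (EuclideanSpace.single j 1) = g x j) (i : Fin n) (x : Rn n) (s : ℝ) :
    HasDerivAt (fun s : ℝ => q (x + s • EuclideanSpace.single i 1))
      (g (x + s • EuclideanSpace.single i 1) i) s := by
  have h1 : HasDerivAt (fun s : ℝ => x + s • EuclideanSpace.single i (1 : ℝ))
      (EuclideanSpace.single i (1 : ℝ)) s := by
    simpa using ((hasDerivAt_id s).smul_const (EuclideanSpace.single i (1 : ℝ))).const_add x
  have h2 := (hq (x + s • EuclideanSpace.single i 1)).hasFDerivAt.comp_hasDerivAt s h1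
  rwa [h] at h2

theorem integral_line_eq_sub {w : ℝ → Cn n} (hw : Continuous w) {φ : ℝ → ℂ} {k : Fin n}
    (h : ∀ s, HasDerivAt φ (w s k) s) (r : ℝ) : (∫ σ in (0 : ℝ)..r, w σ) k = φ r - φ 0 := by
  have hck : Continuous fun σ : ℝ => w σ k := (EuclideanSpace.proj k : Cn n →L[ℂ] ℂ).continuous.comp hw
  have h2 := intervalIntegral.integral_eq_sub_of_hasDerivAt (fun σ _ => h σ)
    (hck.intervalIntegrable 0 r)
  have h3 := (EuclideanSpace.proj k : Cn n →L[ℂ] ℂ).intervalIntegral_comp_comm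
    (hw.intervalIntegrable (μ := volume) 0 r)
  exact h3.symm.trans h2

theorem eval_integral_transl_apply {g : FM n} {q : Rn n → ℂ} (hq : Differentiable ℝ q)
    (h : ∀ x j, fderiv ℝ q x (EuclideanSpace.single j 1) = g x j) (k : Fin n) (r : ℝ) (x : Rn n) :
    (∫ σ in (0 : ℝ)..r, sm (transl k σ) g) x k = q (x + r • EuclideanSpace.single k 1) - q x := by
  rw [eval_integral_transl, integral_line_eq_sub (continuous_eval_line g x k)
    (hasDerivAt_line_of_fderiv hq h k x)]
  simp

/-- The potential q need not belong to FM, so it has no Fourier transform here. Its increment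
q(·+re_k) - q does belong: it is the k-th component of an integral of translates of g. -/
theorem sm_dres_compOp_integral {g : FM n} {q : Rn n → ℂ} (hq : Differentiable ℝ q)
    (h : ∀ x j, fderiv ℝ q x (EuclideanSpace.single j 1) = g x j) (j k : Fin n) (r : ℝ) :
    sm (dres j) (compOp k (∫ σ in (0 : ℝ)..r, sm (transl k σ) g)) =
      sm (res n) (compOp j (sm (transl k r) g - g)) := by
  refine sm_dres_eq_sm_res fun x s => hasDerivAt_euclidean fun i => ?_
  have e3 : ∀ y : Rn n, (sm (transl k r) g - g) y = sm (transl k r) g y - g y := fun y => by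
    simp only [← evalCLM_apply, map_sub]
  have h1 := hasDerivAt_line_of_fderiv hq h j (x + r • EuclideanSpace.single k 1) s
  have h2 := h1.sub (hasDerivAt_line_of_fderiv hq h j x s)
  rw [eval_compOp, compMap_apply, e3, PiLp.sub_apply, eval_transl]
  simp only [eval_compOp, compMap_apply, eval_integral_transl_apply hq h]
  simp only [add_right_comm x (r • EuclideanSpace.single k (1 : ℝ))] at h2
  exact h2

/-- Differentiating the identity for increments of q at r = 0 gives ∂_j g_k = ∂_k g_j, without
second derivatives of q. -/
theorem curl_eq_zero {g : FM n} {q : Rn n → ℂ} (hq : Differentiable ℝ q)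
    (h : ∀ x j, fderiv ℝ q x (EuclideanSpace.single j 1) = g x j) (j k : Fin n) :
    sm (dres j) (compOp k g) = sm (dres k) (compOp j g) := by
  have h1 : HasDerivAt (fun r : ℝ => sm (dres j) (compOp k (∫ σ in (0 : ℝ)..r, sm (transl k σ) g)))
      (sm (dres j) (compOp k g)) 0 :=
    (((sm (dres j)).comp (compOp k)).restrictScalars ℝ).hasFDerivAt.comp_hasDerivAt 0
      (hasDerivAt_integral_transl k g)
  have h2 : HasDerivAt (fun r : ℝ => compOp j (sm (transl k r) (sm (res n) g) - sm (res n) g))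
      (compOp j (sm (dres k) g)) 0 :=
    ((compOp j).restrictScalars ℝ).hasFDerivAt.comp_hasDerivAt 0
      ((hasDerivAt_transl_res k g).sub_const _)
  rw [sm_compOp (dres k)]
  refine h1.unique (h2.congr_of_eventuallyEq (Eventually.of_forall fun r => ?_))
  beta_reduce
  rw [sm_dres_compOp_integral hq h, sm_compOp, map_sub, sm_sm, sm_sm, mul_comm]

/-- The hypothesis says ξ_j f_k = ξ_k f_j almost everywhere. Multiplying by ξ_j and summing over j
gives |ξ|² f = (ξ·f) ξ, so f is parallel to ξ and the symbol of P annihilates it. -/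
theorem helm_eq_zero_of_curl {g : FM n}
    (h : ∀ j k, sm (dres j) (compOp k g) = sm (dres k) (compOp j g)) : helm g = 0 := by
  obtain ⟨f, hf, e⟩ := exists_density g
  set m := g.hat.variation
  have hc : ∀ k, Integrable (fun ξ => compMap k (f ξ)) m := fun k =>
    (compMap k).integrable_comp hf
  have hae : ∀ j k, ∀ᵐ ξ ∂m, (ξ j : ℂ) * f ξ k = (ξ k : ℂ) * f ξ j := by
    intro j k
    have h1 := h j k
    have hs : Integrable (fun ξ => dres j (id ξ) • compMap k (f ξ) -
        dres k (id ξ) • compMap j (f ξ)) m :=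
      (integrable_bcf_smul measurable_id (hc k) _).sub (integrable_bcf_smul measurable_id (hc j) _)
    rw [e, compOp_push measurable_id k hf, compOp_push measurable_id j hf,
      sm_push measurable_id (hc k), sm_push measurable_id (hc j), ← sub_eq_zero,
      ← push_sub (integrable_bcf_smul measurable_id (hc k) _)
        (integrable_bcf_smul measurable_id (hc j) _), push_id_eq_zero_iff hs] at h1
    filter_upwards [h1] with ξ hξ
    have h2 := congrArg (fun z : Cn n => z j) hξ
    simp only [Pi.zero_apply, PiLp.sub_apply, PiLp.smul_apply, compMap_apply, PiLp.zero_apply,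
      dres_apply, derivSym, smul_eq_mul, id] at h2
    have h3 : Complex.I * res n ξ ≠ 0 := mul_ne_zero Complex.I_ne_zero (res_ne_zero ξ)
    refine sub_eq_zero.1 ((mul_eq_zero.1 (?_ : (Complex.I * res n ξ) * _ = 0)).resolve_left h3)
    rw [← h2]
    ring
  have hall : ∀ᵐ ξ ∂m, ∀ j k, (ξ j : ℂ) * f ξ k = (ξ k : ℂ) * f ξ j :=
    ae_all_iff.2 fun j => ae_all_iff.2 fun k => hae j k
  rw [e, helm_push measurable_id hf,
    push_id_eq_zero_iff (integrable_helmSymbol measurable_id hf)]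
  filter_upwards [hall] with ξ hξ
  by_cases h0 : ξ = 0
  · simp [h0, helmSymbol_zero]
  · have hn : ((‖ξ‖ ^ 2 : ℝ) : ℂ) ≠ 0 := by
      rw [Complex.ofReal_ne_zero]; simpa using h0
    rw [id, helmSymbol_of_ne h0, helmholtzSymbol_apply, Pi.zero_apply, sub_eq_zero]
    ext i
    rw [PiLp.smul_apply, smul_eq_mul, div_mul_eq_mul_div, eq_div_iff hn, ← dotc_complexify]
    simp only [dotc, complexify]
    rw [Finset.mul_sum, Finset.sum_mul]
    refine Finset.sum_congr rfl fun j _ => ?_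
    linear_combination (ξ j : ℂ) * hξ j i

theorem helm_eq_zero_of_gradient {g : FM n} {q : Rn n → ℂ} (hq : Differentiable ℝ q)
    (h : ∀ x j, fderiv ℝ q x (EuclideanSpace.single j 1) = g x j) : helm g = 0 :=
  helm_eq_zero_of_curl fun j k => curl_eq_zero hq h j k

end FM
end ActiveFluid

/-! ### Potentials for the range of I - P -/

namespace ActiveFluid
namespace FM

open BoundedContinuousFunction Filter Topology Duhamel

variable {n : ℕ}

/-! ### The range of `I - P` consists of gradient fields -/

/-- The linear form `y ↦ ∑ⱼ yⱼ zⱼ`, depending linearly on `z`. -/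
def pairing (n : ℕ) : Cn n →L[ℝ] Rn n →L[ℝ] ℂ :=
  ∑ j, ((ContinuousLinearMap.smulRightL ℝ (Rn n) ℂ (EuclideanSpace.proj j)).comp
    ((EuclideanSpace.proj j : Cn n →L[ℂ] ℂ).restrictScalars ℝ))

theorem pairing_apply (z : Cn n) (y : Rn n) : pairing n z y = dotc y z := by
  simp [pairing, dotc]

theorem pairing_single (z : Cn n) (j : Fin n) : pairing n z (EuclideanSpace.single j 1) = z j := by
  rw [pairing_apply, dotc, Finset.sum_eq_single j (fun i _ hi => by simp [hi]) (by simp)]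
  simp

theorem pairing_complexify (ξ y : Rn n) : pairing n (complexify ξ) y = (⟪y, ξ⟫_ℝ : ℝ) := by
  simp [pairing_apply, dotc, complexify, PiLp.inner_apply, mul_comm]

/-- The potential of the plane wave with frequency `ξ` and amplitude `c ξ`, respectively of the
constant field `b`. -/
def wavePotential (c : ℂ) (b : Cn n) (x ξ : Rn n) : ℂ :=
  (Complex.exp (Complex.I * ((⟪x, ξ⟫_ℝ : ℝ) : ℂ)) - 1) * (-Complex.I * c) + pairing n b x

theorem hasFDerivAt_wavePotential {c : ℂ} {b : Cn n} {ξ : Rn n} (h : ξ ≠ 0 → b = 0) (x : Rn n) :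
    HasFDerivAt (fun x => wavePotential c b x ξ) (Complex.exp (Complex.I * ((⟪x, ξ⟫_ℝ : ℝ) : ℂ)) •
      pairing n (c • complexify ξ + b)) x := by
  have h1 : HasFDerivAt (fun x : Rn n => ⟪x, ξ⟫_ℝ) (innerSL ℝ ξ) x := by
    have := (innerSL ℝ ξ).hasFDerivAt (x := x)
    simpa [real_inner_comm] using this
  have h2 : HasFDerivAt (fun x : Rn n => ((⟪x, ξ⟫_ℝ : ℝ) : ℂ))
      (Complex.ofRealCLM.comp (innerSL ℝ ξ)) x := Complex.ofRealCLM.hasFDerivAt.comp x h1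
  have h3 := (((h2.const_mul Complex.I).cexp.sub_const 1).mul_const (-Complex.I * c)).add
    (pairing n b).hasFDerivAt
  refine h3.congr_fderiv ?_
  ext y
  have e1 : pairing n (c • complexify ξ) y = c * (⟪y, ξ⟫_ℝ : ℝ) := by
    rw [← pairing_complexify, pairing_apply, pairing_apply, dotc, dotc, Finset.mul_sum]
    refine Finset.sum_congr rfl fun i _ => ?_
    rw [PiLp.smul_apply, smul_eq_mul]
    ring
  have e2 : Complex.exp (Complex.I * ((⟪x, ξ⟫_ℝ : ℝ) : ℂ)) * pairing n b y = pairing n b y := by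
    by_cases hξ : ξ = 0
    · simp [hξ]
    · simp [h hξ]
  simp only [map_add, _root_.add_apply, _root_.smul_apply, e1,
    ContinuousLinearMap.comp_apply, innerSL_apply_apply, Complex.ofRealCLM_apply, smul_eq_mul]
  rw [mul_add, e2, real_inner_comm y ξ]
  linear_combination (-Complex.exp (Complex.I * ((⟪x, ξ⟫_ℝ : ℝ) : ℂ)) * c *
    ((⟪y, ξ⟫_ℝ : ℝ) : ℂ)) * Complex.I_mul_I

/-- The -1 makes the potential vanish at x = 0, and |e^(iθ) - 1| ≤ |θ| supplies a factor |ξ|. This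
is needed because c alone, which behaves like |f|/|ξ|, may fail to be integrable near ξ = 0. -/
theorem norm_wavePotential_le {c : ℂ} {b : Cn n} {ξ : Rn n} (h : ξ ≠ 0 → b = 0) (x : Rn n) :
    ‖wavePotential c b x ξ‖ ≤ ‖x‖ * ‖c • complexify ξ + b‖ := by
  by_cases hξ : ξ = 0
  · rw [wavePotential, hξ, pairing_apply]
    have : complexify (0 : Rn n) = 0 := by
      rw [← norm_eq_zero, norm_complexify, norm_zero]
    simpa [this] using norm_dotc_le x b
  · rw [wavePotential, h hξ, map_zero, add_zero]
    simp only [_root_.zero_apply, add_zero, norm_smul, norm_mul, norm_neg,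
      Complex.norm_I, one_mul, norm_complexify]
    have h1 := (Real.norm_exp_I_mul_ofReal_sub_one_le (x := ⟪x, ξ⟫_ℝ)).trans (norm_inner_le_norm x ξ)
    calc _ ≤ ‖x‖ * ‖ξ‖ * ‖c‖ := by gcongr
      _ = _ := by ring

theorem exists_potential {m : Measure (Rn n)} {c : Rn n → ℂ} {b : Rn n → Cn n}
    (hc : AEStronglyMeasurable c m) (hb : AEStronglyMeasurable b m) (h : ∀ ξ, ξ ≠ 0 → b ξ = 0)
    (hg : Integrable (fun ξ => c ξ • complexify ξ + b ξ) m) :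
    ∃ q : Rn n → ℂ, Differentiable ℝ q ∧ ∀ x j, fderiv ℝ q x (EuclideanSpace.single j 1) =
      push m id (fun ξ => c ξ • complexify ξ + b ξ) x j := by
  set g := fun ξ => c ξ • complexify ξ + b ξ with hgd
  have hpair : Integrable (fun ξ => pairing n (g ξ)) m := (pairing n).integrable_comp hg
  have hmeas : ∀ x : Rn n, AEStronglyMeasurable (fun ξ : Rn n =>
      Complex.exp (Complex.I * ((⟪x, ξ⟫_ℝ : ℝ) : ℂ))) m := fun x =>
    Continuous.aestronglyMeasurable (by fun_prop)
  have hF : ∀ x : Rn n, Integrable (fun ξ => wavePotential (c ξ) (b ξ) x ξ) m := fun x => by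
    refine (hg.norm.const_mul ‖x‖).mono' ?_ (ae_of_all _ fun ξ => norm_wavePotential_le (h ξ) x)
    refine (((hmeas x).sub aestronglyMeasurable_const).mul (hc.const_mul _)).add ?_
    exact ((ContinuousLinearMap.apply ℝ ℂ x).comp (pairing n)).continuous.comp_aestronglyMeasurable hb
  have hD : ∀ x : Rn n, ∀ ξ, ‖Complex.exp (Complex.I * ((⟪x, ξ⟫_ℝ : ℝ) : ℂ)) • pairing n (g ξ)‖ ≤
      ‖pairing n (g ξ)‖ := fun x ξ => by
    rw [norm_smul, mul_comm Complex.I, Complex.norm_exp_ofReal_mul_I, one_mul]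
  have hDi : ∀ x : Rn n, Integrable (fun ξ =>
      Complex.exp (Complex.I * ((⟪x, ξ⟫_ℝ : ℝ) : ℂ)) • pairing n (g ξ)) m := fun x =>
    hpair.norm.mono' ((hmeas x).smul hpair.1) (ae_of_all _ (hD x))
  have key : ∀ x : Rn n, HasFDerivAt (fun x => ∫ ξ, wavePotential (c ξ) (b ξ) x ξ ∂m)
      (∫ ξ, Complex.exp (Complex.I * ((⟪x, ξ⟫_ℝ : ℝ) : ℂ)) • pairing n (g ξ) ∂m) x := fun x =>
    hasFDerivAt_integral_of_dominated_of_fderiv_le (bound := fun ξ => ‖pairing n (g ξ)‖)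
      (F' := fun x ξ => Complex.exp (Complex.I * ((⟪x, ξ⟫_ℝ : ℝ) : ℂ)) • pairing n (g ξ))
      (s := univ) Filter.univ_mem (Eventually.of_forall fun y => (hF y).1) (hF x) (hDi x).1
      (ae_of_all _ fun ξ y _ => hD y ξ) hpair.norm
      (ae_of_all _ fun ξ y _ => hasFDerivAt_wavePotential (h ξ) y)
  refine ⟨fourierConst n • fun x => ∫ ξ, wavePotential (c ξ) (b ξ) x ξ ∂m,
    fun x => ((key x).const_smul (fourierConst n)).differentiableAt, fun x j => ?_⟩
  rw [((key x).const_smul (fourierConst n)).fderiv, _root_.smul_apply,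
    ContinuousLinearMap.integral_apply (hDi x), eval_push measurable_id hg, PiLp.smul_apply]
  have h3 := (EuclideanSpace.proj j : Cn n →L[ℂ] ℂ).integral_comp_comm
    (integrable_exp_smul measurable_id hg x)
  refine congrArg (fourierConst n • ·) ((integral_congr_ae (ae_of_all _ fun ξ => ?_)).trans h3)
  simp [pairing_single]

/-- Away from the origin the density of u - Pu is (ξ·f)ξ/|ξ|², a multiple of ξ. At the origin the
symbol of P is 0, so the point mass survives as a constant field with a linear potential. -/
theorem exists_potential_sub_helm (u : FM n) :
    ∃ q : Rn n → ℂ, Differentiable ℝ q ∧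
      ∀ x j, fderiv ℝ q x (EuclideanSpace.single j 1) = (u - helm u) x j := by
  obtain ⟨f, hf, e⟩ := exists_density u
  set m := u.hat.variation
  set c : Rn n → ℂ := fun ξ => dotc ξ (f ξ) / ((‖ξ‖ ^ 2 : ℝ) : ℂ) with hc
  set b : Rn n → Cn n := ({0} : Set (Rn n)).indicator f with hb
  have hfun : (fun ξ => f ξ - helmSymbol (id ξ) (f ξ)) = fun ξ => c ξ • complexify ξ + b ξ := by
    ext1 ξ
    by_cases h : ξ = 0
    · have : complexify (0 : Rn n) = 0 := by
        rw [← norm_eq_zero, norm_complexify, norm_zero]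
      simp [h, hb, helmSymbol_zero, this]
    · rw [id, helmSymbol_of_ne h, helmholtzSymbol_apply, hb, indicator_of_notMem (by simpa using h),
        sub_sub_cancel, add_zero]
  have hg : Integrable (fun ξ => f ξ - helmSymbol (id ξ) (f ξ)) m :=
    hf.sub (integrable_helmSymbol measurable_id hf)
  have hcm : AEStronglyMeasurable c m := by
    simp only [hc, div_eq_mul_inv, dotc_eq_inner]
    refine AEStronglyMeasurable.mul ?_ (Measurable.aestronglyMeasurable (by fun_prop))
    exact continuous_complexify.aestronglyMeasurable.inner hf.1
  rw [hfun] at hg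
  obtain ⟨q, hq, h⟩ := exists_potential hcm (hf.1.indicator (measurableSet_singleton 0))
    (fun ξ hξ => indicator_of_notMem (by simpa using hξ) f) hg
  refine ⟨q, hq, fun x j => ?_⟩
  rw [h, e, helm_push measurable_id hf, ← push_sub hf (integrable_helmSymbol measurable_id hf), hfun]

end FM
end ActiveFluid

/-! ### Existence and uniqueness for the integral equation -/

namespace ActiveFluid
namespace FM

open BoundedContinuousFunction Filter Topology Duhamel

variable {n : ℕ} {lam₀ Γ₀ Γ₂ α β d D : ℝ}

/-! ### Mild solutions -/

/-- The right-hand side of the integral equation with initial value `U` at time `t₀`. -/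
def mildMap (lam₀ Γ₀ Γ₂ α β t₀ : ℝ) (U : FM n) (u : ℝ → FM n) (t : ℝ) : FM n :=
  duhamel (symbolAd Γ₀ Γ₂ α) (fun _ => 1) t₀ U (fun s => cubicPart β (u s))
    (fun s => flux lam₀ (u s)) t

theorem continuousOn_flux {u : ℝ → FM n} {S : Set ℝ} (hu : ContinuousOn u S) (j : Fin n) :
    ContinuousOn (fun s => flux lam₀ (u s) j) S :=
  (continuous_flux j).comp_continuousOn hu

theorem continuousOn_cubicPart {u : ℝ → FM n} {S : Set ℝ} (hu : ContinuousOn u S) :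
    ContinuousOn (fun s => cubicPart β (u s)) S :=
  continuous_cubicPart.comp_continuousOn hu

theorem IsCoerciveSymbol.intervalIntegrable_mild
    (ha : IsCoerciveSymbol (symbolAd Γ₀ Γ₂ α : Rn n → ℝ) d D) {t₀ t : ℝ} (ht : t₀ ≤ t)
    {u : ℝ → FM n} (hu : ContinuousOn u (Icc t₀ t)) :
    IntervalIntegrable (fun s => forcing (symbolAd Γ₀ Γ₂ α) (fun _ => 1) (t - s)
      (cubicPart β (u s)) (flux lam₀ (u s))) volume t₀ t :=
  ha.intervalIntegrable_forcing isOrder_one le_rfl (by norm_num) ht (continuousOn_cubicPart hu)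
    (continuousOn_flux hu)

/-- P fixes the Duhamel integrand and passes through the integral, so solutions of the integral
equation are solenoidal automatically. -/
theorem helm_mildMap (ha : IsCoerciveSymbol (symbolAd Γ₀ Γ₂ α : Rn n → ℝ) d D) {t₀ t : ℝ}
    (ht : t₀ ≤ t) {U : FM n} (hU : helm U = U) {u : ℝ → FM n} (hu : ContinuousOn u (Icc t₀ t)) :
    helm (mildMap lam₀ Γ₀ Γ₂ α β t₀ U u t) = mildMap lam₀ Γ₀ Γ₂ α β t₀ U u t := by
  have h := (helm (n := n)).intervalIntegral_comp_comm
    (ha.intervalIntegrable_mild (lam₀ := lam₀) (β := β) ht hu)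
  simp only [helm_forcing] at h
  rw [mildMap, duhamel, map_sub, ← sm_helm, hU, ← h]

theorem mildMap_eq (ha : IsCoerciveSymbol (symbolAd Γ₀ Γ₂ α : Rn n → ℝ) d D) {U : FM n}
    {u : ℝ → FM n} {t : ℝ} (ht : 0 ≤ t) : mildMap lam₀ Γ₀ Γ₂ α β 0 U u t =
      sm (heat (symbolAd Γ₀ Γ₂ α) (fun _ => 1) t) U -
        ∫ s in (0 : ℝ)..t, semigroupH lam₀ Γ₀ Γ₂ α β (t - s) (u s) := by
  rw [mildMap, ← IsCoerciveSymbol.eq_duhamel ha ht, sub_zero]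

theorem isGlobalMildSolution_of_eq_mildMap
    (ha : IsCoerciveSymbol (symbolAd Γ₀ Γ₂ α : Rn n → ℝ) d D) {u₀ : FM n} (hu₀ : helm u₀ = u₀)
    {u : ℝ → FM n} (huc : ContinuousOn u (Ici 0)) {R : ℝ} (hR : ∀ t, 0 ≤ t → ‖u t‖ ≤ R)
    (hu : ∀ t, 0 ≤ t → u t = mildMap lam₀ Γ₀ Γ₂ α β 0 u₀ u t) :
    IsGlobalMildSolution lam₀ Γ₀ Γ₂ α β u₀ u := by
  obtain ⟨C, hN⟩ := isSingularNonlinearity_semigroupH ha lam₀ β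
  refine ⟨fun t ht => ?_, huc, ⟨R, hR⟩, fun t ht => ?_, fun t ht => ?_⟩
  · rw [mem_FM₀σ_iff, hu t ht]
    exact helm_mildMap ha ht hu₀ (huc.mono Icc_subset_Ici_self)
  · exact hN.intervalIntegrable ht (huc.mono fun s hs => hs.1.le) fun s hs => hR s hs.1.le
  · rw [semigroup_eq ha ht hu₀, ← mildMap_eq ha ht]
    exact hu t ht

theorem eq_mildMap_of_isGlobalMildSolution
    (ha : IsCoerciveSymbol (symbolAd Γ₀ Γ₂ α : Rn n → ℝ) d D) {u₀ : FM n} (hu₀ : helm u₀ = u₀)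
    {u : ℝ → FM n} (hu : IsGlobalMildSolution lam₀ Γ₀ Γ₂ α β u₀ u) {t : ℝ} (ht : 0 ≤ t) :
    u t = mildMap lam₀ Γ₀ Γ₂ α β 0 u₀ u t := by
  rw [mildMap_eq ha ht, ← semigroup_eq ha ht hu₀]
  exact hu.formula t ht

theorem eq_of_eq_mildMap (ha : IsCoerciveSymbol (symbolAd Γ₀ Γ₂ α : Rn n → ℝ) d D) {u₀ : FM n}
    {u v : ℝ → FM n} (huc : ContinuousOn u (Ici 0)) (hvc : ContinuousOn v (Ici 0))
    (hu : ∀ t, 0 ≤ t → u t = mildMap lam₀ Γ₀ Γ₂ α β 0 u₀ u t)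
    (hv : ∀ t, 0 ≤ t → v t = mildMap lam₀ Γ₀ Γ₂ α β 0 u₀ v t) {t : ℝ} (ht : 0 ≤ t) :
    u t = v t := by
  obtain ⟨C, hN⟩ := isSingularNonlinearity_semigroupH ha lam₀ β
  exact hN.eqOn_of_eq_integral (huc.mono Icc_subset_Ici_self) (hvc.mono Icc_subset_Ici_self)
    (fun s hs => (hu s hs.1).trans (mildMap_eq ha hs.1))
    (fun s hs => (hv s hs.1).trans (mildMap_eq ha hs.1)) (right_mem_Icc.2 ht)

theorem continuousOn_heat_orbit (ha : IsCoerciveSymbol (symbolAd Γ₀ Γ₂ α : Rn n → ℝ) d D)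
    (u₀ : FM n) :
    ContinuousOn (fun t => sm (heat (symbolAd Γ₀ Γ₂ α) (fun _ => 1) t) u₀) (Ici 0) :=
  ha.continuousOn_heat_one.comp (f := fun t : ℝ => (t, u₀)) (by fun_prop)
    fun t ht => ⟨ht, mem_univ _⟩

/-- The threshold gives r ≤ 1 and 40Kr ≤ 1, so the left side is at most K · 5 · 4r = 20Kr ≤ 1/2. -/
theorem small_radius {K r : ℝ} (hK : 0 ≤ K) (hr : 0 ≤ r) (h : r < 1 / (40 * (K + 1))) :
    K * ((1 + 4 * r) * (4 * r)) ≤ 1 / 2 := by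
  rw [lt_div_iff₀ (by positivity)] at h
  have h1 : r ≤ 1 := by nlinarith
  have h2 : K * ((1 + 4 * r) * (4 * r)) ≤ K * (5 * (4 * r)) := by gcongr; linarith
  nlinarith

theorem exp_arith {d t r x : ℝ} (hd : 0 < d) (ht : 0 ≤ t) (hr : 0 ≤ r)
    (hx : x ≤ Real.exp (-(d * t)) * r) : x ≤ Real.exp (-(d / 2 * t)) * r := by
  refine hx.trans (mul_le_mul_of_nonneg_right (Real.exp_le_exp.2 ?_) hr)
  nlinarith

/-- The linear part decays like e^(-dt), the Duhamel kernel only like e^(-dτ/2), and the fixed point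
argument keeps half of the latter rate: hence d/4. -/
theorem exists_eq_mildMap (ha : IsCoerciveSymbol (symbolAd Γ₀ Γ₂ α : Rn n → ℝ) d D)
    (lam₀ β : ℝ) : ∃ κ, 0 < κ ∧ ∀ u₀ : FM n, ‖u₀‖ < κ → ∃ u : ℝ → FM n,
      ContinuousOn u (Ici 0) ∧ (∀ t, 0 ≤ t → ‖u t‖ ≤ 2 * Real.exp (-(d / 4) * t) * ‖u₀‖) ∧
      ∀ t, 0 ≤ t → u t = mildMap lam₀ Γ₀ Γ₂ α β 0 u₀ u t := by
  obtain ⟨C, hN⟩ := isSingularNonlinearity_semigroupH ha lam₀ β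
  have hK : 0 ≤ C * singMass (1 / 4) (d / 2 / 2) :=
    mul_nonneg hN.nonneg (singMass_pos (by norm_num) (by linarith [ha.pos])).le
  refine ⟨1 / (40 * (C * singMass (1 / 4) (d / 2 / 2) + 1)), by positivity, fun u₀ hu₀ => ?_⟩
  obtain ⟨u, huc, hub, hu⟩ := hN.exists_eq_integral (norm_nonneg u₀) (continuousOn_heat_orbit ha u₀)
    (fun t ht => exp_arith ha.pos ht (norm_nonneg _) ((norm_sm_apply_le _ _).trans
      (mul_le_mul_of_nonneg_right (ha.norm_heat_one_le ht) (norm_nonneg _))))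
    (small_radius hK (norm_nonneg _) hu₀)
  refine ⟨u, huc, fun t ht => (hub t ht).trans_eq ?_, fun t ht => ?_⟩
  · rw [show -(d / 4) * t = -(d / 2 / 2 * t) by ring]
    ring
  · rw [mildMap_eq ha ht]
    exact hu t ht

end FM
end ActiveFluid

/-! ### Equivalence of mild and classical solutions -/

namespace ActiveFluid
namespace FM

open BoundedContinuousFunction Filter Topology Duhamel

variable {n : ℕ} {lam₀ Γ₀ Γ₂ α β d D : ℝ}

/-! ### Mild solutions are classical solutions -/

theorem helm_eq_of_sm_res {y : FM n} (h : helm (sm (res n) y) = sm (res n) y) : helm y = y :=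
  sm_res_injective (by rw [sm_helm, h])

theorem isClassicalSolution_of_smooth
    (ha : IsCoerciveSymbol (symbolAd Γ₀ Γ₂ α : Rn n → ℝ) d D) {u₀ : FM n} {u y z : ℝ → FM n}
    (h0 : u 0 = u₀) (huc : ContinuousOn u (Ici 0)) (hmem : ∀ t, 0 ≤ t → helm (u t) = u t)
    (hyc : ContinuousOn y (Ioi 0)) (hzc : ContinuousOn z (Ioi 0))
    (huy : ∀ t, 0 < t → u t = sm (res n) (y t)) (hyz : ∀ t, 0 < t → y t = sm (res n) (z t))
    (hder : ∀ t, 0 < t → HasDerivAt u (-(sm ha.elliptic (z t) + source lam₀ β (z t))) t) :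
    IsClassicalSolution lam₀ Γ₀ Γ₂ α β u₀ u (fun t => pressureGradient lam₀ α β (u t)) := by
  have huz : ∀ t, 0 < t → u t = sm (res n) (sm (res n) (z t)) := fun t ht => by
    rw [huy t ht, hyz t ht]
  have hy : ∀ t, 0 < t → helm (y t) = y t := fun t ht =>
    helm_eq_of_sm_res (by rw [← huy t ht, hmem t ht.le])
  have hz : ∀ t, 0 < t → helm (z t) = z t := fun t ht =>
    helm_eq_of_sm_res (by rw [← hyz t ht, hy t ht])
  have hp : ∀ t, 0 < t → pressureGradient lam₀ α β (u t) =
      -(lower lam₀ α β (y t) - helm (lower lam₀ α β (y t))) := fun t ht => by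
    rw [huy t ht, pressureGradient_res]
  refine ⟨fun t ht => mem_FM₀σ_iff.2 (hmem t ht), h0, huc,
    fun t ht => (hder t ht).differentiableAt, ?_, fun t ht => ?_, ?_, ?_, fun t ht => ?_,
    fun t ht x => ?_, fun t ht => ?_⟩
  · have h1 : ContinuousOn (fun t => -(sm ha.elliptic (z t) + source lam₀ β (z t))) (Ioi 0) :=
      (((sm ha.elliptic).continuous.comp_continuousOn hzc).add
        (continuous_source.comp_continuousOn hzc)).neg
    exact h1.congr fun t ht => (hder t ht).deriv
  · rw [huz t ht]
    exact res_res_mem_FMSobolev _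
  · have h1 : ContinuousOn (fun t => sm (resSq n * resSq n) (z t)) (Ioi 0) :=
      (sm (resSq n * resSq n)).continuous.comp_continuousOn hzc
    refine h1.congr fun t ht => ?_
    beta_reduce
    rw [huz t ht, op_pow_four_res_res]
  · exact (continuous_pressure.comp_continuousOn hyc).congr hp
  · obtain ⟨q, hq, h⟩ := exists_potential_sub_helm (-lower lam₀ α β (y t))
    refine ⟨q, hq, fun x j => (h x j).trans ?_⟩
    rw [hp t ht, map_neg, neg_sub_neg, neg_sub]
  · rw [huy t ht]
    exact divergence_res (hy t ht) x
  -- The evolution equation is the P-part of the momentum equation, and the pressure gradient is by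
  -- definition minus the complementary part of the lower order terms.
  · rw [momentum_iff ha (huz t ht), (hder t ht).deriv, hp t ht, hyz t ht, helm_lower (hz t ht),
      ← huz t ht]
    abel

theorem isClassicalSolution_of_eq_mildMap
    (ha : IsCoerciveSymbol (symbolAd Γ₀ Γ₂ α : Rn n → ℝ) d D) {u₀ : FM n} (hu₀ : helm u₀ = u₀)
    {u : ℝ → FM n} (huc : ContinuousOn u (Ici 0))
    (hu : ∀ t, 0 ≤ t → u t = mildMap lam₀ Γ₀ Γ₂ α β 0 u₀ u t) :
    IsClassicalSolution lam₀ Γ₀ Γ₂ α β u₀ u (fun t => pressureGradient lam₀ α β (u t)) := by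
  obtain ⟨y, z, hyc, hzc, huy, hyz, hder, -⟩ := ha.exists_smoothing huc hu
  refine isClassicalSolution_of_smooth ha ?_ huc (fun t ht => ?_) hyc hzc huy hyz hder
  · rw [hu 0 le_rfl, mildMap_eq ha le_rfl, IsCoerciveSymbol.heat_zero ha, sm_one,
      intervalIntegral.integral_same, sub_zero]
  · rw [hu t ht]
    exact helm_mildMap ha ht hu₀ (huc.mono Icc_subset_Ici_self)

theorem integrableOn_rpow_neg_half_add_one (C : ℝ) {T : ℝ} (hT : 0 < T) :
    IntegrableOn (fun t : ℝ => C * (t ^ (-(1 / 2) : ℝ) + 1)) (Ioo 0 T) := by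
  have h1 : IntegrableOn (fun t : ℝ => t ^ (-(1 / 2) : ℝ)) (Ioo 0 T) :=
    (intervalIntegral.integrableOn_Ioo_rpow_iff hT).2 (by norm_num)
  exact (h1.add (integrableOn_const (by simp))).const_mul C

theorem norm_conv_le {y : FM n} {R : ℝ} (hR : ‖sm (res n) y‖ ≤ R) :
    ‖conv y‖ ≤ (∑ j : Fin n, fourierConst n * R * ‖(dres j : Rn n →ᵇ ℂ)‖) * ‖y‖ := by
  rw [conv, Finset.sum_mul]
  refine norm_sum_le_of_le _ fun j _ => (norm_B_le _ _ _).trans ?_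
  have hc := (fourierConst_pos n).le
  rw [mul_assoc _ ‖(dres j : Rn n →ᵇ ℂ)‖]
  exact mul_le_mul (mul_le_mul_of_nonneg_left hR hc) (norm_sm_apply_le _ _) (norm_nonneg _)
    (mul_nonneg hc ((norm_nonneg _).trans hR))

theorem continuous_local_terms (α β : ℝ) :
    Continuous fun w : FM n => (α : ℂ) • w + (β : ℂ) • cub w := by
  have h1 : Continuous fun w : FM n => (α : ℂ) • w := continuous_const_smul _
  have h2 : Continuous fun w : FM n => (β : ℂ) • cub w := continuous_cub.const_smul (β : ℂ)
  exact h1.add h2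

/-- Only the convective term is singular at t = 0. It is bilinear in u and ∇u, where u is bounded
and ∇u is controlled by y, hence by t^(-1/2) + 1. -/
theorem integrableOn_pressureGradient
    (ha : IsCoerciveSymbol (symbolAd Γ₀ Γ₂ α : Rn n → ℝ) d D) {u₀ : FM n}
    {u : ℝ → FM n} (huc : ContinuousOn u (Ici 0)) {R : ℝ} (hR : ∀ t, 0 ≤ t → ‖u t‖ ≤ R)
    (hu : ∀ t, 0 ≤ t → u t = mildMap lam₀ Γ₀ Γ₂ α β 0 u₀ u t) {T : ℝ} (hT : 0 < T) :
    IntegrableOn (fun t => pressureGradient lam₀ α β (u t)) (Ioo 0 T) := by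
  obtain ⟨y, z, hyc, -, huy, -, -, hyb⟩ := ha.exists_smoothing huc hu
  obtain ⟨C, hC⟩ := hyb T
  have h1 : IntegrableOn (fun t => conv (y t)) (Ioo 0 T) := by
    set K := ∑ j : Fin n, fourierConst n * R * ‖(dres j : Rn n →ᵇ ℂ)‖
    have hK : 0 ≤ K := Finset.sum_nonneg fun j _ => mul_nonneg (mul_nonneg (fourierConst_pos n).le
      ((norm_nonneg _).trans (hR 0 le_rfl))) (norm_nonneg _)
    have hm : AEStronglyMeasurable (fun t => conv (y t)) (volume.restrict (Ioo 0 T)) :=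
      ((continuous_conv.comp_continuousOn hyc).mono fun t ht => ht.1).aestronglyMeasurable
        measurableSet_Ioo
    refine ((integrableOn_rpow_neg_half_add_one C hT).const_mul K).mono' hm ?_
    refine (ae_restrict_iff' measurableSet_Ioo).2 (ae_of_all _ fun t ht => ?_)
    refine (norm_conv_le (R := R) (by rw [← huy t ht.1]; exact hR t ht.1.le)).trans ?_
    exact mul_le_mul_of_nonneg_left (hC t ⟨ht.1, ht.2.le⟩) hK
  have h2 : IntegrableOn (fun t => (α : ℂ) • u t + (β : ℂ) • cub (u t)) (Ioo 0 T) := by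
    have hT : ContinuousOn (fun t => (α : ℂ) • u t + (β : ℂ) • cub (u t)) (Icc 0 T) :=
      (continuous_local_terms α β).comp_continuousOn (huc.mono Icc_subset_Ici_self)
    exact hT.integrableOn_Icc.mono_set Ioo_subset_Icc_self
  have h3 : IntegrableOn (fun t => (lam₀ : ℂ) • conv (y t) +
      ((α : ℂ) • u t + (β : ℂ) • cub (u t))) (Ioo 0 T) := (h1.smul (lam₀ : ℂ)).add h2
  have h4 : IntegrableOn (fun t => lower lam₀ α β (y t)) (Ioo 0 T) :=
    IntegrableOn.congr_fun h3 (fun t ht => by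
      rw [lower, ← add_assoc, ← huy t ht.1]) measurableSet_Ioo
  have h5 : IntegrableOn (fun t => helm (lower lam₀ α β (y t))) (Ioo 0 T) :=
    helm.integrable_comp h4
  have h6 : IntegrableOn (fun t => -(lower lam₀ α β (y t) - helm (lower lam₀ α β (y t))))
    (Ioo 0 T) := (h4.sub h5).neg
  refine IntegrableOn.congr_fun h6 (fun t ht => ?_) measurableSet_Ioo
  rw [huy t ht.1, pressureGradient_res]

/-! ### Classical solutions are mild solutions -/

section Classical

variable {u₀ : FM n} {v g : ℝ → FM n} (hv : IsClassicalSolution lam₀ Γ₀ Γ₂ α β u₀ v g)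
include hv

theorem helm_deriv_of_isClassicalSolution {t : ℝ} (ht : 0 < t) :
    helm (deriv v t) = deriv v t := by
  have h1 : HasDerivAt v (deriv v t) t := (hv.differentiableAt t ht).hasDerivAt
  have h2 : HasDerivAt (fun s => helm (v s)) (helm (deriv v t)) t :=
    ((helm (n := n)).restrictScalars ℝ).hasFDerivAt.comp_hasDerivAt t h1
  refine h2.unique (h1.congr_of_eventuallyEq ?_)
  filter_upwards [Ioi_mem_nhds ht] with s hs
  exact mem_FM₀σ_iff.1 (hv.mem s (le_of_lt hs))

/-- Apply P to the momentum identity in FM: it annihilates g and fixes the solenoidal terms, which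
leaves the evolution equation. Substituting this back determines g. -/
theorem exists_smooth_of_isClassicalSolution
    (ha : IsCoerciveSymbol (symbolAd Γ₀ Γ₂ α : Rn n → ℝ) d D) :
    ∃ z : ℝ → FM n, ContinuousOn z (Ioi 0) ∧
      (∀ t, 0 < t → v t = sm (res n) (sm (res n) (z t))) ∧
      (∀ t, 0 < t → HasDerivAt v (-(sm ha.elliptic (z t) + source lam₀ β (z t))) t) ∧
      ∀ t, 0 < t → g t = pressureGradient lam₀ α β (v t) := by
  set z : ℝ → FM n := fun t => sm (rhoQuot n) (v t + (v t).op
    (fun ξ => ((‖ξ‖ ^ 4 : ℝ) : ℂ) • ContinuousLinearMap.id ℂ (Cn n))) with hz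
  have hvz : ∀ t, 0 < t → v t = sm (res n) (sm (res n) (z t)) := fun t ht =>
    res_res_of_mem_FMSobolev (hv.mem_sobolev t ht)
  have hmem : ∀ t, 0 < t → helm (v t) = v t := fun t ht => mem_FM₀σ_iff.1 (hv.mem t ht.le)
  have hzh : ∀ t, 0 < t → helm (z t) = z t := fun t ht =>
    helm_eq_of_sm_res (helm_eq_of_sm_res (by
      rw [← hvz t ht, hmem t ht]))
  have heq : ∀ t, 0 < t → deriv v t + lower lam₀ α β (sm (res n) (z t)) +
      (sm ha.elliptic (z t) - (α : ℂ) • v t) + g t = 0 := fun t ht =>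
    (momentum_iff ha (hvz t ht) _ _).1 (hv.momentum t ht)
  have hg : ∀ t, 0 < t → helm (g t) = 0 := fun t ht => by
    obtain ⟨q, hq, h⟩ := hv.gradient t ht
    exact helm_eq_zero_of_gradient hq h
  have hd : ∀ t, 0 < t → deriv v t = -(sm ha.elliptic (z t) + source lam₀ β (z t)) := by
    intro t ht
    have h := congrArg helm (heq t ht)
    rw [map_add, map_add, map_add, map_sub, map_smul, hg t ht, hmem t ht,
      helm_deriv_of_isClassicalSolution hv ht, ← sm_helm, hzh t ht, helm_lower (hzh t ht),
      ← hvz t ht, map_zero] at h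
    rw [eq_neg_iff_add_eq_zero, ← h]
    abel
  refine ⟨z, ?_, hvz, fun t ht => ?_, fun t ht => ?_⟩
  · exact (sm (rhoQuot n)).continuous.comp_continuousOn
      ((hv.continuousOn.mono Ioi_subset_Ici_self).add hv.continuousOn_sobolev)
  · rw [← hd t ht]
    exact (hv.differentiableAt t ht).hasDerivAt
  · have h := heq t ht
    rw [hd t ht] at h
    rw [hvz t ht, pressureGradient_res, helm_lower (hzh t ht), ← hvz t ht,
      ← sub_eq_zero, ← h]
    abel

/-- The equation holds only for t > 0, so the variation of constants formula is first obtained on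
[ε,t]. As ε → 0 the semigroup term converges by continuity of v at 0, and the missing piece of the
integral vanishes because the singular integrand is integrable. -/
theorem eq_mildMap_of_isClassicalSolution
    (ha : IsCoerciveSymbol (symbolAd Γ₀ Γ₂ α : Rn n → ℝ) d D) {t : ℝ} (ht : 0 ≤ t) :
    v t = mildMap lam₀ Γ₀ Γ₂ α β 0 u₀ v t := by
  rcases ht.eq_or_lt with rfl | ht
  · rw [mildMap_eq ha le_rfl, ha.heat_zero, sm_one, intervalIntegral.integral_same, sub_zero,
      hv.initial]
  obtain ⟨z, hzc, hvz, hder, -⟩ := exists_smooth_of_isClassicalSolution hv ha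
  set f : ℝ → FM n := fun s => forcing (symbolAd Γ₀ Γ₂ α) (fun _ => 1) (t - s)
    (cubicPart β (v s)) (flux lam₀ (v s)) with hf
  have hfi : IntervalIntegrable f volume 0 t :=
    ha.intervalIntegrable_mild ht.le (hv.continuousOn.mono Icc_subset_Ici_self)
  have hε : ∀ ε ∈ Ioo 0 t, v t = sm (heat (symbolAd Γ₀ Γ₂ α) (fun _ => 1) (t - ε)) (v ε) -
      ((∫ s in (0 : ℝ)..t, f s) - ∫ s in (0 : ℝ)..ε, f s) := by
    intro ε hε
    have h := ha.duhamel_of_hasDerivAt hε.2.le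
      (hv.continuousOn.mono (Icc_subset_Ici_self.trans (Ici_subset_Ici.2 hε.1.le)))
      ((continuous_source (lam₀ := lam₀) (β := β)).comp_continuousOn
        (hzc.mono fun s hs => hε.1.trans_le hs.1))
      (fun s hs => hvz s (hε.1.trans hs.1)) (fun s hs => hder s (hε.1.trans hs.1))
    rw [h]
    congr 1
    rw [intervalIntegral.integral_interval_sub_left hfi (hfi.mono_set (uIcc_subset_uIcc_left (by
      rw [uIcc_of_le ht.le]; exact ⟨hε.1.le, hε.2.le⟩)))]
    rw [intervalIntegral.integral_of_le hε.2.le, intervalIntegral.integral_of_le hε.2.le,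
      integral_Ioc_eq_integral_Ioo, integral_Ioc_eq_integral_Ioo]
    refine setIntegral_congr_fun measurableSet_Ioo fun s hs => ?_
    simp only [hf]
    rw [hvz s (hε.1.trans hs.1)]
    exact (ha.forcing_res_res (sub_pos.2 hs.2) _).symm
  have hlim1 : Tendsto (fun ε => sm (heat (symbolAd Γ₀ Γ₂ α) (fun _ => 1) (t - ε)) (v ε))
      (𝓝[Ioo 0 t] 0) (𝓝 (sm (heat (symbolAd Γ₀ Γ₂ α) (fun _ => 1) (t - 0)) (v 0))) := by
    have h1 : ContinuousOn (fun ε => sm (heat (symbolAd Γ₀ Γ₂ α) (fun _ => 1) (t - ε)) (v ε))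
        (Icc 0 t) :=
      ha.continuousOn_heat_one.comp (f := fun ε : ℝ => (t - ε, v ε))
        ((continuousOn_const.sub continuousOn_id).prodMk (hv.continuousOn.mono Icc_subset_Ici_self))
        fun ε hε => ⟨sub_nonneg.2 hε.2, mem_univ _⟩
    exact (h1 0 ⟨le_rfl, ht.le⟩).mono_left (nhdsWithin_mono _ Ioo_subset_Icc_self)
  have hlim2 : Tendsto (fun ε => ∫ s in (0 : ℝ)..ε, f s) (𝓝[Ioo 0 t] 0) (𝓝 0) := by
    have h1 := intervalIntegral.continuousOn_primitive_interval
      ((intervalIntegrable_iff' (by simp)).1 hfi)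
    rw [uIcc_of_le ht.le] at h1
    have h2 := (h1 0 ⟨le_rfl, ht.le⟩).mono_left (nhdsWithin_mono _ Ioo_subset_Icc_self)
    beta_reduce at h2
    rwa [intervalIntegral.integral_same] at h2
  have hlim := hlim1.sub (hlim2.const_sub (∫ s in (0 : ℝ)..t, f s))
  have hne : (𝓝[Ioo 0 t] (0 : ℝ)).NeBot := left_nhdsWithin_Ioo_neBot ht
  have h := tendsto_nhds_unique (hlim.congr' (eventually_nhdsWithin_of_forall fun ε h =>
    (hε ε h).symm)) tendsto_const_nhds
  rw [← h, mildMap, duhamel, hv.initial, sub_zero (∫ s in (0 : ℝ)..t, f s)]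

end Classical

end FM
end ActiveFluid

/-! ### Real-valued data, and the theorem -/

namespace ActiveFluid
namespace FM

open BoundedContinuousFunction Filter Topology Duhamel

variable {n : ℕ} {lam₀ Γ₀ Γ₂ α β d D : ℝ}

/-! ### Real-valued solutions -/

theorem derivSym_neg (j : Fin n) (ξ : Rn n) : derivSym j (-ξ) = (starRingEnd ℂ) (derivSym j ξ) := by
  simp [derivSym]

theorem conj_sm_dres (j : Fin n) (u : FM n) : conj (sm (dres j) u) = sm (dres j) (conj u) :=
  conj_sm (fun ξ => by simp [dres_apply, derivSym_neg, res_apply]) u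

theorem conj_cubicPart (u : FM n) : conj (cubicPart β u) = cubicPart β (conj u) := by
  rw [cubicPart, conj_smul, Complex.conj_ofReal, conj_cub, cubicPart]

theorem conj_flux (u : FM n) (j : Fin n) : conj (flux lam₀ u j) = flux lam₀ (conj u) j := by
  rw [flux, conj_smul, Complex.conj_ofReal, conj_B, flux]

theorem conj_conv (y : FM n) : conj (conv y) = conv (conj y) := by
  simp only [conv, map_sum, conj_B, conj_sm_res, conj_sm_dres]

theorem conj_lower (y : FM n) : conj (lower lam₀ α β y) = lower lam₀ α β (conj y) := by
  simp only [lower, map_add, conj_smul, Complex.conj_ofReal, conj_conv, conj_sm_res, conj_cub]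

namespace IsCoerciveSymbol

variable {a : Rn n → ℝ} (ha : IsCoerciveSymbol a d D)
include ha

theorem conj_sm_heat_one {τ : ℝ} (hτ : 0 ≤ τ) (u : FM n) :
    conj (sm (heat a (fun _ => 1) τ) u) = sm (heat a (fun _ => 1) τ) (conj u) :=
  conj_sm (fun ξ => by rw [ha.heat_one_apply hτ, ha.heat_one_apply hτ, ha.even,
    Complex.conj_ofReal]) u

theorem conj_sm_heat_derivSym {τ : ℝ} (hτ : 0 < τ) (j : Fin n) (u : FM n) :
    conj (sm (heat a (fun ξ => 1 * derivSym j ξ) τ) u) =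
      sm (heat a (fun ξ => 1 * derivSym j ξ) τ) (conj u) := by
  have h : (fun ξ => 1 * derivSym j ξ) = derivSym j := funext fun ξ => one_mul _
  rw [h]
  refine conj_sm (fun ξ => ?_) u
  rw [ha.heat_apply (isOrder_derivSym j) (by norm_num) (by norm_num) hτ,
    ha.heat_apply (isOrder_derivSym j) (by norm_num) (by norm_num) hτ, ha.even, map_mul,
    derivSym_neg, Complex.conj_ofReal]

theorem conj_forcing {τ : ℝ} (hτ : 0 < τ) (F : FM n) (f : Fin n → FM n) :
    conj (forcing a (fun _ => 1) τ F f) =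
      forcing a (fun _ => 1) τ (conj F) (fun j => conj (f j)) := by
  simp only [forcing, map_add, map_sum, ha.conj_sm_heat_one hτ.le, ha.conj_sm_heat_derivSym hτ,
    conj_helm]

end IsCoerciveSymbol

theorem conj_mildMap (ha : IsCoerciveSymbol (symbolAd Γ₀ Γ₂ α : Rn n → ℝ) d D) {U : FM n}
    {u : ℝ → FM n} {t : ℝ} (ht : 0 ≤ t) (hu : ContinuousOn u (Icc 0 t)) :
    conj (mildMap lam₀ Γ₀ Γ₂ α β 0 U u t) =
      mildMap lam₀ Γ₀ Γ₂ α β 0 (conj U) (fun s => conj (u s)) t := by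
  have h := (conj (n := n)).intervalIntegral_comp_comm
    (ha.intervalIntegrable_mild (lam₀ := lam₀) (β := β) ht hu)
  rw [mildMap, duhamel, map_sub, ha.conj_sm_heat_one (by linarith), ← h, mildMap, duhamel]
  congr 1
  rw [intervalIntegral.integral_of_le ht, intervalIntegral.integral_of_le ht,
    integral_Ioc_eq_integral_Ioo, integral_Ioc_eq_integral_Ioo]
  refine setIntegral_congr_fun measurableSet_Ioo fun s hs => ?_
  rw [ha.conj_forcing (sub_pos.2 hs.2), conj_cubicPart]
  congr 1
  exact funext fun j => conj_flux _ j

/-- The symbol a is even and the parameters are real, so the conjugate of u solves the integral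
equation with the same initial value; uniqueness gives conj u = u. -/
theorem isReal_of_eq_mildMap (ha : IsCoerciveSymbol (symbolAd Γ₀ Γ₂ α : Rn n → ℝ) d D)
    {u₀ : FM n} {u : ℝ → FM n} (huc : ContinuousOn u (Ici 0))
    (hu : ∀ t, 0 ≤ t → u t = mildMap lam₀ Γ₀ Γ₂ α β 0 u₀ u t) (h0 : u₀.IsReal) {t : ℝ}
    (ht : 0 ≤ t) : (u t).IsReal := by
  rw [isReal_iff] at h0 ⊢
  refine eq_of_eq_mildMap ha (u := fun s => conj (u s)) (conj.continuous.comp_continuousOn huc) huc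
    (fun s hs => ?_) hu ht
  conv_lhs => rw [hu s hs]
  rw [conj_mildMap ha hs (huc.mono Icc_subset_Ici_self), h0]

theorem isReal_pressureGradient {u y : FM n} (h : u = sm (res n) y) (hu : u.IsReal) :
    (pressureGradient lam₀ α β u).IsReal := by
  rw [isReal_iff] at hu ⊢
  have hy : conj y = y := sm_res_injective (by rw [← conj_sm_res, ← h, hu])
  rw [h, pressureGradient_res, map_neg, map_sub, conj_helm, conj_lower, hy]

end FM
end ActiveFluid

end

open ActiveFluid in
theorem theorem3p10 (n : ℕ) (hn : n = 2 ∨ n = 3) (lam₀ Γ₀ Γ₂ α β : ℝ)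
    (hΓ₂ : 0 < Γ₂) (hβ : 0 < β)
    (hstable : (Γ₀ < 0 ∧ Γ₀ ^ 2 / Γ₂ < 4 * α) ∨ (0 ≤ Γ₀ ∧ 0 < α)) :
    ∃ κ C ω : ℝ, 0 < κ ∧ 0 < C ∧ 0 < ω ∧
      ∀ u₀ : FM n, u₀ ∈ FM₀σ n → ‖u₀‖ < κ →
        ∃ u : ℝ → FM n,
          IsGlobalMildSolution lam₀ Γ₀ Γ₂ α β u₀ u ∧
          (∀ v : ℝ → FM n, IsGlobalMildSolution lam₀ Γ₀ Γ₂ α β u₀ v → ∀ t, 0 ≤ t → v t = u t) ∧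
          (∀ t, 0 ≤ t → ‖u t‖ ≤ C * Real.exp (-ω * t) * ‖u₀‖) ∧
          (∀ T : ℝ, 0 < T → IntegrableOn (fun t => pressureGradient lam₀ α β (u t)) (Ioo 0 T)) ∧
          IsClassicalSolution lam₀ Γ₀ Γ₂ α β u₀ u (fun t => pressureGradient lam₀ α β (u t)) ∧
          (∀ v g : ℝ → FM n, IsClassicalSolution lam₀ Γ₀ Γ₂ α β u₀ v g →
            (∀ t, 0 ≤ t → v t = u t) ∧ ∀ t, 0 < t → g t = pressureGradient lam₀ α β (u t)) ∧
          (u₀.IsReal → ∀ t, 0 ≤ t →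
            (u t).IsReal ∧ (0 < t → (pressureGradient lam₀ α β (u t)).IsReal)) := by
  obtain ⟨d, D, ha⟩ := FM.isCoerciveSymbol_symbolAd n hΓ₂ hstable
  obtain ⟨κ, hκ, h⟩ := FM.exists_eq_mildMap ha lam₀ β
  refine ⟨κ, 2, d / 4, hκ, two_pos, by linarith [ha.pos], fun u₀ hu₀ hsmall => ?_⟩
  obtain ⟨u, huc, hub, hu⟩ := h u₀ hsmall
  have hh₀ : FM.helm u₀ = u₀ := FM.mem_FM₀σ_iff.1 hu₀
  have hR : ∀ t, 0 ≤ t → ‖u t‖ ≤ 2 * ‖u₀‖ := fun t ht => by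
    have h1 : Real.exp (-(d / 4) * t) ≤ 1 :=
      Real.exp_le_one_iff.2 (by nlinarith [mul_nonneg ha.pos.le ht])
    refine (hub t ht).trans ?_
    nlinarith [norm_nonneg u₀]
  have huniq : ∀ v g : ℝ → FM n, IsClassicalSolution lam₀ Γ₀ Γ₂ α β u₀ v g →
      ∀ t, 0 ≤ t → v t = u t := fun v g hv t ht =>
    FM.eq_of_eq_mildMap ha hv.continuousOn huc
      (fun s hs => FM.eq_mildMap_of_isClassicalSolution hv ha hs) hu ht
  refine ⟨u, FM.isGlobalMildSolution_of_eq_mildMap ha hh₀ huc hR hu, fun v hv t ht => ?_, hub,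
    fun T hT => FM.integrableOn_pressureGradient ha huc hR hu hT,
    FM.isClassicalSolution_of_eq_mildMap ha hh₀ huc hu,
    fun v g hv => ⟨huniq v g hv, fun t ht => ?_⟩, fun h0 t ht => ?_⟩
  · exact FM.eq_of_eq_mildMap ha hv.continuousOn huc
      (fun s hs => FM.eq_mildMap_of_isGlobalMildSolution ha hh₀ hv hs) hu ht
  · obtain ⟨z, -, -, -, hg⟩ := FM.exists_smooth_of_isClassicalSolution hv ha
    rw [hg t ht, huniq v g hv t ht.le]
  · have hreal := FM.isReal_of_eq_mildMap ha huc hu h0 ht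
    refine ⟨hreal, fun ht' => ?_⟩
    -- Reality of ∇q is read off from y = (1-Δ)u, which is real because the resolvent is injective
    -- and commutes with conjugation.
    obtain ⟨y, z, -, -, huy, -⟩ := ha.exists_smoothing huc hu
    exact FM.isReal_pressureGradient (huy t ht') hreal
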